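/- Let $q\ge 1$. For each $n\ge 1$ let $(\Omega_n,\mathcal F_n,P_n)$ be a probability space with a filtration $\mathcal F_{n,0}\subseteq\dots\subseteq\mathcal F_{n,m_n}\subseteq\mathcal F_n$, where $m_n=O(n)$, and let $\mathbf X_{n,m}=(X_{n,m,1},\dots,X_{n,m,q})$, $0\le m\le m_n$, be $\mathcal F_{n,m}$-measurable random vectors in $\mathbb R^q$ with $X_{n,m,k}\le C_0n$ a.s. for a constant $C_0$ and with square-integrable increments $\Delta \mathbf X_{n,m}=\mathbf X_{n,m}-\mathbf X_{n,m-1}$. Let $\|\cdot\|=\|\cdot\|_\infty$. Let $D\subset\mathbb R^q$ be a bounded connected open set that contains the closure of $\{z: P_n[\mathbf X_{n,0}=nz]\ne 0\text{ for some }n\}$, and let $H_D$ be the least $m$ with $n^{-1}\mathbf X_{n,m}\notin D$ ($\infty$ if there is none). Let $f_k,g_{ij}:\mathbb R^q\to\mathbb R$ ($1\le i,j,k\le q$) be functions and $\beta,\lambda_1,\lambda_2$ functions of $n$ such that $\beta\ge1$, $\beta=o(n^{1/12-\varepsilon})$ for some $\varepsilon>0$, $\lambda_1=o(n^{-1/2})$,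 $\lambda_2=o(1)$, and, for all $i,j,k$ and all $1\le m\le m_n$, almost surely on $\{m\le H_D\}$, - $\|\Delta\mathbf X_{n,m}\|\le\beta$; - $|\mathbb E[\Delta X_{n,m,k}\mid\mathcal F_{n,m-1}]-f_k(n^{-1}\mathbf X_{n,m-1})|\le\lambda_1$; - $|\mathbb E[\Delta X_{n,m,i}\,\Delta X_{n,m,j}\mid\mathcal F_{n,m-1}]-g_{ij}(n^{-1}\mathbf X_{n,m-1})|\le\lambda_2$. Assume that all $f_k$ and $g_{ij}$ are Lipschitz on $D$ and that every $f_k$ is $C^1$ on $D$. Write $F=(f_1,\dots,f_q)'$ and $G=(g_{ij})$, let $J$ be the Jacobian matrix of $F$, and for $y\in D$ let $\mathbf z_y$ denote the solution in $D$ of $\mathbf z'=F(\mathbf z)$, $\mathbf z(0)=y$. For $\delta\in\mathbb R$ let $\sigma(y,\delta)$ be the supremum of the times $t\ge0$ to which $\mathbf z_y$ extends while staying at $L_\infty$-distance greater than $\delta$ from the boundary of $D$ ($-\infty$ if there are none). Then for every $x\in D$ and every $0<\tau\le\infty$ such that $\mathbf z_x$ exists on $[0,\tau)$ there is a continuous matrix-valued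 function $\Sigma:\mathbb R\to\mathbb R^{q\times q}$, given on $[0,\tau)$ by $\Sigma=T^{-1}\,\Xi\,(T^{-1})'$, where, with $A(t)=J(\mathbf z_x(t))$, $$T'=-TA,\quad T(0)=I,\qquad \Xi'=T\bigl(G(\mathbf z_x)-F(\mathbf z_x)F(\mathbf z_x)^{\top}\bigr)T^{\top},\quad \Xi(0)=0,$$ (here $T',\Xi'$ are derivatives, and $T(t)$ is invertible), such that the following holds. Let $\lambda=\lambda(n)$ satisfy $\lambda\sqrt n\to\infty$ and let $C>0$. Let $n_k\ge1$ be integers with $n_k\to\infty$, let $x_k\to x$ with $P_{n_k}[\mathbf X_{n_k,0}=n_kx_k]>0$, and let $m(k)$ be integers with $0\le m(k)\le m_{n_k}$, such that $\mathbf z_{x_k}$ exists on $[0,m(k)/n_k]$, $m(k)\le\sigma(x_k,C\lambda(n_k))\,n_k$, and $m(k)/n_k\to t$ for some $t\le\tau$. Then $\Sigma(t)$ is positive semidefinite and, conditionally on $\mathbf X_{n_k,0}=n_kx_k$, $$\frac{\mathbf X_{n_k,m(k)}-n_k\,\mathbf z_{x_k}(m(k)/n_k)}{\sqrt{n_k}}\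 \xrightarrow{d}\ \mathcal N(0,\Sigma(t))\qquad(k\to\infty).$$ In particular, if $\mathbf X_{n,0}=nx$ a.s. for all $n$, this holds unconditionally with $n_k=k$ and $\mathbf z_{x_k}=\mathbf z_x$. -/

import Mathlib

open MeasureTheory ProbabilityTheory Filter Topology Asymptotics
open scoped NNReal ENNReal

noncomputable section

/-- The exit time `H_D`: the least `m` such that `n⁻¹ X_m ∉ D` (`⊤` if there is none). -/
def exitTime {Ω : Type*} {q : ℕ} (n : ℕ) (X : ℕ → Ω → Fin q → ℝ) (D : Set (Fin q → ℝ))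
    (ω : Ω) : ℕ∞ :=
  sInf {h : ℕ∞ | ∃ m : ℕ, h = (m : ℕ∞) ∧ (n : ℝ)⁻¹ • X m ω ∉ D}

/-- The values `z` that `n⁻¹ X_{n,0}` takes with positive probability for some `n ≥ 1`. -/
def initialValues {Ω : ℕ → Type*} [∀ n, MeasurableSpace (Ω n)] (P : ∀ n, Measure (Ω n)) {q : ℕ}
    (X : ∀ n, ℕ → Ω n → Fin q → ℝ) : Set (Fin q → ℝ) :=
  {z | ∃ n : ℕ, 0 < n ∧ P n {ω | X n 0 ω = (n : ℝ) • z} ≠ 0}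

/-- The vector field `F = (f_1, …, f_q)`. -/
def driftField {q : ℕ} (f : Fin q → (Fin q → ℝ) → ℝ) (v : Fin q → ℝ) : Fin q → ℝ :=
  fun k => f k v

/-- The Jacobian matrix `(∂f_i / ∂z_j)(v)`. -/
def jacobian {q : ℕ} (f : Fin q → (Fin q → ℝ) → ℝ) (v : Fin q → ℝ) :
    Matrix (Fin q) (Fin q) ℝ :=
  Matrix.of fun i j => fderiv ℝ (f i) v (Pi.single j 1)

/-- `z` solves `dz_k/dt = f_k(z)`, `z(0) = x`, on the interval `I`, and stays in `D` there
(one-sided derivatives at end points of `I` that belong to `I`). -/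
structure IsSolutionOn {q : ℕ} (f : Fin q → (Fin q → ℝ) → ℝ) (D : Set (Fin q → ℝ))
    (x : Fin q → ℝ) (z : ℝ → Fin q → ℝ) (I : Set ℝ) : Prop where
  init : z 0 = x
  mem : ∀ s ∈ I, z s ∈ D
  deriv : ∀ s ∈ I, HasDerivWithinAt z (driftField f (z s)) I s

/-- The supremum of the times `t ≥ 0` to which the solution from `x` extends before reaching
within `L_∞`-distance `δ` of the boundary of `D` (`⊥` if there is no such time). -/
def sigma {q : ℕ} (f : Fin q → (Fin q → ℝ) → ℝ) (D : Set (Fin q → ℝ)) (x : Fin q → ℝ)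
    (δ : ℝ) : EReal :=
  sSup {u : EReal | ∃ t : ℝ, u = (t : EReal) ∧ 0 ≤ t ∧ ∃ z : ℝ → Fin q → ℝ,
    IsSolutionOn f D x z (Set.Icc 0 t) ∧ ∀ s ∈ Set.Icc 0 t, δ < Metric.infDist (z s) (frontier D)}

/-- The time interval `[0, τ)`, where `τ = ⊤` is allowed. -/
def timeInterval (τ : EReal) : Set ℝ := {s | 0 ≤ s ∧ (s : EReal) < τ}

/-- Entrywise derivative `dM/dt = V` of a matrix-valued function on `I`. -/
def HasMatrixDerivOn {q : ℕ} (M V : ℝ → Matrix (Fin q) (Fin q) ℝ) (I : Set ℝ) : Prop :=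
  ∀ s ∈ I, ∀ i j, HasDerivWithinAt (fun u => M u i j) (V s i j) I s

/-- The systems that determine the covariance matrix along a solution `z` on `I`:
`T' = -T A`, `T(0) = 1`, where `A(t)` is the Jacobian at `z(t)`;
`Ξ' = T (G(z) - F(z) F(z)ᵀ) Tᵀ`, `Ξ(0) = 0`; and `Σ = T⁻¹ Ξ (T⁻¹)ᵀ`. -/
structure IsCovarianceSystem {q : ℕ} (f : Fin q → (Fin q → ℝ) → ℝ)
    (g : Fin q → Fin q → (Fin q → ℝ) → ℝ) (z : ℝ → Fin q → ℝ) (I : Set ℝ)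
    (T Ξ S : ℝ → Matrix (Fin q) (Fin q) ℝ) : Prop where
  T_zero : T 0 = 1
  T_deriv : HasMatrixDerivOn T (fun s => -(T s * jacobian f (z s))) I
  T_inv : ∀ s ∈ I, IsUnit (T s).det
  Ξ_zero : Ξ 0 = 0
  Ξ_deriv : HasMatrixDerivOn Ξ (fun s => T s *
    (Matrix.of (fun i j => g i j (z s)) -
      Matrix.vecMulVec (driftField f (z s)) (driftField f (z s))) * (T s).transpose) I
  S_eq : ∀ s ∈ I, S s = (T s)⁻¹ * Ξ s * ((T s)⁻¹).transpose

/-- `(X_m - n z(m/n)) / √n`, as a random vector in Euclidean space. -/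
def normalized {Ω : Type*} {q : ℕ} (n : ℕ) (X : ℕ → Ω → Fin q → ℝ) (z : ℝ → Fin q → ℝ)
    (m : ℕ) (ω : Ω) : EuclideanSpace ℝ (Fin q) :=
  WithLp.toLp 2 fun k => (X m ω k - (n : ℝ) * z ((m : ℝ) / (n : ℝ)) k) / Real.sqrt (n : ℝ)

end

/-! Let `y j = z_{x_k}(j/n)` and let `W j = (X j - n y j) / √n`, frozen after the exit from `D`.
Linearizing `F` along the fluid path shows that the conditional drift of `W` is about `A(j/n) W /
n`. Its conditional second moments are about `M(j/n) / n` with `M = G - F Fᵀ`; the term `- F Fᵀ`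
comes from centring each step by `n (y (j+1) - y j) ≈ F`. The steps of `W` have size `O(β / √n) →
0`. So `W` is a discrete form of the linear diffusion with drift matrix `A` and diffusion matrix `M`
started at `0`, whose law at time `t` is `N(0, Σ(t))`.

The limit is identified by characteristic functions. For `t' < τ` put `u' = u T(t')⁻¹`, `a(s) = u'
T(s)` and `ψ(s) = u' Ξ(s) u'ᵀ`. Then `a' = -a A`, `a(t') = u`, `ψ' = a M aᵀ`, `ψ(t') = u Σ(t') uᵀ`.
The row vector cancels the linear drift and `ψ` cancels the variance, so `exp(i a·W + ψ/2)` is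
nearly a martingale. One step changes its mean by `O(e/n)` with `e` arbitrarily small
(`IsAdaptedWalk.norm_integral_exp_succ_sub_le`), and `O(n)` steps keep it near `1`. All coefficient
errors have the form `e (1 + W·W)`, so only a uniform second moment bound is required; it is a
discrete Gronwall estimate (`IsAdaptedWalk.integral_dotProduct_self_le`).

The exit from `D` needs no separate probability estimate. The fluid path keeps a distance `r = C λ`
from the boundary with `√n r → ∞`, so after the exit `‖W‖ ≥ √n r` (`le_norm_stoppedWalk`). The
discrepancy between the frozen walk and the linear dynamics is then absorbed by the term `e W·W`,
and at the end the same lower bound gives a Chebyshev estimate for the effect of stopping.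

The path `z` need not exist at `τ`. Since `F` and `G` are Lipschitz on the bounded set `D`, the
coefficients of the linear systems are bounded, so `Σ` extends continuously; the case `t = τ`
follows by comparing `W` at times near `t' < t` and `t` in mean square. `Σ(t)` is symmetric because
conditional second moments are, and nonnegative because characteristic functions have modulus at
most `1`. Lévy's continuity theorem concludes. -/

/-! ### Linear integral equations with bounded measurable coefficients -/

section LinearODE

variable {E : Type*} [NormedAddCommGroup E] [NormedSpace ℝ E]

theorem stronglyMeasurable_exp_smul_clm_apply {L : ℝ → E →L[ℝ] E} (hL : StronglyMeasurable L)
    {v : ℝ → E} (hv : Continuous v) (c : ℝ) :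
    StronglyMeasurable fun s => Real.exp (c * s) • L s (v s) :=
  StronglyMeasurable.smul (by fun_prop : Continuous fun s : ℝ => Real.exp (c * s)).stronglyMeasurable
    (isBoundedBilinearMap_apply.continuous.comp_stronglyMeasurable (hL.prodMk hv.stronglyMeasurable))

theorem norm_exp_smul_clm_apply_le {L : ℝ → E →L[ℝ] E} {K : ℝ} (hK : ∀ s, ‖L s‖ ≤ K)
    {v : ℝ → E} {M : ℝ} (hv : ∀ s, ‖v s‖ ≤ M) (c s : ℝ) :
    ‖Real.exp (c * s) • L s (v s)‖ ≤ K * M * Real.exp (c * s) := by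
  rw [norm_smul, Real.norm_of_nonneg (Real.exp_pos _).le, mul_comm]
  refine mul_le_mul_of_nonneg_right ((L s).le_opNorm_of_le (hv s) |>.trans ?_) (Real.exp_pos _).le
  exact mul_le_mul_of_nonneg_right (hK s) ((norm_nonneg _).trans (hv s))

theorem intervalIntegrable_exp_smul_clm_apply {L : ℝ → E →L[ℝ] E} (hL : StronglyMeasurable L)
    {K : ℝ} (hK : ∀ s, ‖L s‖ ≤ K) {v : ℝ → E} (hv : Continuous v) {M : ℝ}
    (hM : ∀ s, ‖v s‖ ≤ M) (c a b : ℝ) :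
    IntervalIntegrable (fun s => Real.exp (c * s) • L s (v s)) volume a b := by
  have h : IntervalIntegrable (fun s => K * M * Real.exp (c * s)) volume a b :=
    (by fun_prop : Continuous fun s => K * M * Real.exp (c * s)).intervalIntegrable a b
  refine h.mono_fun' (stronglyMeasurable_exp_smul_clm_apply hL hv c).aestronglyMeasurable ?_
  exact ae_of_all _ fun s => norm_exp_smul_clm_apply_le hK hM c s

/-- Integrating `exp (c s)` gains a factor `1 / c`, so in the weighted sup norm the Picard operator
contracts on the whole half-line once `c > K`. -/
theorem norm_exp_neg_smul_integral_le {L : ℝ → E →L[ℝ] E}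
    {K : ℝ} (hK : ∀ s, ‖L s‖ ≤ K) {v : ℝ → E} {M : ℝ}
    (hM : ∀ s, ‖v s‖ ≤ M) {c : ℝ} (hc : 0 < c) {t : ℝ} (ht : 0 ≤ t) :
    ‖Real.exp (-(c * t)) • ∫ s in (0)..t, Real.exp (c * s) • L s (v s)‖ ≤ K * M / c := by
  have hKM : 0 ≤ K * M :=
    mul_nonneg ((norm_nonneg _).trans (hK 0)) ((norm_nonneg _).trans (hM 0))
  have h1 : ‖∫ s in (0)..t, Real.exp (c * s) • L s (v s)‖ ≤
      ∫ s in (0)..t, K * M * Real.exp (c * s) :=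
    intervalIntegral.norm_integral_le_of_norm_le ht
      (ae_of_all _ fun s _ => norm_exp_smul_clm_apply_le hK hM c s)
      ((by fun_prop : Continuous fun s => K * M * Real.exp (c * s)).intervalIntegrable _ _)
  have h2 : ∫ s in (0)..t, K * M * Real.exp (c * s) =
      K * M / c * Real.exp (c * t) - K * M / c * Real.exp (c * 0) := by
    refine intervalIntegral.integral_eq_sub_of_hasDerivAt
      (f := fun s => K * M / c * Real.exp (c * s)) (fun s _ => ?_)
      ((by fun_prop : Continuous fun s => K * M * Real.exp (c * s)).intervalIntegrable _ _)
    have := (((hasDerivAt_id s).const_mul c).exp).const_mul (K * M / c)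
    refine this.congr_deriv ?_
    simp
    field_simp
  rw [norm_smul, Real.norm_of_nonneg (Real.exp_pos _).le]
  calc Real.exp (-(c * t)) * ‖∫ s in (0)..t, Real.exp (c * s) • L s (v s)‖
      ≤ Real.exp (-(c * t)) * (K * M / c * Real.exp (c * t)) := by
        gcongr
        rw [h2] at h1
        have : 0 ≤ K * M / c * Real.exp (c * 0) := by positivity
        linarith
    _ = K * M / c := by
        rw [mul_left_comm, ← Real.exp_add]; simp

/-- A linear integral equation with bounded measurable coefficients has a continuous solution. -/
theorem exists_continuous_eq_add_integral [CompleteSpace E] {L : ℝ → E →L[ℝ] E}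
    (hL : StronglyMeasurable L) {K : ℝ} (hK : ∀ s, ‖L s‖ ≤ K) (x₀ : E) :
    ∃ w : ℝ → E, Continuous w ∧ ∀ t, 0 ≤ t → w t = x₀ + ∫ s in (0)..t, L s (w s) := by
  have hK0 : 0 ≤ K := (norm_nonneg _).trans (hK 0)
  -- The contraction constant is `K / c`, hence at most `1 / 2`; the summand `1` keeps `c` positive
  -- when `K = 0`.
  set c : ℝ := 2 * K + 1 with hc
  have hc0 : 0 < c := by positivity
  have hint (v : BoundedContinuousFunction ℝ E) (a b : ℝ) :=
    intervalIntegrable_exp_smul_clm_apply hL hK v.continuous v.norm_coe_le_norm c a b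
  -- The unknown is `v t = exp (-c t) w t`, which is bounded although `w` may grow. Replacing `t` by
  -- `max t 0` freezes it at negative times.
  let Φ : BoundedContinuousFunction ℝ E → BoundedContinuousFunction ℝ E := fun v =>
    BoundedContinuousFunction.ofNormedAddCommGroup
      (fun t => Real.exp (-(c * max t 0)) • x₀ +
        Real.exp (-(c * max t 0)) • ∫ s in (0)..(max t 0), Real.exp (c * s) • L s (v s))
      (by
        have h1 := (intervalIntegral.continuous_primitive (hint v) 0).comp
          (by fun_prop : Continuous fun t : ℝ => max t 0)
        exact (Continuous.smul (by fun_prop) continuous_const).add (Continuous.smul (by fun_prop) h1))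
      (‖x₀‖ + K * ‖v‖ / c)
      (fun t => by
        refine (norm_add_le _ _).trans (add_le_add ?_ ?_)
        · rw [norm_smul, Real.norm_of_nonneg (Real.exp_pos _).le]
          refine mul_le_of_le_one_left (norm_nonneg _) ?_
          rw [Real.exp_le_one_iff]
          have : 0 ≤ max t 0 := le_max_right _ _
          nlinarith
        · exact norm_exp_neg_smul_integral_le hK v.norm_coe_le_norm hc0 (le_max_right _ _))
  have hΦ : ContractingWith (1 / 2 : ℝ≥0) Φ := by
    refine ⟨by
      rw [← NNReal.coe_lt_coe]; norm_num, LipschitzWith.of_dist_le_mul fun v w => ?_⟩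
    rw [dist_eq_norm, dist_eq_norm]
    refine BoundedContinuousFunction.norm_le (by positivity) |>.2 fun t => ?_
    have h1 : (Φ v - Φ w) t = Real.exp (-(c * max t 0)) •
        ∫ s in (0)..(max t 0), Real.exp (c * s) • L s ((v - w) s) := by
      have h2 : (fun s => Real.exp (c * s) • L s ((v - w) s)) =
          fun s => Real.exp (c * s) • L s (v s) - Real.exp (c * s) • L s (w s) := by
        ext s; simp [smul_sub]
      rw [h2, intervalIntegral.integral_sub (hint v _ _) (hint w _ _), smul_sub]
      simp [Φ]
    rw [h1]
    refine (norm_exp_neg_smul_integral_le hK (v - w).norm_coe_le_norm hc0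
      (le_max_right _ _)).trans ?_
    rw [div_le_iff₀ hc0]
    have := norm_nonneg (v - w)
    push_cast
    rw [hc]
    nlinarith
  obtain ⟨v, hv⟩ : ∃ v, Φ v = v := ⟨_, hΦ.fixedPoint_isFixedPt⟩
  refine ⟨fun t => Real.exp (c * t) • v t, by
    exact Continuous.smul (by fun_prop) v.continuous, fun t ht => ?_⟩
  have h1 : v t = Real.exp (-(c * t)) • x₀ +
      Real.exp (-(c * t)) • ∫ s in (0)..t, Real.exp (c * s) • L s (v s) := by
    conv_lhs => rw [← hv]
    simp [Φ, max_eq_left ht]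
  simp only [map_smul]
  rw [h1, ← smul_add, smul_smul, ← Real.exp_add]
  simp

end LinearODE

/-! ### Existence of `T`, `Ξ` and a continuous `Σ` on all of `ℝ` -/

section CovarianceSystem

theorem convex_timeInterval (τ : EReal) : Convex ℝ (timeInterval τ) := by
  refine Set.OrdConnected.convex ⟨fun a ha b hb s hs => ⟨ha.1.trans hs.1, ?_⟩⟩
  exact (EReal.coe_le_coe_iff.2 hs.2).trans_lt hb.2

theorem zero_mem_timeInterval {τ : EReal} (hτ : 0 < τ) : (0 : ℝ) ∈ timeInterval τ :=
  ⟨le_rfl, by simpa using hτ⟩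

theorem isOpen_setOf_coe_lt (τ : EReal) : IsOpen {s : ℝ | (s : EReal) < τ} :=
  isOpen_lt continuous_coe_real_ereal continuous_const

/-- Extension of a function on `[0, τ)` by a constant to the left and by `0` to the right. -/
noncomputable def extendTimeInterval {E : Type*} [Zero E] (τ : EReal) (φ : ℝ → E) : ℝ → E := by
  classical exact {s : ℝ | (s : EReal) < τ}.piecewise (fun s => φ (max s 0)) 0

section Extend

variable {E : Type*} [NormedAddCommGroup E] {τ : EReal} {φ : ℝ → E}

theorem extendTimeInterval_of_mem {s : ℝ} (hs : s ∈ timeInterval τ) :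
    extendTimeInterval τ φ s = φ s := by
  rw [extendTimeInterval, Set.piecewise_eq_of_mem _ _ _ (show s ∈ {s : ℝ | (s : EReal) < τ} from hs.2),
    max_eq_left hs.1]

theorem continuousOn_extendTimeInterval (hτ : 0 < τ) (hφ : ContinuousOn φ (timeInterval τ)) :
    ContinuousOn (extendTimeInterval τ φ) {s : ℝ | (s : EReal) < τ} := by
  have h : ContinuousOn (fun s => φ (max s 0)) {s : ℝ | (s : EReal) < τ} := by
    refine hφ.comp (by fun_prop) fun s hs => ⟨le_max_right _ _, ?_⟩
    rcases max_choice s 0 with h | h <;> rw [h]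
    · exact hs
    · simpa using hτ
  exact h.congr fun s hs => Set.piecewise_eq_of_mem _ _ _ hs

theorem norm_extendTimeInterval_le (hτ : 0 < τ) {K : ℝ} (hK : ∀ s ∈ timeInterval τ, ‖φ s‖ ≤ K)
    (s : ℝ) : ‖extendTimeInterval τ φ s‖ ≤ K := by
  have hK0 : 0 ≤ K := (norm_nonneg _).trans (hK 0 (zero_mem_timeInterval hτ))
  by_cases hs : (s : EReal) < τ
  · rw [extendTimeInterval, Set.piecewise_eq_of_mem _ _ _
      (show s ∈ {s : ℝ | (s : EReal) < τ} from hs)]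
    refine hK _ ⟨le_max_right _ _, ?_⟩
    rcases max_choice s 0 with h | h <;> rw [h]
    · exact hs
    · simpa using hτ
  · rw [extendTimeInterval, Set.piecewise_eq_of_notMem _ _ _
      (show s ∉ {s : ℝ | (s : EReal) < τ} from hs)]
    simpa using hK0

theorem stronglyMeasurable_extendTimeInterval [NormedSpace ℝ E] [FiniteDimensional ℝ E]
    (hτ : 0 < τ) (hφ : ContinuousOn φ (timeInterval τ)) :
    StronglyMeasurable (extendTimeInterval τ φ) := by
  classical
  borelize E
  have : ProperSpace E := FiniteDimensional.proper ℝ E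
  refine Measurable.stronglyMeasurable ?_
  have h : ContinuousOn (fun s => φ (max s 0)) {s : ℝ | (s : EReal) < τ} :=
    (continuousOn_extendTimeInterval hτ hφ).congr fun s hs => by
      rw [extendTimeInterval, Set.piecewise_eq_of_mem _ _ _ hs]
  exact h.measurable_piecewise (continuousOn_const (c := (0 : E)))
    (isOpen_setOf_coe_lt τ).measurableSet

/-- The integral equation is solved past `τ`, where the extended coefficient may jump. Before `τ`
the integrand is continuous on an open set, so the fundamental theorem of calculus applies there. -/
theorem hasDerivWithinAt_of_eq_add_integral [NormedSpace ℝ E] [CompleteSpace E] {w ψ : ℝ → E}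
    {x₀ : E} (hw : ∀ t, 0 ≤ t → w t = x₀ + ∫ s in (0)..t, ψ s)
    (hint : ∀ t, IntervalIntegrable ψ volume 0 t) (hψm : StronglyMeasurable ψ)
    (hψ : ContinuousOn ψ {s : ℝ | (s : EReal) < τ}) {t : ℝ} (ht : t ∈ timeInterval τ) :
    HasDerivWithinAt w (ψ t) (timeInterval τ) t := by
  have h1 : HasDerivAt (fun t => x₀ + ∫ s in (0)..t, ψ s) (ψ t) t :=
    (intervalIntegral.integral_hasDerivAt_right (hint t)
      (hψm.stronglyMeasurableAtFilter)
      (hψ.continuousAt ((isOpen_setOf_coe_lt τ).mem_nhds ht.2))).const_add x₀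
  exact h1.hasDerivWithinAt.congr (fun s hs => hw s hs.1) (hw t ht.1)

end Extend

/-- Solution of `T' = -T B`, `U' = B U`, `Ξ' = T M Tᵀ` in a finite-dimensional algebra, where `tr`
is any linear map in place of the transpose. -/
theorem exists_linear_algebra_system {R : Type*} [NormedRing R] [NormedAlgebra ℝ R]
    [FiniteDimensional ℝ R] (tr : R →L[ℝ] R) {τ : EReal} (hτ : 0 < τ)
    {B M : ℝ → R} (hB : ContinuousOn B (timeInterval τ))
    (hM : ContinuousOn M (timeInterval τ)) {K : ℝ}
    (hBK : ∀ s ∈ timeInterval τ, ‖B s‖ ≤ K) (hMK : ∀ s ∈ timeInterval τ, ‖M s‖ ≤ K) :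
    ∃ T U Ξ : ℝ → R, Continuous U ∧ Continuous Ξ ∧ T 0 = 1 ∧ Ξ 0 = 0 ∧
      (∀ s ∈ timeInterval τ, T s * U s = 1) ∧
      (∀ s ∈ timeInterval τ, HasDerivWithinAt T (-(T s * B s)) (timeInterval τ) s) ∧
      (∀ s ∈ timeInterval τ, HasDerivWithinAt Ξ (T s * M s * tr (T s)) (timeInterval τ) s) := by
  have : CompleteSpace R := FiniteDimensional.complete ℝ R
  set Be := extendTimeInterval τ B with hBe
  set Me := extendTimeInterval τ M with hMe
  have hBm : StronglyMeasurable Be := stronglyMeasurable_extendTimeInterval hτ hB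
  have hMm : StronglyMeasurable Me := stronglyMeasurable_extendTimeInterval hτ hM
  have hBb : ∀ s, ‖Be s‖ ≤ K := norm_extendTimeInterval_le hτ hBK
  have hMb : ∀ s, ‖Me s‖ ≤ K := norm_extendTimeInterval_le hτ hMK
  have hBc := continuousOn_extendTimeInterval hτ hB
  have hMc := continuousOn_extendTimeInterval hτ hM
  let mulL := ContinuousLinearMap.mul ℝ R
  obtain ⟨T, hTc, hT⟩ := exists_continuous_eq_add_integral (L := fun s => mulL.flip (-(Be s)))
    (mulL.flip.continuous.comp_stronglyMeasurable hBm.neg) (K := ‖mulL.flip‖ * K)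
    (fun s => mulL.flip.le_opNorm_of_le (by rw [norm_neg]; exact hBb s)) 1
  obtain ⟨U, hUc, hU⟩ := exists_continuous_eq_add_integral (L := fun s => mulL (Be s))
    (mulL.continuous.comp_stronglyMeasurable hBm) (K := ‖mulL‖ * K)
    (fun s => mulL.le_opNorm_of_le (hBb s)) 1
  have bounded_int : ∀ ψ : ℝ → R, StronglyMeasurable ψ →
      ∀ b : ℝ → ℝ, Continuous b → (∀ s, ‖ψ s‖ ≤ b s) → ∀ t, IntervalIntegrable ψ volume 0 t :=
    fun ψ hψ b hb hψb t => (hb.intervalIntegrable 0 t).mono_fun' hψ.aestronglyMeasurable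
      (ae_of_all _ hψb)
  have hTd : ∀ s ∈ timeInterval τ, HasDerivWithinAt T (T s * -(Be s)) (timeInterval τ) s := by
    intro s hs
    have hm : StronglyMeasurable fun s => T s * -(Be s) := hTc.stronglyMeasurable.mul hBm.neg
    refine hasDerivWithinAt_of_eq_add_integral (ψ := fun s => T s * -(Be s)) hT
      (bounded_int _ hm (fun s => ‖T s‖ * K) (by fun_prop) fun s => ?_) hm
      (hTc.continuousOn.mul hBc.neg) hs
    refine (norm_mul_le _ _).trans (mul_le_mul_of_nonneg_left ?_ (norm_nonneg _))
    rw [norm_neg]; exact hBb s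
  have hUd : ∀ s ∈ timeInterval τ, HasDerivWithinAt U (Be s * U s) (timeInterval τ) s := by
    intro s hs
    have hm : StronglyMeasurable fun s => Be s * U s := hBm.mul hUc.stronglyMeasurable
    refine hasDerivWithinAt_of_eq_add_integral (ψ := fun s => Be s * U s) hU
      (bounded_int _ hm (fun s => K * ‖U s‖) (by fun_prop) fun s => ?_) hm
      (hBc.mul hUc.continuousOn) hs
    exact (norm_mul_le _ _).trans (mul_le_mul_of_nonneg_right (hBb s) (norm_nonneg _))
  have hTt : Continuous fun s => tr (T s) := tr.continuous.comp hTc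
  have hΞm : StronglyMeasurable fun s => T s * Me s * tr (T s) :=
    (hTc.stronglyMeasurable.mul hMm).mul hTt.stronglyMeasurable
  have hΞint := bounded_int _ hΞm (fun s => ‖T s‖ * K * ‖tr (T s)‖) (by fun_prop) fun s => by
    refine (norm_mul_le _ _).trans (mul_le_mul_of_nonneg_right ?_ (norm_nonneg _))
    exact (norm_mul_le _ _).trans (mul_le_mul_of_nonneg_left (hMb s) (norm_nonneg _))
  have hΞd : ∀ s ∈ timeInterval τ, HasDerivWithinAt
      (fun t => ∫ s in (0)..t, T s * Me s * tr (T s)) (T s * Me s * tr (T s))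
      (timeInterval τ) s := fun s hs =>
    hasDerivWithinAt_of_eq_add_integral (x₀ := 0)
      (ψ := fun s => T s * Me s * tr (T s)) (fun t _ => by simp) hΞint hΞm
      ((hTc.continuousOn.mul hMc).mul hTt.continuousOn) hs
  refine ⟨T, U, fun t => ∫ s in (0)..t, T s * Me s * tr (T s), hUc, ?_,
    by simpa using hT 0 le_rfl, by simp, fun s hs => ?_, fun s hs => ?_, fun s hs => ?_⟩
  · exact intervalIntegral.continuous_primitive (fun a b => (hΞint a).symm.trans (hΞint b)) 0
  -- `(T U)' = -T B U + T B U = 0`, so `T U` keeps its initial value `1`; this gives invertibility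
  -- together with a continuous inverse.
  · have hd : ∀ r ∈ timeInterval τ, HasDerivWithinAt (fun r => T r * U r) 0 (timeInterval τ) r := by
      intro r hr
      refine ((hTd r hr).mul (hUd r hr)).congr_deriv ?_
      simp [mul_assoc]
    have h := (convex_timeInterval τ).norm_image_sub_le_of_norm_hasDerivWithin_le (C := 0) hd
      (by simp) (zero_mem_timeInterval hτ) hs
    have h0 : T 0 * U 0 = 1 := by
      rw [hT 0 le_rfl, hU 0 le_rfl]; simp
    rw [zero_mul, norm_le_zero_iff, sub_eq_zero] at h
    rw [h, h0]
  · refine (hTd s hs).congr_deriv ?_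
    rw [hBe, extendTimeInterval_of_mem hs, mul_neg]
  · refine (hΞd s hs).congr_deriv ?_
    rw [hMe, extendTimeInterval_of_mem hs]

attribute [local instance] Matrix.linftyOpNormedRing Matrix.linftyOpNormedAlgebra

theorem norm_matrix_le_of_entry_le {q : ℕ} {A : Matrix (Fin q) (Fin q) ℝ} {K : ℝ}
    (hK : ∀ i j, |A i j| ≤ K) (hK0 : 0 ≤ K) : ‖A‖ ≤ q * K := by
  rw [Matrix.linfty_opNorm_def]
  lift K to ℝ≥0 using hK0
  have : (Finset.univ.sup fun i => ∑ j, ‖A i j‖₊) ≤ (q : ℝ≥0) * K := by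
    refine Finset.sup_le fun i _ => ?_
    refine (Finset.sum_le_card_nsmul _ _ K fun j _ => ?_).trans (by simp)
    rw [← NNReal.coe_le_coe]
    exact hK i j
  exact_mod_cast this

theorem hasMatrixDerivOn_of_hasDerivWithinAt {q : ℕ} {M V : ℝ → Matrix (Fin q) (Fin q) ℝ}
    {I : Set ℝ} (h : ∀ s ∈ I, HasDerivWithinAt M (V s) I s) : HasMatrixDerivOn M V I := by
  intro s hs i j
  exact ((Matrix.entryLinearMap ℝ ℝ i j).toContinuousLinearMap.hasFDerivAt.comp_hasDerivWithinAt s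
    (h s hs))

/-- Existence of the matrix functions `T`, its inverse `U` and `Ξ`, for bounded coefficients that
are continuous on `[0, τ)`. -/
theorem exists_linear_matrix_system {q : ℕ} {τ : EReal} (hτ : 0 < τ)
    {B M : ℝ → Matrix (Fin q) (Fin q) ℝ} (hB : ContinuousOn B (timeInterval τ))
    (hM : ContinuousOn M (timeInterval τ)) {K : ℝ} (hK0 : 0 ≤ K)
    (hBK : ∀ s ∈ timeInterval τ, ∀ i j, |B s i j| ≤ K)
    (hMK : ∀ s ∈ timeInterval τ, ∀ i j, |M s i j| ≤ K) :
    ∃ T U Ξ : ℝ → Matrix (Fin q) (Fin q) ℝ, Continuous U ∧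
      Continuous Ξ ∧ T 0 = 1 ∧ Ξ 0 = 0 ∧
      (∀ s ∈ timeInterval τ, T s * U s = 1) ∧
      HasMatrixDerivOn T (fun s => -(T s * B s)) (timeInterval τ) ∧
      HasMatrixDerivOn Ξ (fun s => T s * M s * (T s).transpose) (timeInterval τ) := by
  obtain ⟨T, U, Ξ, hU, hΞ, hT0, hΞ0, hTU, hT, hΞd⟩ := exists_linear_algebra_system
    (Matrix.transposeLinearEquiv (Fin q) (Fin q) ℝ ℝ).toLinearMap.toContinuousLinearMap hτ hB hM
    (fun s hs => norm_matrix_le_of_entry_le (hBK s hs) hK0)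
    (fun s hs => norm_matrix_le_of_entry_le (hMK s hs) hK0)
  exact ⟨T, U, Ξ, hU, hΞ, hT0, hΞ0, hTU, hasMatrixDerivOn_of_hasDerivWithinAt hT,
    hasMatrixDerivOn_of_hasDerivWithinAt hΞd⟩

end CovarianceSystem

/-- Along a solution on `[0, τ)` the covariance system can be solved if the Jacobian and the
matrix `G - F Fᵀ` are continuous and bounded there, and `S` extends continuously to `ℝ`. -/
theorem exists_isCovarianceSystem {q : ℕ} {τ : EReal} (hτ : 0 < τ)
    (f : Fin q → (Fin q → ℝ) → ℝ) (g : Fin q → Fin q → (Fin q → ℝ) → ℝ) (z : ℝ → Fin q → ℝ)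
    (hB : ContinuousOn (fun s => jacobian f (z s)) (timeInterval τ))
    (hM : ContinuousOn (fun s => (Matrix.of (fun i j => g i j (z s)) -
      Matrix.vecMulVec (driftField f (z s)) (driftField f (z s)) : Matrix (Fin q) (Fin q) ℝ))
      (timeInterval τ)) {K : ℝ} (hK0 : 0 ≤ K)
    (hBK : ∀ s ∈ timeInterval τ, ∀ i j, |jacobian f (z s) i j| ≤ K)
    (hMK : ∀ s ∈ timeInterval τ, ∀ i j, |g i j (z s) - f i (z s) * f j (z s)| ≤ K) :
    ∃ T Ξ S : ℝ → Matrix (Fin q) (Fin q) ℝ,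
      Continuous S ∧ IsCovarianceSystem f g z (timeInterval τ) T Ξ S := by
  obtain ⟨T, U, Ξ, hU, hΞ, hT0, hΞ0, hTU, hTd, hΞd⟩ :=
    exists_linear_matrix_system hτ hB hM hK0 hBK hMK
  -- `U` stands for `T⁻¹` because it is continuous on all of `ℝ`, in particular at `τ`, where
  -- nothing is known about `T⁻¹`.
  refine ⟨T, Ξ, fun t => U (max t 0) * Ξ (max t 0) * (U (max t 0)).transpose, ?_, hT0, hTd,
    fun s hs => ?_, hΞ0, hΞd, fun s hs => ?_⟩
  · have hm : Continuous fun t : ℝ => max t 0 := by fun_prop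
    have hU' : Continuous fun t : ℝ => U (max t 0) :=
      hU.comp hm
    have hΞ' : Continuous fun t : ℝ => Ξ (max t 0) :=
      hΞ.comp hm
    exact (hU'.matrix_mul hΞ').matrix_mul hU'.matrix_transpose
  · exact (Matrix.isUnit_iff_isUnit_det _).1
      (IsUnit.of_mul_eq_one _ (hTU s hs))
  · simp only [max_eq_left hs.1]
    rw [Matrix.inv_eq_right_inv (hTU s hs)]

/-! ### Taylor bounds for the complex exponential -/

section Taylor

-- The power series handles `|x| ≤ 1` and the bound `‖exp (I x) - 1‖ ≤ 2` the rest. The estimate has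
-- to be global, since it will be applied to multiples of an unbounded walk.
open Complex in
theorem norm_exp_I_mul_sub_one_sub_le (x : ℝ) : ‖exp (I * x) - 1 - I * x‖ ≤ 3 * x ^ 2 := by
  have hn : ‖I * (x : ℂ)‖ = |x| := by simp
  rcases le_or_gt |x| 1 with hx | hx
  · have := norm_exp_sub_one_sub_id_le (x := I * x) (by rw [hn]; exact hx)
    rw [hn, sq_abs] at this
    nlinarith [sq_nonneg x]
  · have h1 : ‖exp (I * x) - 1‖ ≤ 2 := by
      refine (norm_sub_le _ _).trans ?_
      rw [mul_comm, norm_exp_ofReal_mul_I]; norm_num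
    have h2 := norm_sub_le (exp (I * x) - 1) (I * x)
    rw [hn] at h2
    have h3 : |x| ^ 2 = x ^ 2 := sq_abs x
    nlinarith

open Complex in
theorem norm_exp_I_mul_sub_taylor_two_le (x : ℝ) :
    ‖exp (I * x) - 1 - (I * x - (x : ℂ) ^ 2 / 2)‖ ≤ 4 * |x| ^ 3 := by
  have hn : ‖I * (x : ℂ)‖ = |x| := by simp
  have hn2 : ‖(x : ℂ) ^ 2 / 2‖ = |x| ^ 2 / 2 := by simp
  rcases le_or_gt |x| 1 with hx | hx
  · have h := norm_exp_sub_sum_le_norm_mul_exp (I * x) 3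
    have he : ∑ m ∈ Finset.range 3, (I * (x : ℂ)) ^ m / (m.factorial : ℂ) =
        1 + (I * x - (x : ℂ) ^ 2 / 2) := by
      simp [Finset.sum_range_succ, mul_pow]; ring
    rw [he, hn, ← sub_sub] at h
    refine h.trans ?_
    have : Real.exp |x| ≤ 4 := by
      calc Real.exp |x| ≤ Real.exp 1 := Real.exp_le_exp.2 hx
        _ ≤ 4 := by linarith [Real.exp_one_lt_d9]
    nlinarith [pow_nonneg (abs_nonneg x) 3]
  · have h1 : ‖exp (I * x) - 1‖ ≤ 2 := by
      refine (norm_sub_le _ _).trans ?_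
      rw [mul_comm, norm_exp_ofReal_mul_I]; norm_num
    have h2 := norm_sub_le (exp (I * x) - 1) (I * x - (x : ℂ) ^ 2 / 2)
    have h3 := norm_sub_le (I * (x : ℂ)) ((x : ℂ) ^ 2 / 2)
    rw [hn, hn2] at h3
    have h4 : 1 ≤ |x| ^ 3 := one_le_pow₀ hx.le
    have h5 : |x| ≤ |x| ^ 3 := le_self_pow₀ hx.le (by norm_num)
    have h6 : |x| ^ 2 ≤ |x| ^ 3 := pow_le_pow_right₀ hx.le (by norm_num)
    linarith

open Complex in
/-- Expansion of `exp (i (α + γ) + κ)` to second order in `α` and first order in `γ` and `κ`. -/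
theorem norm_exp_sub_taylor_le (α γ κ : ℝ) (hκ : |κ| ≤ 1) :
    ‖exp (I * (α + γ) + κ) - 1 - (I * (α + γ) + κ - (α : ℂ) ^ 2 / 2)‖ ≤
      13 * (|α| ^ 3 + γ ^ 2 + κ ^ 2 + |α| * (|γ| + |κ|)) := by
  have hα := norm_exp_I_mul_sub_taylor_two_le α
  have hα1 : ‖exp (I * α) - 1‖ ≤ |α| := Real.norm_exp_I_mul_ofReal_sub_one_le
  have hγ := norm_exp_I_mul_sub_one_sub_le γ
  have hγ1 : ‖exp (I * γ) - 1‖ ≤ |γ| := Real.norm_exp_I_mul_ofReal_sub_one_le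
  have hκn : ‖(κ : ℂ)‖ ≤ 1 := by simpa using hκ
  have hκ1 : ‖exp (κ : ℂ) - 1‖ ≤ 2 * |κ| := by simpa using norm_exp_sub_one_le hκn
  have hκ2 : ‖exp (κ : ℂ) - 1 - κ‖ ≤ κ ^ 2 := by simpa using norm_exp_sub_one_sub_id_le hκn
  have hκ3 : ‖exp (κ : ℂ)‖ ≤ 3 := by
    have := norm_le_norm_sub_add (exp (κ : ℂ)) 1
    simp only [norm_one] at this
    linarith
  have he : exp (I * (α + γ) + κ) = exp (I * α) * (exp (I * γ) * exp κ) := by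
    rw [← exp_add, ← exp_add]; congr 1; ring
  -- The three groups are the second-order remainder in `α`, the first-order remainder of `exp (I γ
  -- + κ)`, and the mixed product `(exp (I α) - 1) (exp (I γ + κ) - 1)`.
  have hid : exp (I * (α + γ) + κ) - 1 - (I * (α + γ) + κ - (α : ℂ) ^ 2 / 2) =
      (exp (I * α) - 1 - (I * α - (α : ℂ) ^ 2 / 2)) +
      ((exp (I * γ) - 1 - I * γ) * exp κ + I * γ * (exp κ - 1) + (exp κ - 1 - κ)) +
      (exp (I * α) - 1) * ((exp (I * γ) - 1) * exp κ + (exp κ - 1)) := by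
    rw [he]; ring
  have hIγ : ‖I * (γ : ℂ)‖ = |γ| := by simp
  have a1 : ‖(exp (I * γ) - 1 - I * γ) * exp κ‖ ≤ 3 * γ ^ 2 * 3 := by
    rw [norm_mul]; gcongr
  have a2 : ‖I * γ * (exp κ - 1)‖ ≤ |γ| * (2 * |κ|) := by
    rw [norm_mul, hIγ]; gcongr
  have a3 : ‖(exp (I * α) - 1) * ((exp (I * γ) - 1) * exp κ + (exp κ - 1))‖ ≤
      |α| * (|γ| * 3 + 2 * |κ|) := by
    rw [norm_mul]
    refine mul_le_mul hα1 ((norm_add_le _ _).trans (add_le_add ?_ hκ1)) (norm_nonneg _)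
      (abs_nonneg _)
    rw [norm_mul]; gcongr
  rw [hid]
  have t1 := norm_add₃_le (a := (exp (I * α) - 1 - (I * α - (α : ℂ) ^ 2 / 2)))
    (b := ((exp (I * γ) - 1 - I * γ) * exp κ + I * γ * (exp κ - 1) + (exp κ - 1 - κ)))
    (c := (exp (I * α) - 1) * ((exp (I * γ) - 1) * exp κ + (exp κ - 1)))
  have t2 := norm_add₃_le (a := (exp (I * γ) - 1 - I * γ) * exp κ)
    (b := I * γ * (exp κ - 1)) (c := (exp κ - 1 - κ))
  have h1 : 2 * (|γ| * |κ|) ≤ γ ^ 2 + κ ^ 2 := by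
    nlinarith [sq_nonneg (|γ| - |κ|), sq_abs γ, sq_abs κ]
  have h2 : 0 ≤ |α| * |γ| := by positivity
  have h3 : 0 ≤ |α| * |κ| := by positivity
  have h4 : 0 ≤ |α| ^ 3 := by positivity
  nlinarith [sq_nonneg γ, sq_nonneg κ]

end Taylor

/-! ### Conditional expectations tested against bounded functions -/

section WeakCondExp

variable {Ω : Type*} {m mΩ : MeasurableSpace Ω} {μ : Measure Ω}

/-- `b` has the same integrals as `Y` against bounded `m`-measurable functions. -/
structure IsWeakCondExp (m : MeasurableSpace Ω) {mΩ : MeasurableSpace Ω} (μ : Measure Ω)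
    (Y b : Ω → ℝ) : Prop where
  integrable_left : Integrable Y μ
  integrable_right : Integrable b μ
  integral_eq : ∀ h : Ω → ℂ, Measurable[m] h → (∃ C, ∀ᵐ ω ∂μ, ‖h ω‖ ≤ C) →
    ∫ ω, h ω * Y ω ∂μ = ∫ ω, h ω * b ω ∂μ

namespace IsWeakCondExp

variable {Y b Y' b' : Ω → ℝ}

theorem integrable_mul (hm : m ≤ mΩ) {Y : Ω → ℝ} (hY : Integrable Y μ) {h : Ω → ℂ}
    (hh : Measurable[m] h) (hb : ∃ C, ∀ᵐ ω ∂μ, ‖h ω‖ ≤ C) :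
    Integrable (fun ω => h ω * Y ω) μ := by
  obtain ⟨C, hC⟩ := hb
  exact hY.ofReal.bdd_mul (hh.mono hm le_rfl).aestronglyMeasurable hC

theorem condExp [IsFiniteMeasure μ] (hm : m ≤ mΩ) (hY : Integrable Y μ) :
    IsWeakCondExp m μ Y (μ[Y | m]) := by
  refine ⟨hY, integrable_condExp, fun h hh ⟨C, hC⟩ => ?_⟩
  have h1 := condExp_stronglyMeasurable_bilin_of_bound
    ((ContinuousLinearMap.lsmul ℝ ℝ : ℝ →L[ℝ] ℂ →L[ℝ] ℂ).flip) hm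
    (hh.stronglyMeasurable) hY C hC
  have h2 := integral_congr_ae h1
  rw [integral_condExp hm] at h2
  simpa [mul_comm] using h2

/-- Since `A` belongs to `m`, multiplying a test function by the indicator of `A` gives a test
function. So conditional moments computed under `P` remain valid given the initial value, with no
new conditional expectation to identify. -/
theorem cond [IsFiniteMeasure μ] (hm : m ≤ mΩ) (h : IsWeakCondExp m μ Y b) {A : Set Ω}
    (hA : MeasurableSet[m] A) (hA0 : μ A ≠ 0) : IsWeakCondExp m (ProbabilityTheory.cond μ A) Y b := by
  have hfin : (μ A)⁻¹ ≠ ∞ := by simpa using hA0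
  have hac : ProbabilityTheory.cond μ A = (μ A)⁻¹ • μ.restrict A := rfl
  refine ⟨hac ▸ h.integrable_left.restrict.smul_measure hfin,
    hac ▸ h.integrable_right.restrict.smul_measure hfin, fun φ hφ hb => ?_⟩
  obtain ⟨C, hC⟩ := hb
  rw [hac, integral_smul_measure, integral_smul_measure]
  congr 1
  rw [← integral_indicator (hm _ hA), ← integral_indicator (hm _ hA)]
  -- The bound `C` is known only almost everywhere on `A`; off `A` the indicator is `0`, and `C`
  -- itself could be negative if no point forces otherwise.
  have key := h.integral_eq (A.indicator φ) (hφ.indicator hA) ⟨max C 0, by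
    have h2 : ∀ᵐ ω ∂μ, ω ∈ A → ‖φ ω‖ ≤ C := by
      rw [← ae_restrict_iff' (hm _ hA)]
      rw [hac] at hC
      exact (Measure.ae_ennreal_smul_measure_iff (by simp)).1 hC
    filter_upwards [h2] with ω hω
    by_cases hωA : ω ∈ A
    · rw [Set.indicator_of_mem hωA]; exact (hω hωA).trans (le_max_left _ _)
    · rw [Set.indicator_of_notMem hωA, norm_zero]; exact le_max_right _ _⟩
  simpa only [Set.indicator_mul_left] using key

theorem of_measurable (hY : Integrable Y μ) : IsWeakCondExp m μ Y Y :=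
  ⟨hY, hY, fun _ _ _ => rfl⟩

theorem mul_left (hm : m ≤ mΩ) (h : IsWeakCondExp m μ Y b) {φ : Ω → ℝ} (hφ : Measurable[m] φ)
    {C : ℝ} (hC : ∀ ω, ‖φ ω‖ ≤ C) :
    IsWeakCondExp m μ (fun ω => φ ω * Y ω) (fun ω => φ ω * b ω) := by
  refine ⟨h.integrable_left.bdd_mul (hφ.mono hm le_rfl).aestronglyMeasurable (ae_of_all _ hC),
    h.integrable_right.bdd_mul (hφ.mono hm le_rfl).aestronglyMeasurable (ae_of_all _ hC),
    fun ψ hψ ⟨D, hD⟩ => ?_⟩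
  have key := h.integral_eq (fun ω => ψ ω * φ ω) (hψ.mul (Complex.measurable_ofReal.comp hφ))
    ⟨D * C, by
      filter_upwards [hD] with ω hω
      rw [norm_mul, Complex.norm_real]
      exact mul_le_mul hω (hC ω) (norm_nonneg _) ((norm_nonneg _).trans hω)⟩
  simpa [mul_assoc] using key

theorem const_mul (h : IsWeakCondExp m μ Y b) (c : ℝ) :
    IsWeakCondExp m μ (fun ω => c * Y ω) (fun ω => c * b ω) := by
  refine ⟨h.integrable_left.const_mul c, h.integrable_right.const_mul c, fun ψ hψ hb => ?_⟩
  have key := h.integral_eq ψ hψ hb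
  simp only [Complex.ofReal_mul, mul_left_comm (_ : ℂ) (c : ℂ), integral_const_mul, key]

theorem add (hm : m ≤ mΩ) (h : IsWeakCondExp m μ Y b) (h' : IsWeakCondExp m μ Y' b') :
    IsWeakCondExp m μ (fun ω => Y ω + Y' ω) (fun ω => b ω + b' ω) := by
  refine ⟨h.integrable_left.add h'.integrable_left, h.integrable_right.add h'.integrable_right,
    fun ψ hψ hb => ?_⟩
  simp only [Complex.ofReal_add, mul_add]
  rw [integral_add (integrable_mul hm h.integrable_left hψ hb)
      (integrable_mul hm h'.integrable_left hψ hb),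
    integral_add (integrable_mul hm h.integrable_right hψ hb)
      (integrable_mul hm h'.integrable_right hψ hb), h.integral_eq ψ hψ hb, h'.integral_eq ψ hψ hb]

theorem sum (hm : m ≤ mΩ) {ι : Type*} (s : Finset ι) {Y b : ι → Ω → ℝ}
    (h : ∀ i ∈ s, IsWeakCondExp m μ (Y i) (b i)) :
    IsWeakCondExp m μ (fun ω => ∑ i ∈ s, Y i ω) (fun ω => ∑ i ∈ s, b i ω) := by
  classical
  induction s using Finset.induction_on with
  | empty => exact of_measurable (integrable_zero Ω ℝ μ)
  | insert i s hi ih =>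
    simp only [Finset.sum_insert hi]
    exact add hm (h i (Finset.mem_insert_self _ _))
      (ih fun j hj => h j (Finset.mem_insert_of_mem hj))

theorem integral_real_eq (h : IsWeakCondExp m μ Y b) {φ : Ω → ℝ} (hφ : Measurable[m] φ)
    (hb : ∃ C, ∀ᵐ ω ∂μ, |φ ω| ≤ C) : ∫ ω, φ ω * Y ω ∂μ = ∫ ω, φ ω * b ω ∂μ := by
  have key := h.integral_eq (fun ω => φ ω) (Complex.measurable_ofReal.comp hφ)
    (by simpa using hb)
  simp only [← Complex.ofReal_mul, integral_complex_ofReal] at key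
  exact_mod_cast key

theorem integral_eq_integral (h : IsWeakCondExp m μ Y b) : ∫ ω, Y ω ∂μ = ∫ ω, b ω ∂μ := by
  have := h.integral_real_eq (φ := fun _ => 1) measurable_const ⟨1, by simp⟩
  simpa using this

end IsWeakCondExp

end WeakCondExp

/-! ### Second moments of walks with linearly bounded drift -/

section Walk

variable {Ω : Type*} {mΩ : MeasurableSpace Ω} {q : ℕ}

/-- An adapted process with bounded increments, started at `0`, whose conditional drift is `b` and
whose matrix of conditional second moments of the increments is `c`, up to time `N`. -/
structure IsAdaptedWalk (ℱ : Filtration ℕ mΩ) (μ : Measure Ω) (W b : ℕ → Ω → Fin q → ℝ)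
    (c : ℕ → Ω → Fin q → Fin q → ℝ) (δ : ℝ) (N : ℕ) : Prop where
  meas : ∀ j ≤ N, Measurable[ℱ j] (W j)
  zero : ∀ᵐ ω ∂μ, W 0 ω = 0
  step : ∀ j < N, ∀ᵐ ω ∂μ, ‖W (j + 1) ω - W j ω‖ ≤ δ
  mean : ∀ j < N, ∀ k, IsWeakCondExp (ℱ j) μ (fun ω => W (j + 1) ω k - W j ω k) (fun ω => b j ω k)
  second : ∀ j < N, ∀ i k, IsWeakCondExp (ℱ j) μ
    (fun ω => (W (j + 1) ω i - W j ω i) * (W (j + 1) ω k - W j ω k)) (fun ω => c j ω i k)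

/-- Steps and distances are measured in the sup norm, whereas `v ⬝ᵥ v` is the quantity whose mean
satisfies a recursion; this and the next bound pass between the two. -/
theorem norm_sq_le_dotProduct_self (v : Fin q → ℝ) : ‖v‖ ^ 2 ≤ v ⬝ᵥ v := by
  have h : ‖v‖ ≤ √(v ⬝ᵥ v) := by
    refine (pi_norm_le_iff_of_nonneg (Real.sqrt_nonneg _)).2 fun i => ?_
    refine Real.le_sqrt_of_sq_le ?_
    rw [Real.norm_eq_abs, sq_abs, sq, dotProduct]
    exact Finset.single_le_sum (f := fun i => v i * v i) (fun _ _ => mul_self_nonneg _)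
      (Finset.mem_univ i)
  have h0 : 0 ≤ v ⬝ᵥ v := Finset.sum_nonneg fun _ _ => mul_self_nonneg _
  calc ‖v‖ ^ 2 ≤ √(v ⬝ᵥ v) ^ 2 := by gcongr
    _ = _ := Real.sq_sqrt h0

theorem dotProduct_self_le (v : Fin q → ℝ) : v ⬝ᵥ v ≤ q * ‖v‖ ^ 2 := by
  rw [dotProduct]
  refine (Finset.sum_le_card_nsmul _ _ (‖v‖ ^ 2) fun i _ => ?_).trans (by simp)
  rw [← sq, ← sq_abs]
  have := norm_le_pi_norm v i
  rw [Real.norm_eq_abs] at this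
  gcongr

theorem dotProduct_self_nonneg' (v : Fin q → ℝ) : 0 ≤ v ⬝ᵥ v :=
  Finset.sum_nonneg fun _ _ => mul_self_nonneg _

theorem abs_dotProduct_le {a : Fin q → ℝ} {K : ℝ} (ha : ∀ k, |a k| ≤ K) (v : Fin q → ℝ) :
    |a ⬝ᵥ v| ≤ q * K * ‖v‖ := by
  rw [dotProduct]
  refine (Finset.abs_sum_le_sum_abs _ _).trans ?_
  refine (Finset.sum_le_card_nsmul _ _ (K * ‖v‖) fun i _ => ?_).trans (by simp [mul_assoc])
  rw [abs_mul]
  have := norm_le_pi_norm v i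
  rw [Real.norm_eq_abs] at this
  exact mul_le_mul (ha i) this (abs_nonneg _) ((abs_nonneg _).trans (ha i))

theorem sq_dotProduct_le {a : Fin q → ℝ} {K : ℝ} (ha : ∀ k, |a k| ≤ K) (v : Fin q → ℝ) :
    (a ⬝ᵥ v) ^ 2 ≤ q * K ^ 2 * (v ⬝ᵥ v) := by
  have h1 := Finset.sum_mul_sq_le_sq_mul_sq Finset.univ a v
  have h2 : ∑ i, a i ^ 2 ≤ q * K ^ 2 := by
    refine (Finset.sum_le_card_nsmul _ _ (K ^ 2) fun i _ => ?_).trans (by simp)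
    rw [← sq_abs]
    have := ha i
    gcongr
  have h3 : v ⬝ᵥ v = ∑ i, v i ^ 2 := by simp [dotProduct, sq]
  rw [h3]
  exact h1.trans (mul_le_mul_of_nonneg_right h2 (Finset.sum_nonneg fun i _ => sq_nonneg _))

namespace IsAdaptedWalk

variable {ℱ : Filtration ℕ mΩ} {μ : Measure Ω} {W b : ℕ → Ω → Fin q → ℝ}
  {c : ℕ → Ω → Fin q → Fin q → ℝ} {δ : ℝ} {N : ℕ}

theorem measurable (h : IsAdaptedWalk ℱ μ W b c δ N) {j : ℕ} (hj : j ≤ N) : Measurable (W j) :=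
  (h.meas j hj).mono (ℱ.le j) le_rfl

theorem measurable_of_le (h : IsAdaptedWalk ℱ μ W b c δ N) {i j : ℕ} (hij : i ≤ j) (hj : j ≤ N) :
    Measurable[ℱ j] (W i) :=
  (h.meas i (hij.trans hj)).mono (ℱ.mono hij) le_rfl

theorem norm_le (h : IsAdaptedWalk ℱ μ W b c δ N) {j : ℕ} (hj : j ≤ N) :
    ∀ᵐ ω ∂μ, ‖W j ω‖ ≤ j * δ := by
  induction j with
  | zero => filter_upwards [h.zero] with ω hω; simp [hω]
  | succ j ih =>
    filter_upwards [ih (by omega), h.step j (by omega)] with ω h1 h2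
    have := norm_le_norm_sub_add (W (j + 1) ω) (W j ω)
    push_cast
    linarith

theorem integrable_dotProduct_self [IsFiniteMeasure μ] (h : IsAdaptedWalk ℱ μ W b c δ N) {i j : ℕ}
    (hi : i ≤ N) (hj : j ≤ N) :
    Integrable (fun ω => (W j ω - W i ω) ⬝ᵥ (W j ω - W i ω)) μ := by
  have hm : Measurable fun ω => (W j ω - W i ω) ⬝ᵥ (W j ω - W i ω) := by
    have h1 := h.measurable hi
    have h2 := h.measurable hj
    simp only [dotProduct, Pi.sub_apply]
    fun_prop
  refine Integrable.of_bound hm.aestronglyMeasurable (q * (j * δ + i * δ) ^ 2) ?_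
  filter_upwards [h.norm_le hi, h.norm_le hj] with ω h1 h2
  rw [Real.norm_of_nonneg (dotProduct_self_nonneg' _)]
  refine (dotProduct_self_le _).trans ?_
  have := norm_sub_le (W j ω) (W i ω)
  gcongr
  linarith

theorem integrable_dotProduct_self' [IsFiniteMeasure μ] (h : IsAdaptedWalk ℱ μ W b c δ N) {j : ℕ}
    (hj : j ≤ N) : Integrable (fun ω => W j ω ⬝ᵥ W j ω) μ := by
  refine (h.integrable_dotProduct_self (Nat.zero_le N) hj).congr ?_
  filter_upwards [h.zero] with ω hω
  simp [hω]

/-- One step of the growth of the second moment of `W j - W i`. -/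
theorem integral_dotProduct_self_succ [IsProbabilityMeasure μ] (h : IsAdaptedWalk ℱ μ W b c δ N)
    {i j : ℕ} (hij : i ≤ j) (hj : j < N) :
    Integrable (fun ω => ∑ k, (2 * ((W j ω k - W i ω k) * b j ω k) + c j ω k k)) μ ∧
    ∫ ω, (W (j + 1) ω - W i ω) ⬝ᵥ (W (j + 1) ω - W i ω) ∂μ =
      ∫ ω, (W j ω - W i ω) ⬝ᵥ (W j ω - W i ω) ∂μ +
      ∫ ω, (∑ k, (2 * ((W j ω k - W i ω k) * b j ω k) + c j ω k k)) ∂μ := by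
  have hm := ℱ.le j
  have hd : ∀ k, Measurable[ℱ j] fun ω => W j ω k - W i ω k := fun k =>
    ((measurable_pi_apply k).comp (h.meas j hj.le)).sub
      ((measurable_pi_apply k).comp (h.measurable_of_le hij hj.le))
  have hdb : ∀ k, ∀ᵐ ω ∂μ, |W j ω k - W i ω k| ≤ j * δ + i * δ := by
    intro k
    filter_upwards [h.norm_le (hij.trans hj.le), h.norm_le hj.le] with ω h1 h2
    have h3 := norm_sub_le (W j ω) (W i ω)
    have h4 := norm_le_pi_norm (W j ω - W i ω) k
    rw [Pi.sub_apply, Real.norm_eq_abs] at h4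
    linarith
  have hI : ∀ k, ∀ Y : Ω → ℝ, Integrable Y μ →
      Integrable (fun ω => (W j ω k - W i ω k) * Y ω) μ := fun k Y hY =>
    hY.bdd_mul ((hd k).mono hm le_rfl).aestronglyMeasurable (hdb k)
  have hM := h.mean j hj
  have hS := h.second j hj
  have h1 : ∀ k, ∫ ω, (2 * ((W j ω k - W i ω k) * (W (j + 1) ω k - W j ω k)) +
      (W (j + 1) ω k - W j ω k) * (W (j + 1) ω k - W j ω k)) ∂μ =
      ∫ ω, (2 * ((W j ω k - W i ω k) * b j ω k) + c j ω k k) ∂μ := by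
    intro k
    rw [integral_add ((hI k _ (hM k).integrable_left).const_mul 2) (hS k k).integrable_left,
      integral_add ((hI k _ (hM k).integrable_right).const_mul 2) (hS k k).integrable_right,
      integral_const_mul, integral_const_mul, (hM k).integral_real_eq (hd k) ⟨_, hdb k⟩,
      (hS k k).integral_eq_integral]
  have h2 : ∫ ω, (∑ k, (2 * ((W j ω k - W i ω k) * (W (j + 1) ω k - W j ω k)) +
      (W (j + 1) ω k - W j ω k) * (W (j + 1) ω k - W j ω k))) ∂μ =
      ∫ ω, (∑ k, (2 * ((W j ω k - W i ω k) * b j ω k) + c j ω k k)) ∂μ := by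
    rw [integral_finsetSum, integral_finsetSum]
    · exact Finset.sum_congr rfl fun k _ => h1 k
    · exact fun k _ => ((hI k _ (hM k).integrable_right).const_mul 2).add (hS k k).integrable_right
    · exact fun k _ => ((hI k _ (hM k).integrable_left).const_mul 2).add (hS k k).integrable_left
  refine ⟨integrable_finsetSum _ fun k _ =>
    ((hI k _ (hM k).integrable_right).const_mul 2).add (hS k k).integrable_right, ?_⟩
  rw [← h2, ← integral_add (h.integrable_dotProduct_self (hij.trans hj.le) hj.le)]
  · congr 1 with ω
    simp only [dotProduct, Pi.sub_apply, ← Finset.sum_add_distrib]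
    exact Finset.sum_congr rfl fun k _ => by ring
  · exact integrable_finsetSum _ fun k _ =>
      ((hI k _ (hM k).integrable_left).const_mul 2).add (hS k k).integrable_left

/-- Second moment bound for the increments of a walk with linearly bounded drift. -/
theorem integral_dotProduct_self_le [IsProbabilityMeasure μ] (h : IsAdaptedWalk ℱ μ W b c δ N)
    {n : ℕ} (hn : 0 < n) {i : ℕ} {L B K : ℝ} (hL : 0 ≤ L) (hK : 0 ≤ K) {R : Ω → ℝ}
    (hRi : Integrable (fun ω => R ω ^ 2) μ) (hRB : ∫ ω, R ω ^ 2 ∂μ ≤ B)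
    (hb : ∀ j, i ≤ j → j < N → ∀ᵐ ω ∂μ, ∀ k, |b j ω k| ≤ (L * ‖W j ω - W i ω‖ + R ω) / n)
    (hc : ∀ j, i ≤ j → j < N → ∀ᵐ ω ∂μ, ∀ k, c j ω k k ≤ K / n) {j : ℕ} (hij : i ≤ j) (hj : j ≤ N) :
    ∫ ω, (W j ω - W i ω) ⬝ᵥ (W j ω - W i ω) ∂μ ≤
      q * (B + K) * (((j : ℝ) - i) / n) * Real.exp (q * (2 * L + 1) * (((j : ℝ) - i) / n)) := by
  have hn' : (0 : ℝ) < n := by exact_mod_cast hn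
  have hB : 0 ≤ B := (integral_nonneg fun ω => sq_nonneg (R ω)).trans hRB
  induction j, hij using Nat.le_induction with
  | base => simp
  | succ j hij ih =>
    have hjN : j < N := hj
    have ih := ih hjN.le
    obtain ⟨hsint, hsucc⟩ := h.integral_dotProduct_self_succ hij hjN
    rw [hsucc]
    set u := ∫ ω, (W j ω - W i ω) ⬝ᵥ (W j ω - W i ω) ∂μ with hu
    -- The cross term is at most `2 d (L d + R) / n`, and `2 d R ≤ d² + R²`. This makes the
    -- recursion affine: `u (j+1) ≤ (1 + γ / n) u j + U / n` with `γ = q (2 L + 1)` and `U = q (B +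
    -- K)`.
    have hstep : ∫ ω, (∑ k, (2 * ((W j ω k - W i ω k) * b j ω k) + c j ω k k)) ∂μ ≤
        q * (2 * L + 1) / n * u + q * (B + K) / n := by
      have hint := h.integrable_dotProduct_self (hij.trans hjN.le) hjN.le
      have hle : ∀ᵐ ω ∂μ, (∑ k, (2 * ((W j ω k - W i ω k) * b j ω k) + c j ω k k)) ≤
          q * (2 * L + 1) / n * ((W j ω - W i ω) ⬝ᵥ (W j ω - W i ω)) +
            (q / n * R ω ^ 2 + q * K / n) := by
        filter_upwards [hb j hij hjN, hc j hij hjN] with ω hbω hcω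
        have hs := norm_sq_le_dotProduct_self (W j ω - W i ω)
        set d := ‖W j ω - W i ω‖ with hd
        have hd0 : 0 ≤ d := norm_nonneg _
        have hk : ∀ k ∈ Finset.univ, 2 * ((W j ω k - W i ω k) * b j ω k) + c j ω k k ≤
            ((2 * L + 1) * d ^ 2 + R ω ^ 2 + K) / n := by
          intro k _
          have h4 := norm_le_pi_norm (W j ω - W i ω) k
          rw [Pi.sub_apply, Real.norm_eq_abs, ← hd] at h4
          have h5 : (W j ω k - W i ω k) * b j ω k ≤ d * ((L * d + R ω) / n) := by
            refine (le_abs_self _).trans ?_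
            rw [abs_mul]
            exact mul_le_mul h4 (hbω k) (abs_nonneg _) hd0
          have h6 := hcω k
          have h7 : 2 * (d * ((L * d + R ω) / n)) + K / n ≤
              ((2 * L + 1) * d ^ 2 + R ω ^ 2 + K) / n := by
            rw [← mul_div_assoc, ← mul_div_assoc, ← add_div]
            gcongr
            nlinarith [sq_nonneg (d - R ω)]
          linarith
        refine (Finset.sum_le_card_nsmul _ _ _ hk).trans ?_
        simp only [Finset.card_univ, Fintype.card_fin, nsmul_eq_mul]
        have h8 : (q : ℝ) * (((2 * L + 1) * d ^ 2 + R ω ^ 2 + K) / n) =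
            q * (2 * L + 1) / n * d ^ 2 + (q / n * R ω ^ 2 + q * K / n) := by ring
        rw [h8]
        gcongr
      have hRint : Integrable (fun ω => q / n * R ω ^ 2 + q * K / n) μ :=
        (hRi.const_mul _).add (integrable_const _)
      refine (integral_mono_ae hsint ((hint.const_mul _).add hRint) hle).trans ?_
      rw [integral_add' (hint.const_mul _) hRint, integral_const_mul,
        integral_add (hRi.const_mul _) (integrable_const _), integral_const_mul, integral_const]
      simp only [probReal_univ, one_smul]
      have : (q : ℝ) / n * ∫ ω, R ω ^ 2 ∂μ ≤ q / n * B := by gcongr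
      have h9 : (q : ℝ) * (B + K) / n = q / n * B + q * K / n := by ring
      rw [h9]
      linarith
    set U : ℝ := q * (B + K) with hU
    set γ : ℝ := q * (2 * L + 1) with hγ
    set x : ℝ := ((j : ℝ) - i) / n with hx
    have hU0 : 0 ≤ U := by positivity
    have hγ0 : 0 ≤ γ := by positivity
    have hx0 : 0 ≤ x := div_nonneg (sub_nonneg.2 (by exact_mod_cast hij)) hn'.le
    have hx1 : (((j + 1 : ℕ) : ℝ) - i) / n = x + 1 / n := by
      rw [hx]; push_cast; ring
    rw [hx1]
    -- Discrete Gronwall: `1 + γ / n ≤ exp (γ / n)` closes the induction with the bound `U x exp (γ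
    -- x)`.
    have h1 : (1 + γ / n) * u ≤ Real.exp (γ / n) * (U * x * Real.exp (γ * x)) :=
      mul_le_mul (by linarith [Real.add_one_le_exp (γ / n)]) ih
        (integral_nonneg fun ω => dotProduct_self_nonneg' _) (Real.exp_pos _).le
    have h2 : Real.exp (γ * (x + 1 / n)) = Real.exp (γ / n) * Real.exp (γ * x) := by
      rw [← Real.exp_add]; congr 1; ring
    have h3 : 1 ≤ Real.exp (γ * (x + 1 / n)) := Real.one_le_exp (by positivity)
    have h4 : U / n * 1 ≤ U / n * Real.exp (γ * (x + 1 / n)) := by gcongr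
    calc u + ∫ ω, (∑ k, (2 * ((W j ω k - W i ω k) * b j ω k) + c j ω k k)) ∂μ
        ≤ (1 + γ / n) * u + U / n * 1 := by linarith
      _ ≤ Real.exp (γ / n) * (U * x * Real.exp (γ * x)) + U / n * Real.exp (γ * (x + 1 / n)) :=
          add_le_add h1 h4
      _ = U * (x + 1 / n) * Real.exp (γ * (x + 1 / n)) := by rw [h2]; ring

end IsAdaptedWalk

end Walk

/-! ### One step of the compensated characteristic function -/

section Walk

variable {Ω : Type*} {mΩ : MeasurableSpace Ω} {q : ℕ}

theorem integrable_linear_combination {f₁ f₂ f₃ f₄ : Ω → ℂ} {μ : Measure Ω} (h₁ : Integrable f₁ μ)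
    (h₂ : Integrable f₂ μ) (h₃ : Integrable f₃ μ) (h₄ : Integrable f₄ μ) (c₁ c₂ c₃ c₄ : ℂ) :
    Integrable (fun ω => c₁ * f₁ ω + c₂ * f₂ ω + c₃ * f₃ ω - c₄ * f₄ ω) μ :=
  (((h₁.const_mul _).add (h₂.const_mul _)).add (h₃.const_mul _)).sub (h₄.const_mul _)

theorem integral_linear_combination {f₁ f₂ f₃ f₄ : Ω → ℂ} {μ : Measure Ω} (h₁ : Integrable f₁ μ)
    (h₂ : Integrable f₂ μ) (h₃ : Integrable f₃ μ) (h₄ : Integrable f₄ μ) (c₁ c₂ c₃ c₄ : ℂ) :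
    ∫ ω, (c₁ * f₁ ω + c₂ * f₂ ω + c₃ * f₃ ω - c₄ * f₄ ω) ∂μ =
      c₁ * ∫ ω, f₁ ω ∂μ + c₂ * ∫ ω, f₂ ω ∂μ + c₃ * ∫ ω, f₃ ω ∂μ - c₄ * ∫ ω, f₄ ω ∂μ := by
  have h₁₂ : Integrable (fun ω => c₁ * f₁ ω + c₂ * f₂ ω) μ :=
    (h₁.const_mul _).add (h₂.const_mul _)
  have h₁₂₃ : Integrable (fun ω => c₁ * f₁ ω + c₂ * f₂ ω + c₃ * f₃ ω) μ := h₁₂.add (h₃.const_mul _)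
  rw [integral_sub h₁₂₃ (h₄.const_mul _), integral_add h₁₂ (h₃.const_mul _),
    integral_add (h₁.const_mul _) (h₂.const_mul _)]
  simp only [integral_const_mul]

theorem integral_affine_combination {f g : Ω → ℝ} {μ : Measure Ω} [IsProbabilityMeasure μ]
    (hf : Integrable f μ) (hg : Integrable g μ) (a b c : ℝ) :
    Integrable (fun ω => a * f ω + b * g ω + c) μ ∧
      ∫ ω, (a * f ω + b * g ω + c) ∂μ = a * ∫ ω, f ω ∂μ + b * ∫ ω, g ω ∂μ + c := by
  have h : Integrable (fun ω => a * f ω + b * g ω) μ := (hf.const_mul _).add (hg.const_mul _)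
  refine ⟨h.add (integrable_const _), ?_⟩
  rw [integral_add h (integrable_const _), integral_add (hf.const_mul _) (hg.const_mul _)]
  simp [integral_const_mul]

/-- Every contribution to the one-step error is a constant times `e / n`; for the term `(K / n)²`
this uses `1 / n ≤ e`. The constant is generous, since only linearity in `e / n` matters for the sum
over `O(n)` steps. -/
theorem step_error_le {n K B e q : ℝ} (hn' : 0 < n) (hK1 : 1 ≤ K) (hB0 : 0 ≤ B) (he0 : 0 ≤ e)
    (hne : 1 / n ≤ e) (hq0 : 0 ≤ q) :
    13 * (q * K * e * ((K + 1 + B) / n) + (K / n) ^ 2 * (q * B + 1) +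
      q * K * e * (K / n * (q + B + 1))) + 2 * (e / n) * (1 + B) ≤
      30 * K ^ 2 * (1 + q) ^ 2 * (1 + B) * (e / n) := by
  have e1 : (K / n) ^ 2 * (q * B + 1) ≤ K ^ 2 * (q * B + 1) * (e / n) := by
    have : (K / n) ^ 2 * (q * B + 1) = K ^ 2 * (q * B + 1) * ((1 / n) / n) := by
      field_simp
    rw [this]
    gcongr
  have e2 : 13 * (q * K * e * ((K + 1 + B) / n) + K ^ 2 * (q * B + 1) * (e / n) +
      q * K * e * (K / n * (q + B + 1))) + 2 * (e / n) * (1 + B) =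
      (13 * (q * (K * (K + 1 + B)) + K ^ 2 * (q * B + 1) + q * K ^ 2 * (q + B + 1)) +
        2 * (1 + B)) * (e / n) := by ring
  have e3 : K * (K + 1 + B) ≤ K ^ 2 * (2 + B) := by nlinarith [mul_nonneg hB0 (sub_nonneg.2 hK1)]
  have hK2 : 1 ≤ K ^ 2 := one_le_pow₀ hK1
  calc _ ≤ 13 * (q * K * e * ((K + 1 + B) / n) + K ^ 2 * (q * B + 1) * (e / n) +
      q * K * e * (K / n * (q + B + 1))) + 2 * (e / n) * (1 + B) := by gcongr
    _ = _ := e2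
    _ ≤ (13 * (q * (K ^ 2 * (2 + B)) + K ^ 2 * (q * B + 1) + q * K ^ 2 * (q + B + 1)) +
        2 * (K ^ 2 * (1 + B))) * (e / n) := by
        gcongr
        nlinarith
    _ = K ^ 2 * (13 * (q * (2 + B) + (q * B + 1) + q * (q + B + 1)) + 2 * (1 + B)) * (e / n) := by
        ring
    _ ≤ K ^ 2 * (30 * (1 + q) ^ 2 * (1 + B)) * (e / n) := by
        gcongr
        nlinarith [mul_nonneg hq0 hB0, mul_nonneg (mul_nonneg hq0 hq0) hB0]
    _ = _ := by ring

namespace IsAdaptedWalk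

variable {ℱ : Filtration ℕ mΩ} {μ : Measure Ω} {W b : ℕ → Ω → Fin q → ℝ}
  {c : ℕ → Ω → Fin q → Fin q → ℝ} {δ : ℝ} {N : ℕ}

theorem isWeakCondExp_dotProduct (h : IsAdaptedWalk ℱ μ W b c δ N) {j : ℕ} (hj : j < N)
    (a : Fin q → ℝ) :
    IsWeakCondExp (ℱ j) μ (fun ω => a ⬝ᵥ (W (j + 1) ω - W j ω)) (fun ω => a ⬝ᵥ b j ω) := by
  simp only [dotProduct, Pi.sub_apply]
  exact IsWeakCondExp.sum (ℱ.le j) _ fun k _ => (h.mean j hj k).const_mul (a k)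

theorem isWeakCondExp_dotProduct_sq (h : IsAdaptedWalk ℱ μ W b c δ N) {j : ℕ} (hj : j < N)
    (a : Fin q → ℝ) :
    IsWeakCondExp (ℱ j) μ (fun ω => (a ⬝ᵥ (W (j + 1) ω - W j ω)) ^ 2)
      (fun ω => ∑ i, ∑ k, a i * a k * c j ω i k) := by
  have h1 := IsWeakCondExp.sum (ℱ.le j) Finset.univ fun i _ =>
    IsWeakCondExp.sum (ℱ.le j) Finset.univ fun k _ => (h.second j hj i k).const_mul (a i * a k)
  convert h1 using 2 with ω
  rw [sq, dotProduct, Finset.sum_mul_sum]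
  exact Finset.sum_congr rfl fun i _ => Finset.sum_congr rfl fun k _ => by
    simp only [Pi.sub_apply]; ring

theorem integrable_exp [IsFiniteMeasure μ] (h : IsAdaptedWalk ℱ μ W b c δ N) {j : ℕ} (hj : j ≤ N)
    (a : Fin q → ℝ) (x : ℝ) :
    Integrable (fun ω => Complex.exp (Complex.I * ((a ⬝ᵥ W j ω : ℝ) : ℂ) + x)) μ := by
  have hm := h.measurable hj
  refine Integrable.of_bound (C := Real.exp x) ?_ (ae_of_all _ fun ω => ?_)
  · refine Measurable.aestronglyMeasurable ?_
    simp only [dotProduct]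
    fun_prop
  · rw [Complex.norm_exp]; simp

/-- One step of the characteristic function of `a ⬝ᵥ W`, compensated by `exp (ψ / 2)`. -/
theorem norm_integral_exp_succ_sub_le [IsProbabilityMeasure μ] (h : IsAdaptedWalk ℱ μ W b c δ N)
    {n : ℕ} (hn : 0 < n) {j : ℕ} (hj : j < N) {a a' : Fin q → ℝ} {x x' K B e Ψ : ℝ}
    (hK1 : 1 ≤ K) (hδ : δ ≤ e) (he1 : e ≤ 1) (hne : 1 / (n : ℝ) ≤ e) (hKn : K / n ≤ 1)
    (ha' : ∀ k, |a' k| ≤ K) (haa' : ∀ k, |a' k - a k| ≤ K / n) (hxx' : |x' - x| ≤ K / n)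
    (hx : x ≤ Ψ) (hB : ∫ ω, W j ω ⬝ᵥ W j ω ∂μ ≤ B)
    (h1 : ∀ᵐ ω ∂μ, |a' ⬝ᵥ b j ω + (a' - a) ⬝ᵥ W j ω| ≤ e / n * (1 + W j ω ⬝ᵥ W j ω))
    (h2 : ∀ᵐ ω ∂μ, |x' - x - ∑ i, ∑ k, a' i * a' k * c j ω i k| ≤
      e / n * (1 + W j ω ⬝ᵥ W j ω)) :
    ‖∫ ω, Complex.exp (Complex.I * ((a' ⬝ᵥ W (j + 1) ω : ℝ) : ℂ) + (x' / 2 : ℝ)) ∂μ -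
      ∫ ω, Complex.exp (Complex.I * ((a ⬝ᵥ W j ω : ℝ) : ℂ) + (x / 2 : ℝ)) ∂μ‖ ≤
      Real.exp (Ψ / 2) * (30 * K ^ 2 * (1 + q) ^ 2 * (1 + B) * (e / n)) := by
  have hn' : (0 : ℝ) < n := by exact_mod_cast hn
  have hm := ℱ.le j
  have he0 : 0 < e := lt_of_lt_of_le (by positivity) hne
  have hQint := h.integrable_dotProduct_self' hj.le
  set Q : Ω → ℝ := fun ω => W j ω ⬝ᵥ W j ω with hQ
  have hQ0 : ∀ ω, 0 ≤ Q ω := fun ω => dotProduct_self_nonneg' _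
  have hB0 : 0 ≤ B := (integral_nonneg hQ0).trans hB
  -- The exponent changes by `I (α + γ) + κ`: `α` comes from the step of the walk, `γ` from the
  -- change of row vector, `κ` from the compensator. Only `α` has mean square of order `1 / n`, so
  -- only `α` is expanded to second order.
  set α : Ω → ℝ := fun ω => a' ⬝ᵥ (W (j + 1) ω - W j ω) with hα
  set γ : Ω → ℝ := fun ω => (a' - a) ⬝ᵥ W j ω with hγ
  set κ : ℝ := (x' - x) / 2 with hκ
  set Φ : Ω → ℂ := fun ω => Complex.exp (Complex.I * ((a ⬝ᵥ W j ω : ℝ) : ℂ) + (x / 2 : ℝ)) with hΦ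
  set E1 : Ω → ℝ := fun ω => a' ⬝ᵥ b j ω with hE1
  set E2 : Ω → ℝ := fun ω => ∑ i, ∑ k, a' i * a' k * c j ω i k with hE2
  have hΦn : ∀ ω, ‖Φ ω‖ ≤ Real.exp (Ψ / 2) := by
    intro ω
    simp only [hΦ, Complex.norm_exp]
    simp
    linarith
  have hWm := h.meas j hj.le
  have hΦm : Measurable[ℱ j] Φ := by
    simp only [hΦ, dotProduct]
    fun_prop
  have hγm : Measurable[ℱ j] γ := by
    simp only [hγ, dotProduct]
    fun_prop
  have hw1 := h.isWeakCondExp_dotProduct hj a'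
  have hw2 := h.isWeakCondExp_dotProduct_sq hj a'
  have hΦb : ∃ C, ∀ᵐ ω ∂μ, ‖Φ ω‖ ≤ C := ⟨_, ae_of_all _ hΦn⟩
  have hγQ : ∀ ω, γ ω ^ 2 ≤ q * (K / n) ^ 2 * Q ω := fun ω =>
    sq_dotProduct_le (fun k => by simpa using haa' k) _
  have hγabs : ∀ ω, |γ ω| ≤ K / n * (q + Q ω) := by
    intro ω
    have h3 := abs_dotProduct_le (a := a' - a) (fun k => by simpa using haa' k) (W j ω)
    have h4 : |γ ω| ^ 2 ≤ (K / n * (q + Q ω)) ^ 2 := by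
      rw [sq_abs, mul_pow]
      refine (hγQ ω).trans ?_
      have := hQ0 ω
      have h5 : (q : ℝ) * Q ω ≤ (q + Q ω) ^ 2 := by
        nlinarith [sq_nonneg (q : ℝ), sq_nonneg (Q ω), mul_nonneg (Nat.cast_nonneg (α := ℝ) q) this]
      calc (q : ℝ) * (K / n) ^ 2 * Q ω = (K / n) ^ 2 * (q * Q ω) := by ring
        _ ≤ _ := by gcongr
    have h6 : 0 ≤ K / n * (q + Q ω) := by have := hQ0 ω; positivity
    exact le_of_sq_le_sq h4 h6 |>.trans le_rfl
  have hγint : Integrable γ μ := by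
    refine ((integrable_const (q : ℝ)).add hQint |>.const_mul (K / n)).mono'
      (hγm.mono hm le_rfl).aestronglyMeasurable (ae_of_all _ fun ω => hγabs ω)
  have hα2int : Integrable (fun ω => α ω ^ 2) μ := hw2.integrable_left
  have hκabs : |κ| ≤ K / n := by
    rw [hκ, abs_div, abs_two]
    have := abs_nonneg (x' - x)
    linarith
  set R : Ω → ℂ := fun ω => Complex.exp (Complex.I * (α ω + γ ω) + κ) - 1 -
    (Complex.I * (α ω + γ ω) + κ - (α ω : ℂ) ^ 2 / 2) with hR
  have hΦ' : ∀ ω, Complex.exp (Complex.I * ((a' ⬝ᵥ W (j + 1) ω : ℝ) : ℂ) + (x' / 2 : ℝ)) =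
      Φ ω * Complex.exp (Complex.I * (α ω + γ ω) + κ) := by
    intro ω
    rw [hΦ, ← Complex.exp_add]
    congr 1
    have h3 : a' ⬝ᵥ W (j + 1) ω = a ⬝ᵥ W j ω + α ω + γ ω := by
      simp only [hα, hγ, dotProduct_sub, sub_dotProduct]; ring
    have h4 : x' / 2 = x / 2 + κ := by rw [hκ]; ring
    rw [h3, h4]
    push_cast
    ring
  -- The small steps enter here: `|α| ≤ q K e` turns the cubic remainder into `e α²`, whose mean is
  -- `O(e / n)`.
  have hRb : ∀ᵐ ω ∂μ, ‖R ω‖ ≤ 13 * (q * K * e * α ω ^ 2 + (K / n) ^ 2 * (q * Q ω + 1) +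
      q * K * e * (K / n * (q + Q ω + 1))) := by
    filter_upwards [h.step j hj] with ω hω
    have hαe : |α ω| ≤ q * K * e :=
      (abs_dotProduct_le ha' _).trans (by gcongr; exact hω.trans hδ)
    refine (norm_exp_sub_taylor_le (α ω) (γ ω) κ (hκabs.trans hKn)).trans ?_
    have e1 : |α ω| ^ 3 ≤ q * K * e * α ω ^ 2 := by
      rw [pow_succ' |α ω|, sq_abs]; gcongr
    have e2 : γ ω ^ 2 + κ ^ 2 ≤ (K / n) ^ 2 * (q * Q ω + 1) := by
      have : κ ^ 2 ≤ (K / n) ^ 2 := by rw [← sq_abs κ]; gcongr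
      have := hγQ ω
      linarith
    have e3 : |α ω| * (|γ ω| + |κ|) ≤ q * K * e * (K / n * (q + Q ω + 1)) := by
      have := hγabs ω
      gcongr
      linarith
    linarith
  have hΦαint := IsWeakCondExp.integrable_mul hm hw1.integrable_left hΦm hΦb
  have hΦα2int := IsWeakCondExp.integrable_mul hm hw2.integrable_left hΦm hΦb
  have hΦE1int := IsWeakCondExp.integrable_mul hm hw1.integrable_right hΦm hΦb
  have hΦE2int := IsWeakCondExp.integrable_mul hm hw2.integrable_right hΦm hΦb
  have hΦγint := IsWeakCondExp.integrable_mul hm hγint hΦm hΦb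
  have hΦint : Integrable Φ μ := h.integrable_exp hj.le a _
  have hΦ'int := h.integrable_exp hj a' (x' / 2)
  have hΦRint : Integrable (fun ω => Φ ω * R ω) μ := by
    have h3 : (fun ω => Φ ω * R ω) = fun ω =>
        Complex.exp (Complex.I * ((a' ⬝ᵥ W (j + 1) ω : ℝ) : ℂ) + (x' / 2 : ℝ)) - Φ ω -
        (Complex.I * (Φ ω * (α ω : ℝ)) + Complex.I * (Φ ω * (γ ω : ℝ)) + κ * Φ ω -
          1 / 2 * (Φ ω * ((α ω ^ 2 : ℝ) : ℂ))) := by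
      ext ω
      rw [hΦ', hR]
      push_cast
      ring
    rw [h3]
    exact (hΦ'int.sub hΦint).sub
      (integrable_linear_combination hΦαint hΦγint hΦint hΦα2int _ _ _ _)
  -- `Φ` is measurable at time `j`, so `α` and `α²` may be replaced by `E1` and `E2`. What remains
  -- besides `R` is the drift mismatch `E1 + γ` and the variance mismatch `x' - x - E2`, controlled
  -- by `h1` and `h2`.
  have hdiff : ∫ ω, Complex.exp (Complex.I * ((a' ⬝ᵥ W (j + 1) ω : ℝ) : ℂ) + (x' / 2 : ℝ)) ∂μ -
      ∫ ω, Φ ω ∂μ = ∫ ω, Φ ω * R ω ∂μ +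
      ∫ ω, Φ ω * (Complex.I * ((E1 ω + γ ω : ℝ) : ℂ) + 1 / 2 * ((x' - x - E2 ω : ℝ) : ℂ)) ∂μ := by
    have h3 : ∫ ω, Φ ω * (Complex.I * ((E1 ω + γ ω : ℝ) : ℂ) +
        1 / 2 * ((x' - x - E2 ω : ℝ) : ℂ)) ∂μ =
        ∫ ω, (Complex.I * (Φ ω * (E1 ω : ℝ)) + Complex.I * (Φ ω * (γ ω : ℝ)) +
          κ * Φ ω - 1 / 2 * (Φ ω * ((E2 ω : ℝ) : ℂ))) ∂μ := by
      congr 1 with ω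
      rw [hκ]
      push_cast
      ring
    rw [h3, integral_linear_combination hΦE1int hΦγint hΦint hΦE2int,
      ← hw1.integral_eq Φ hΦm hΦb, ← hw2.integral_eq Φ hΦm hΦb,
      ← integral_linear_combination hΦαint hΦγint hΦint hΦα2int, ← integral_sub hΦ'int hΦint,
      ← integral_add hΦRint (integrable_linear_combination hΦαint hΦγint hΦint hΦα2int _ _ _ _)]
    congr 1 with ω
    rw [hΦ', hR]
    push_cast
    ring
  -- The variance hypothesis `h2` itself yields this bound, because `|x' - x| ≤ K / n`.
  have hE2int : ∫ ω, α ω ^ 2 ∂μ ≤ (K + 1 + B) / n := by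
    rw [hw2.integral_eq_integral]
    obtain ⟨i1, i2⟩ := integral_affine_combination hQint hQint (1 / (n : ℝ)) 0 ((K + 1) / n)
    have h3 : ∫ ω, E2 ω ∂μ ≤ ∫ ω, (1 / n * Q ω + 0 * Q ω + (K + 1) / n) ∂μ := by
      refine integral_mono_ae hw2.integrable_right i1 ?_
      filter_upwards [h2] with ω hω
      have h4 := neg_abs_le (x' - x - E2 ω)
      have h5 := le_abs_self (x' - x)
      have h6 : e / n * (1 + Q ω) ≤ 1 / n * (1 + Q ω) := by have := hQ0 ω; gcongr
      have h7 : (K + 1) / n = K / n + 1 / n := by ring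
      simp only [h7]
      linarith
    refine h3.trans ?_
    have : (K + 1 + B) / n = 1 / n * B + 0 * ∫ ω, Q ω ∂μ + (K + 1) / n := by ring
    rw [i2, this]
    gcongr
  have hI1 : ‖∫ ω, Φ ω * R ω ∂μ‖ ≤ Real.exp (Ψ / 2) *
      (13 * (q * K * e * ((K + 1 + B) / n) + (K / n) ^ 2 * (q * B + 1) +
      q * K * e * (K / n * (q + B + 1)))) := by
    obtain ⟨i1, i2⟩ := integral_affine_combination hα2int hQint (13 * (q * K * e))
      (13 * ((K / n) ^ 2 * q + q * K * e * (K / n)))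
      (13 * ((K / n) ^ 2 + q * K * e * (K / n * (q + 1))))
    refine (norm_integral_le_of_norm_le (i1.const_mul (Real.exp (Ψ / 2))) ?_).trans ?_
    · filter_upwards [hRb] with ω hω
      rw [norm_mul]
      refine mul_le_mul (hΦn ω) (hω.trans (le_of_eq ?_)) (norm_nonneg _) (Real.exp_pos _).le
      ring
    · rw [integral_const_mul, i2]
      have h3 : 13 * (q * K * e * ((K + 1 + B) / n) + (K / n) ^ 2 * (q * B + 1) +
          q * K * e * (K / n * (q + B + 1))) = 13 * (q * K * e) * ((K + 1 + B) / n) +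
          13 * ((K / n) ^ 2 * q + q * K * e * (K / n)) * B +
          13 * ((K / n) ^ 2 + q * K * e * (K / n * (q + 1))) := by ring
      rw [h3]
      gcongr
  have hI2 : ‖∫ ω, Φ ω * (Complex.I * ((E1 ω + γ ω : ℝ) : ℂ) +
      1 / 2 * ((x' - x - E2 ω : ℝ) : ℂ)) ∂μ‖ ≤ Real.exp (Ψ / 2) * (2 * (e / n) * (1 + B)) := by
    obtain ⟨i1, i2⟩ := integral_affine_combination hQint hQint (2 * (e / n)) 0 (2 * (e / n))
    refine (norm_integral_le_of_norm_le (i1.const_mul (Real.exp (Ψ / 2))) ?_).trans ?_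
    · filter_upwards [h1, h2] with ω hω1 hω2
      rw [norm_mul]
      refine mul_le_mul (hΦn ω) ((norm_add_le _ _).trans ?_) (norm_nonneg _) (Real.exp_pos _).le
      rw [norm_mul, norm_mul, Complex.norm_I, Complex.norm_real, Complex.norm_real,
        Real.norm_eq_abs, Real.norm_eq_abs]
      norm_num
      have : 0 ≤ e / n * (1 + Q ω) := (abs_nonneg _).trans hω1
      linarith
    · rw [integral_const_mul, i2]
      have : 2 * (e / n) * (1 + B) = 2 * (e / n) * B + 0 * ∫ ω, Q ω ∂μ + 2 * (e / n) := by ring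
      rw [this]
      gcongr
  rw [hdiff]
  refine (norm_add_le _ _).trans ((add_le_add hI1 hI2).trans ?_)
  rw [← mul_add]
  refine mul_le_mul_of_nonneg_left ?_ (Real.exp_pos _).le
  exact step_error_le hn' hK1 hB0 he0.le hne (Nat.cast_nonneg q)

end IsAdaptedWalk

end Walk

/-- Characteristic function of a walk, along row vectors `a j` that compensate the drift and
numbers `ψ j` that accumulate the variance. -/
theorem IsAdaptedWalk.norm_integral_exp_sub_one_le {Ω : Type*} {mΩ : MeasurableSpace Ω} {q : ℕ}
    {ℱ : Filtration ℕ mΩ} {μ : Measure Ω} {W b : ℕ → Ω → Fin q → ℝ}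
    {c : ℕ → Ω → Fin q → Fin q → ℝ} {δ : ℝ} {N : ℕ}
    [IsProbabilityMeasure μ] (h : IsAdaptedWalk ℱ μ W b c δ N)
    {n : ℕ} (hn : 0 < n) {M : ℕ} (hM : M ≤ N) {a : ℕ → Fin q → ℝ} {ψ : ℕ → ℝ} {K B e Ψ : ℝ}
    (hK1 : 1 ≤ K) (hδ : δ ≤ e) (he1 : e ≤ 1) (hne : 1 / (n : ℝ) ≤ e) (hKn : K / n ≤ 1)
    (hψ0 : ψ 0 = 0)
    (ha : ∀ j ≤ M, ∀ k, |a j k| ≤ K) (haa : ∀ j < M, ∀ k, |a (j + 1) k - a j k| ≤ K / n)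
    (hψψ : ∀ j < M, |ψ (j + 1) - ψ j| ≤ K / n)
    (hψ : ∀ j ≤ M, ψ j ≤ Ψ) (hB : ∀ j ≤ M, ∫ ω, W j ω ⬝ᵥ W j ω ∂μ ≤ B)
    (h1 : ∀ j < M, ∀ᵐ ω ∂μ, |a (j + 1) ⬝ᵥ b j ω + (a (j + 1) - a j) ⬝ᵥ W j ω| ≤
      e / n * (1 + W j ω ⬝ᵥ W j ω))
    (h2 : ∀ j < M, ∀ᵐ ω ∂μ,
      |ψ (j + 1) - ψ j - ∑ i, ∑ k, a (j + 1) i * a (j + 1) k * c j ω i k| ≤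
      e / n * (1 + W j ω ⬝ᵥ W j ω)) {j : ℕ} (hj : j ≤ M) :
    ‖∫ ω, Complex.exp (Complex.I * ((a j ⬝ᵥ W j ω : ℝ) : ℂ) + (ψ j / 2 : ℝ)) ∂μ - 1‖ ≤
      Real.exp (Ψ / 2) * (30 * K ^ 2 * (1 + q) ^ 2 * (1 + B) * (e / n)) * j := by
  induction j with
  | zero =>
    have h3 : ∫ ω, Complex.exp (Complex.I * ((a 0 ⬝ᵥ W 0 ω : ℝ) : ℂ) + (ψ 0 / 2 : ℝ)) ∂μ =
        ∫ _, (1 : ℂ) ∂μ := by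
      refine integral_congr_ae ?_
      filter_upwards [h.zero] with ω hω
      simp [hω, hψ0]
    rw [h3]
    simp
  | succ j ih =>
    have h3 := h.norm_integral_exp_succ_sub_le hn (show j < N by omega) hK1 hδ he1 hne hKn
      (ha (j + 1) hj) (haa j (by omega)) (hψψ j (by omega)) (hψ j (by omega)) (hB j (by omega))
      (h1 j (by omega)) (h2 j (by omega))
    have h4 := ih (by omega)
    refine (norm_sub_le_norm_sub_add_norm_sub _ _ _).trans ((add_le_add h3 h4).trans
      (le_of_eq ?_))
    push_cast
    ring

/-! ### Deterministic estimates: Taylor expansion, linearization, distance to the boundary -/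

section Deterministic

variable {q : ℕ}

theorem exists_lipschitzOnWith_driftField {f : Fin q → (Fin q → ℝ) → ℝ} {D : Set (Fin q → ℝ)}
    (hf : ∀ k, ∃ K : ℝ≥0, LipschitzOnWith K (f k) D) :
    ∃ L : ℝ≥0, LipschitzOnWith L (driftField f) D := by
  choose K hK using hf
  refine ⟨∑ k, K k, LipschitzOnWith.of_dist_le_mul fun x hx y hy => ?_⟩
  refine (dist_pi_le_iff (by positivity)).2 fun k => ((hK k).dist_le_mul x hx y hy).trans ?_
  gcongr
  exact Finset.single_le_sum (f := K) (fun _ _ => zero_le) (Finset.mem_univ k)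

theorem exists_norm_le_of_lipschitzOnWith {E : Type*} [SeminormedAddCommGroup E]
    {D : Set (Fin q → ℝ)} (hD : Bornology.IsBounded D) {φ : (Fin q → ℝ) → E} {L : ℝ≥0}
    (hφ : LipschitzOnWith L φ D) : ∃ K : ℝ, 0 ≤ K ∧ ∀ v ∈ D, ‖φ v‖ ≤ K := by
  obtain ⟨C, hC⟩ := Metric.isBounded_iff.1 hD
  rcases D.eq_empty_or_nonempty with rfl | ⟨x, hx⟩
  · exact ⟨0, le_rfl, by simp⟩
  · refine ⟨L * C + ‖φ x‖, ?_, fun v hv => ?_⟩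
    · have : 0 ≤ C := dist_nonneg.trans (hC hx hx)
      positivity
    · have h1 := hφ.dist_le_mul v hv x hx
      have h2 : (L : ℝ) * dist v x ≤ L * C := by gcongr; exact hC hv hx
      have h3 := norm_le_norm_sub_add (φ v) (φ x)
      rw [← dist_eq_norm] at h3
      linarith

/-- First-order Taylor expansion of a `C¹` function, uniformly on a compact interval. -/
theorem exists_taylor_one_uniform {φ φ' : ℝ → ℝ} {T : ℝ}
    (hφ : ∀ s ∈ Set.Icc 0 T, HasDerivWithinAt φ (φ' s) (Set.Icc 0 T) s)
    (hc : ContinuousOn φ' (Set.Icc 0 T)) {η : ℝ} (hη : 0 < η) :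
    ∃ δ > 0, ∀ s ∈ Set.Icc 0 T, ∀ s' ∈ Set.Icc 0 T, s ≤ s' → s' - s ≤ δ →
      |φ s' - φ s - (s' - s) * φ' s| ≤ η * (s' - s) := by
  have hu := isCompact_Icc.uniformContinuousOn_of_continuous hc
  obtain ⟨δ, hδ, h⟩ := Metric.uniformContinuousOn_iff.1 hu η hη
  refine ⟨δ / 2, by positivity, fun s hs s' hs' hle hd => ?_⟩
  have hsub : Set.Icc s s' ⊆ Set.Icc 0 T := Set.Icc_subset_Icc hs.1 hs'.2
  have h1 : ∀ r ∈ Set.Icc s s', HasDerivWithinAt (fun r => φ r - r * φ' s) (φ' r - φ' s)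
      (Set.Icc s s') r := by
    intro r hr
    have := ((hφ r (hsub hr)).mono hsub).sub (((hasDerivWithinAt_id r _).mul_const (φ' s)))
    rw [one_mul] at this
    exact this
  have h2 := (convex_Icc s s').norm_image_sub_le_of_norm_hasDerivWithin_le (C := η) h1
    (fun r hr => by
      have := h r (hsub hr) s hs (by rw [Real.dist_eq, abs_of_nonneg] <;> linarith [hr.1, hr.2])
      rw [Real.dist_eq] at this
      exact this.le) (Set.left_mem_Icc.2 hle) (Set.right_mem_Icc.2 hle)
  rw [Real.norm_eq_abs, Real.norm_eq_abs, abs_of_nonneg (sub_nonneg.2 hle)] at h2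
  convert h2 using 2
  ring

theorem jacobian_mulVec (f : Fin q → (Fin q → ℝ) → ℝ) (v w : Fin q → ℝ) (i : Fin q) :
    (jacobian f v).mulVec w i = fderiv ℝ (f i) v w := by
  have h : w = ∑ j, w j • (Pi.single j (1 : ℝ) : Fin q → ℝ) := by
    conv_lhs => rw [← Finset.univ_sum_single w]
    refine Finset.sum_congr rfl fun j _ => ?_
    rw [← Pi.single_smul]; simp
  conv_rhs => rw [h, map_sum]
  simp [Matrix.mulVec, dotProduct, jacobian, mul_comm]

/-- A Lipschitz constant bounds the derivative. This keeps the coefficients of the linear system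
bounded up to `τ`, even if the path approaches the boundary of `D`. -/
theorem abs_jacobian_le {f : Fin q → (Fin q → ℝ) → ℝ} {D : Set (Fin q → ℝ)} (hD : IsOpen D)
    {L : ℝ≥0} (hf : LipschitzOnWith L (driftField f) D) {v : Fin q → ℝ} (hv : v ∈ D)
    (i j : Fin q) : |jacobian f v i j| ≤ L := by
  have h1 : LipschitzOnWith L (f i) D := fun x hx y hy =>
    (edist_le_pi_edist (driftField f x) (driftField f y) i).trans (hf hx hy)
  have h2 : ‖fderiv ℝ (f i) v‖ ≤ L := norm_fderiv_le_of_lipschitzOn ℝ (hD.mem_nhds hv) h1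
  have h3 := (fderiv ℝ (f i) v).le_opNorm (Pi.single j (1 : ℝ))
  rw [Pi.norm_single, norm_one, mul_one] at h3
  exact h3.trans h2

/-- Uniform linearization of the drift near a compact subset of `D`. -/
theorem exists_linearization {f : Fin q → (Fin q → ℝ) → ℝ} {D : Set (Fin q → ℝ)} (hD : IsOpen D)
    {L : ℝ≥0} (hf : LipschitzOnWith L (driftField f) D) (hC1 : ∀ k, ContDiffOn ℝ 1 (f k) D)
    {S : Set (Fin q → ℝ)} (hS : IsCompact S) (hSD : S ⊆ D) {η : ℝ} (hη : 0 < η) :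
    ∃ K > 0, ∃ ρ > 0, ∀ z ∈ S, ∀ y ∈ D, ‖y - z‖ ≤ ρ → ∀ v ∈ D, ∀ i,
      |f i v - f i y - (jacobian f z).mulVec (v - y) i| ≤ η * ‖v - y‖ + K * ‖v - y‖ ^ 2 := by
  have hfi : ∀ i, LipschitzOnWith L (f i) D := fun i x hx y hy =>
    (edist_le_pi_edist (driftField f x) (driftField f y) i).trans (hf hx hy)
  obtain ⟨r₀, hr₀, hball⟩ := hS.exists_thickening_subset_open hD hSD
  have hfd : ∀ i, ∃ r > 0, ∀ z ∈ S, ∀ v, dist z v < r →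
      dist (fderiv ℝ (f i) z) (fderiv ℝ (f i) v) < η := by
    intro i
    have h1 := hS.uniformContinuousAt_of_continuousAt (fderiv ℝ (f i)) (fun a ha =>
      (((hC1 i).continuousOn_fderiv_of_isOpen hD le_rfl).continuousAt (hD.mem_nhds (hSD ha))))
      (Metric.dist_mem_uniformity hη)
    obtain ⟨r, hr, h2⟩ := Metric.mem_uniformity_dist.1 h1
    exact ⟨r, hr, fun z hz v hv => h2 hv hz⟩
  choose r hr hrd using hfd
  obtain ⟨r₁, hr₁, hr₁r⟩ : ∃ r₁ > 0, ∀ i, r₁ ≤ r i := by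
    rcases isEmpty_or_nonempty (Fin q) with hq | hq
    · exact ⟨1, one_pos, fun i => hq.elim i⟩
    · obtain ⟨i₀, hi₀⟩ := Finite.exists_min r
      exact ⟨r i₀, hr i₀, hi₀⟩
  set R := min r₀ r₁ with hR
  have hR0 : 0 < R := lt_min hr₀ hr₁
  -- If `v` is within `R` of `z`, the mean value inequality on the ball gives the term with `η`.
  -- Otherwise `‖v - y‖ ≥ R / 2`, and the Lipschitz bound `2 L ‖v - y‖` is at most `(4 L / R) ‖v -
  -- y‖²`. Thus all `v ∈ D` are covered although `D` need not be convex.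
  refine ⟨4 * L / R + 1, by positivity, R / 2, by positivity, fun z hz y hy hyz v hv i => ?_⟩
  rw [jacobian_mulVec]
  by_cases hvz : dist v z < R
  · have hsub : Metric.ball z R ⊆ D := fun w hw => hball (Metric.mem_thickening_iff.2
      ⟨z, hz, (Metric.mem_ball.1 hw).trans_le (min_le_left _ _)⟩)
    have h1 := Convex.norm_image_sub_le_of_norm_fderiv_le' (𝕜 := ℝ) (f := f i)
      (s := Metric.ball z R) (C := η) (φ := fderiv ℝ (f i) z)
      (fun w hw => ((hC1 i).differentiableOn one_ne_zero).differentiableAt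
        (hD.mem_nhds (hsub hw)))
      (fun w hw => by
        rw [← dist_eq_norm, dist_comm]
        refine (hrd i z hz w ?_).le
        rw [dist_comm]
        exact (Metric.mem_ball.1 hw).trans_le ((min_le_right _ _).trans (hr₁r i)))
      (convex_ball z R) (x := y) (y := v)
      (by rw [Metric.mem_ball, dist_eq_norm]; linarith) hvz
    rw [Real.norm_eq_abs] at h1
    have : 0 ≤ (4 * L / R + 1) * ‖v - y‖ ^ 2 := by positivity
    linarith
  · have h1 : R / 2 ≤ ‖v - y‖ := by
      have := dist_triangle v y z
      rw [dist_eq_norm v y, dist_eq_norm y z] at this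
      linarith
    have h2 : |f i v - f i y| ≤ L * ‖v - y‖ := by
      have := (hfi i).dist_le_mul v hv y hy
      rwa [Real.dist_eq, dist_eq_norm] at this
    have h3 : |fderiv ℝ (f i) z (v - y)| ≤ L * ‖v - y‖ :=
      (fderiv ℝ (f i) z).le_of_opNorm_le
        (norm_fderiv_le_of_lipschitzOn ℝ (hD.mem_nhds (hSD hz)) (hfi i)) _
    have h4 : |f i v - f i y - fderiv ℝ (f i) z (v - y)| ≤ 2 * L * ‖v - y‖ :=
      (abs_sub _ _).trans (by linarith)
    have h5 : 2 * L * ‖v - y‖ ≤ 4 * L / R * ‖v - y‖ ^ 2 := by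
      have : 2 * L * ‖v - y‖ = 4 * L / R * (‖v - y‖ * (R / 2)) := by field_simp; ring
      rw [this, sq]
      gcongr
    have : 0 ≤ η * ‖v - y‖ := by positivity
    nlinarith [sq_nonneg ‖v - y‖]

/-- The segment from `y` to `v` is connected and leaves the open set `D`, so it meets the frontier,
at a point no farther from `y` than `v` is. -/
theorem infDist_frontier_le_dist {D : Set (Fin q → ℝ)} (hD : IsOpen D) {y v : Fin q → ℝ} (hy : y ∈ D)
    (hv : v ∉ D) : Metric.infDist y (frontier D) ≤ dist y v := by
  obtain ⟨w, hw, hwD⟩ : ∃ w ∈ segment ℝ y v, w ∈ frontier D := by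
    by_contra! h
    refine hv ((convex_segment y v).isPreconnected.subset_of_closure_inter_subset hD
      ⟨y, left_mem_segment ℝ y v, hy⟩ (fun w hw => ?_) (right_mem_segment ℝ y v))
    by_contra hwD
    exact h w hw.2 (hD.frontier_eq ▸ ⟨hw.1, hwD⟩)
  refine (Metric.infDist_le_dist_of_mem hwD).trans ?_
  rw [dist_eq_norm, dist_eq_norm]
  rw [segment_eq_image'] at hw
  obtain ⟨θ, hθ, rfl⟩ := hw
  simp only [sub_add_cancel_left, norm_neg, norm_smul, Real.norm_eq_abs, abs_of_nonneg hθ.1]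
  rw [norm_sub_rev]
  exact mul_le_of_le_one_left (norm_nonneg _) hθ.2

end Deterministic

/-! ### Solutions of the fluid equation -/

namespace IsSolutionOn

variable {q : ℕ} {f : Fin q → (Fin q → ℝ) → ℝ} {D : Set (Fin q → ℝ)} {x x' : Fin q → ℝ}
  {z z' : ℝ → Fin q → ℝ} {I J : Set ℝ}

theorem mono (h : IsSolutionOn f D x z I) (hJ : J ⊆ I) : IsSolutionOn f D x z J :=
  ⟨h.init, fun s hs => h.mem s (hJ hs), fun s hs => (h.deriv s (hJ hs)).mono hJ⟩

theorem continuousOn (h : IsSolutionOn f D x z I) : ContinuousOn z I :=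
  fun s hs => (h.deriv s hs).continuousWithinAt

theorem norm_sub_le (h : IsSolutionOn f D x z I) (hI : Convex ℝ I) {K : ℝ}
    (hK : ∀ v ∈ D, ‖driftField f v‖ ≤ K) {s s' : ℝ} (hs : s ∈ I) (hs' : s' ∈ I) :
    ‖z s' - z s‖ ≤ K * |s' - s| :=
  hI.norm_image_sub_le_of_norm_hasDerivWithin_le h.deriv (fun r hr => hK _ (h.mem r hr)) hs hs'

/-- The velocity `F(z)` is Lipschitz in time with constant `L K`, which gives a quadratic error
without a second derivative of `z`. -/
theorem norm_taylor_le (h : IsSolutionOn f D x z I) (hI : Convex ℝ I) {K : ℝ}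
    (hK : ∀ v ∈ D, ‖driftField f v‖ ≤ K) {L : ℝ≥0} (hL : LipschitzOnWith L (driftField f) D)
    {s s' : ℝ} (hs : s ∈ I) (hs' : s' ∈ I) (hle : s ≤ s') :
    ‖z s' - z s - (s' - s) • driftField f (z s)‖ ≤ L * K * (s' - s) ^ 2 := by
  have hsub : Set.Icc s s' ⊆ I := hI.ordConnected.out hs hs'
  have h1 : ∀ r ∈ Set.Icc s s', HasDerivWithinAt (fun r => z r - r • driftField f (z s))
      (driftField f (z r) - driftField f (z s)) (Set.Icc s s') r := by
    intro r hr
    have := ((h.deriv r (hsub hr)).mono hsub).sub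
      (((hasDerivWithinAt_id r _).smul_const (driftField f (z s))))
    rw [one_smul] at this
    exact this
  have h2 := (convex_Icc s s').norm_image_sub_le_of_norm_hasDerivWithin_le
    (C := L * (K * (s' - s))) h1
    (fun r hr => by
      have h3 := hL.dist_le_mul _ (h.mem r (hsub hr)) _ (h.mem s hs)
      rw [dist_eq_norm, dist_eq_norm] at h3
      refine h3.trans ?_
      have h4 := h.norm_sub_le hI hK hs (hsub hr)
      rw [abs_of_nonneg (sub_nonneg.2 hr.1)] at h4
      have hK0 : 0 ≤ K := (norm_nonneg _).trans (hK _ (h.mem s hs))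
      have := hr.2
      gcongr
      refine h4.trans ?_
      gcongr) (Set.left_mem_Icc.2 hle) (Set.right_mem_Icc.2 hle)
  rw [Real.norm_eq_abs, abs_of_nonneg (sub_nonneg.2 hle)] at h2
  have e1 : z s' - z s - (s' - s) • driftField f (z s) =
      z s' - s' • driftField f (z s) - (z s - s • driftField f (z s)) := by
    rw [sub_smul]; abel
  rw [e1]
  refine h2.trans (le_of_eq ?_)
  ring

/-- Gronwall's inequality. It serves both for continuity in the initial value and, with `x = x'`,
for uniqueness. -/
theorem dist_le {T : ℝ} (h : IsSolutionOn f D x z (Set.Icc 0 T))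
    (h' : IsSolutionOn f D x' z' (Set.Icc 0 T)) {L : ℝ≥0}
    (hL : LipschitzOnWith L (driftField f) D) {s : ℝ} (hs : s ∈ Set.Icc 0 T) :
    dist (z s) (z' s) ≤ dist x x' * Real.exp (L * s) := by
  have hd : ∀ {x z}, IsSolutionOn f D x z (Set.Icc 0 T) → ∀ t ∈ Set.Ico 0 T,
      HasDerivWithinAt z (driftField f (z t)) (Set.Ici t) t := fun h t ht =>
    (h.deriv t (Set.Ico_subset_Icc_self ht)).mono_of_mem_nhdsWithin
      (Icc_mem_nhdsGE_of_mem ht)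
  have := dist_le_of_trajectories_ODE_of_mem (v := fun _ => driftField f) (s := fun _ => D)
    (δ := dist x x') (fun _ _ => hL) h.continuousOn (hd h)
    (fun t ht => h.mem t (Set.Ico_subset_Icc_self ht)) h'.continuousOn (hd h')
    (fun t ht => h'.mem t (Set.Ico_subset_Icc_self ht)) (by rw [h.init, h'.init]) s hs
  simpa using this

/-- Up to the time `σ`, the solution keeps distance `δ` from the boundary. -/
theorem le_infDist_of_le_sigma {T δ : ℝ} (h : IsSolutionOn f D x z (Set.Icc 0 T)) (hT : 0 ≤ T)
    {L : ℝ≥0} (hL : LipschitzOnWith L (driftField f) D) (hσ : (T : EReal) ≤ sigma f D x δ)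
    {s : ℝ} (hs : s ∈ Set.Icc 0 T) : δ ≤ Metric.infDist (z s) (frontier D) := by
  -- The supremum in `sigma` ranges over arbitrary solutions from `x`; by uniqueness each of them
  -- agrees with `z` on the common interval.
  have key : ∀ t z', 0 ≤ t → IsSolutionOn f D x z' (Set.Icc 0 t) →
      (∀ s ∈ Set.Icc 0 t, δ < Metric.infDist (z' s) (frontier D)) → ∀ s ∈ Set.Icc 0 T, s ≤ t →
      δ ≤ Metric.infDist (z s) (frontier D) := by
    intro t z' _ hz' hd s hs hst
    have h1 := (h.mono (Set.Icc_subset_Icc_right hs.2)).dist_le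
      (hz'.mono (Set.Icc_subset_Icc_right hst)) hL (Set.right_mem_Icc.2 hs.1)
    rw [dist_self, zero_mul, dist_le_zero] at h1
    rw [h1]
    exact (hd s ⟨hs.1, hst⟩).le
  have hlt : ∀ r : EReal, r < T → ∃ (t : ℝ) (z' : ℝ → Fin q → ℝ), r < (t : EReal) ∧ 0 ≤ t ∧
      IsSolutionOn f D x z' (Set.Icc 0 t) ∧
      ∀ s ∈ Set.Icc 0 t, δ < Metric.infDist (z' s) (frontier D) := by
    intro r hr
    obtain ⟨u, ⟨t, rfl, ht, z', hz'⟩, hu⟩ := lt_sSup_iff.1 (hr.trans_le hσ)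
    exact ⟨t, z', hu, ht, hz'⟩
  have hIco : ∀ r ∈ Set.Ico 0 T, δ ≤ Metric.infDist (z r) (frontier D) := by
    intro r hr
    obtain ⟨t, z', hrt, ht, hz', hd⟩ := hlt r (EReal.coe_lt_coe_iff.2 hr.2)
    exact key t z' ht hz' hd r ⟨hr.1, hr.2.le⟩ (EReal.coe_lt_coe_iff.1 hrt).le
  rcases hs.2.lt_or_eq with hsT | rfl
  · exact hIco s ⟨hs.1, hsT⟩
  -- The supremum need not be attained, so the end point is reached by continuity, at the cost of
  -- the strict inequality. For `T = 0` there are no earlier times, but `0 ≤ σ` says that the set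
  -- defining `σ` is nonempty.
  rcases hT.eq_or_lt with rfl | hT0
  · obtain ⟨t, z', -, ht, hz', hd⟩ := hlt ⊥ (EReal.bot_lt_coe _)
    exact key t z' ht hz' hd 0 ⟨le_rfl, le_rfl⟩ ht
  · have hc : ContinuousWithinAt (fun r => Metric.infDist (z r) (frontier D)) (Set.Ico 0 s) s :=
      (Metric.continuous_infDist_pt _).continuousAt.comp_continuousWithinAt
        ((h.continuousOn s hs).mono Set.Ico_subset_Icc_self)
    have : (𝓝[Set.Ico 0 s] s).NeBot := by
      rw [← mem_closure_iff_nhdsWithin_neBot, closure_Ico hT0.ne]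
      exact hs
    exact ge_of_tendsto hc (eventually_mem_nhdsWithin.mono hIco)

end IsSolutionOn

/-! ### The normalized process stopped at the exit from `D` -/

section StoppedWalk

variable {Ω : Type*} {q : ℕ}

/-- The event that `n⁻¹ X_i ∈ D` for all `i ≤ j`. -/
def inDomain (n : ℕ) (X : ℕ → Ω → Fin q → ℝ) (D : Set (Fin q → ℝ)) (j : ℕ) : Set Ω :=
  {ω | ∀ i ≤ j, (n : ℝ)⁻¹ • X i ω ∈ D}

theorem mem_inDomain_iff {n : ℕ} {X : ℕ → Ω → Fin q → ℝ} {D : Set (Fin q → ℝ)} {j : ℕ} {ω : Ω} :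
    ω ∈ inDomain n X D j ↔ (j : ℕ∞) < exitTime n X D ω := by
  constructor
  · intro h
    refine lt_of_lt_of_le (ENat.natCast_lt_natCast.2 (Nat.lt_succ_self j)) (le_sInf ?_)
    rintro _ ⟨m, rfl, hm⟩
    refine ENat.natCast_le_natCast.2 (Nat.succ_le_of_lt ?_)
    by_contra! hmj
    exact hm (h m hmj)
  · intro h i hi
    by_contra hD
    have h1 : exitTime n X D ω ≤ i := sInf_le ⟨i, rfl, hD⟩
    exact absurd (h.trans_le h1) (not_lt.2 (ENat.natCast_le_natCast.2 hi))

theorem inDomain_anti {n : ℕ} {X : ℕ → Ω → Fin q → ℝ} {D : Set (Fin q → ℝ)} {i j : ℕ}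
    (hij : i ≤ j) : inDomain n X D j ⊆ inDomain n X D i :=
  fun _ h l hl => h l (hl.trans hij)

theorem measurableSet_inDomain {mΩ : MeasurableSpace Ω} {ℱ : Filtration ℕ mΩ} {n : ℕ}
    {X : ℕ → Ω → Fin q → ℝ} {D : Set (Fin q → ℝ)} (hD : IsOpen D) {j : ℕ}
    (hX : ∀ i ≤ j, Measurable[ℱ i] (X i)) : MeasurableSet[ℱ j] (inDomain n X D j) := by
  have h : inDomain n X D j = ⋂ i ∈ Set.Iic j, {ω | (n : ℝ)⁻¹ • X i ω ∈ D} := by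
    ext ω; simp [inDomain]
  rw [h]
  refine MeasurableSet.biInter (Set.to_countable _) fun i hi => ?_
  have h1 : Measurable[ℱ j] fun ω => (n : ℝ)⁻¹ • X i ω :=
    ((hX i hi).mono (ℱ.mono hi) le_rfl).const_smul (n : ℝ)⁻¹
  exact h1 hD.measurableSet

/-- The process `(X j - n y j) / √n`, stopped when `n⁻¹ X` leaves `D`. -/
noncomputable def stoppedWalk (n : ℕ) (X : ℕ → Ω → Fin q → ℝ) (D : Set (Fin q → ℝ))
    (y : ℕ → Fin q → ℝ) (j : ℕ) (ω : Ω) : Fin q → ℝ := fun k =>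
  (√n)⁻¹ * (X 0 ω k - n * y 0 k) + ∑ i ∈ Finset.range j,
    (inDomain n X D i).indicator (fun _ => (√n)⁻¹) ω *
      ((X (i + 1) ω k - X i ω k) + -(n * (y (i + 1) k - y i k)))

theorem stoppedWalk_succ_sub (n : ℕ) (X : ℕ → Ω → Fin q → ℝ) (D : Set (Fin q → ℝ))
    (y : ℕ → Fin q → ℝ) (j : ℕ) (ω : Ω) (k : Fin q) :
    stoppedWalk n X D y (j + 1) ω k - stoppedWalk n X D y j ω k =
      (inDomain n X D j).indicator (fun _ => (√n)⁻¹) ω *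
        ((X (j + 1) ω k - X j ω k) + -(n * (y (j + 1) k - y j k))) := by
  simp only [stoppedWalk, Finset.sum_range_succ]
  ring

/-- As long as the process has not left `D` before, the stopped process is the original one. -/
theorem stoppedWalk_eq {n : ℕ} {X : ℕ → Ω → Fin q → ℝ} {D : Set (Fin q → ℝ)}
    {y : ℕ → Fin q → ℝ} {j : ℕ} {ω : Ω} (h : ∀ i < j, ω ∈ inDomain n X D i) (k : Fin q) :
    stoppedWalk n X D y j ω k = (√n)⁻¹ * (X j ω k - n * y j k) := by
  induction j with
  | zero => simp [stoppedWalk]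
  | succ j ih =>
    have h1 := stoppedWalk_succ_sub n X D y j ω k
    rw [Set.indicator_of_mem (h j (Nat.lt_succ_self j)), ih fun i hi => h i (by omega)] at h1
    rw [sub_eq_iff_eq_add.1 h1]
    ring

/-- The indicator of step `i → i + 1` refers to times up to `i`, so the step that leaves `D` is
still taken and only later ones are suppressed: the walk freezes at a position outside `D`. -/
theorem stoppedWalk_eq_of_notMem {n : ℕ} {X : ℕ → Ω → Fin q → ℝ} {D : Set (Fin q → ℝ)}
    {y : ℕ → Fin q → ℝ} {i j : ℕ} {ω : Ω} (hij : i ≤ j) (h : ω ∉ inDomain n X D i) :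
    stoppedWalk n X D y j ω = stoppedWalk n X D y i ω := by
  induction j, hij using Nat.le_induction with
  | base => rfl
  | succ j hij ih =>
    rw [← ih]
    ext k
    have h1 := stoppedWalk_succ_sub n X D y j ω k
    rw [Set.indicator_of_notMem (fun hj => h (inDomain_anti hij hj)), zero_mul] at h1
    exact sub_eq_zero.1 h1

theorem inv_smul_sub_eq {n : ℕ} (hn : 0 < n) {X : ℕ → Ω → Fin q → ℝ} {D : Set (Fin q → ℝ)}
    {y : ℕ → Fin q → ℝ} {j : ℕ} {ω : Ω} (h : ∀ i < j, ω ∈ inDomain n X D i) :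
    stoppedWalk n X D y j ω = √n • ((n : ℝ)⁻¹ • X j ω - y j) := by
  have hn' : (0 : ℝ) < n := by exact_mod_cast hn
  ext k
  rw [stoppedWalk_eq h]
  simp only [Pi.smul_apply, Pi.sub_apply, smul_eq_mul]
  have h1 : √(n : ℝ) * √n = n := Real.mul_self_sqrt hn'.le
  have h2 : √(n : ℝ) ≠ 0 := (Real.sqrt_pos.2 hn').ne'
  field_simp
  rw [sq, h1]

/-- After the exit from `D` the stopped process is far from `0`. -/
theorem le_norm_stoppedWalk {n : ℕ} (hn : 0 < n) {X : ℕ → Ω → Fin q → ℝ} {D : Set (Fin q → ℝ)}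
    (hD : IsOpen D) {y : ℕ → Fin q → ℝ} {j : ℕ} {ω : Ω} (h : ω ∉ inDomain n X D j) {r : ℝ}
    (hy : ∀ i ≤ j, y i ∈ D) (hr : ∀ i ≤ j, r ≤ Metric.infDist (y i) (frontier D)) :
    √n * r ≤ ‖stoppedWalk n X D y j ω‖ := by
  classical
  have hex : ∃ i, ω ∉ inDomain n X D i := ⟨j, h⟩
  -- `i` is the exit time. The frozen value is `√n (n⁻¹ X i - y i)` with `n⁻¹ X i ∉ D`, so its size
  -- is bounded below by `√n` times the distance of `y i` from the frontier.
  set i := Nat.find hex with hi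
  have hij : i ≤ j := Nat.find_min' hex h
  have hiD : ω ∉ inDomain n X D i := Nat.find_spec hex
  have hlt : ∀ l < i, ω ∈ inDomain n X D l := fun l hl => not_not.1 (Nat.find_min hex hl)
  rw [stoppedWalk_eq_of_notMem hij hiD, inv_smul_sub_eq hn hlt, norm_smul,
    Real.norm_of_nonneg (Real.sqrt_nonneg _)]
  have hXi : (n : ℝ)⁻¹ • X i ω ∉ D := by
    intro hmem
    refine hiD fun l hl => ?_
    rcases hl.lt_or_eq with hl | rfl
    · exact hlt l hl l le_rfl
    · exact hmem
  have := (hr i hij).trans (infDist_frontier_le_dist hD (hy i hij) hXi)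
  rw [dist_comm, dist_eq_norm] at this
  gcongr

end StoppedWalk

/-! ### Conditional moments of the stopped process given the initial value -/

section StoppedWalk

variable {Ω : Type*} {mΩ : MeasurableSpace Ω} {q : ℕ}

/-- Bounded steps, conditional drift close to `f` and conditional second moments close to `g`
while `n⁻¹ X` is in `D`. -/
structure HasDriftAndDiffusion (P : Measure Ω) (ℱ : Filtration ℕ mΩ) (X : ℕ → Ω → Fin q → ℝ)
    (n M : ℕ) (D : Set (Fin q → ℝ)) (f : Fin q → (Fin q → ℝ) → ℝ)
    (g : Fin q → Fin q → (Fin q → ℝ) → ℝ) (β l₁ l₂ : ℝ) : Prop where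
  meas : ∀ m ≤ M, Measurable[ℱ m] (X m)
  memLp : ∀ m < M, ∀ k, MemLp (fun ω => X (m + 1) ω k - X m ω k) 2 P
  step : ∀ m < M, ∀ᵐ ω ∂P, ω ∈ inDomain n X D m → ‖X (m + 1) ω - X m ω‖ ≤ β
  drift : ∀ m < M, ∀ k, ∀ᵐ ω ∂P, ω ∈ inDomain n X D m →
    |(P[fun ω' => X (m + 1) ω' k - X m ω' k | ℱ m]) ω - f k ((n : ℝ)⁻¹ • X m ω)| ≤ l₁
  second : ∀ m < M, ∀ i j, ∀ᵐ ω ∂P, ω ∈ inDomain n X D m →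
    |(P[fun ω' => (X (m + 1) ω' i - X m ω' i) * (X (m + 1) ω' j - X m ω' j) | ℱ m]) ω -
      g i j ((n : ℝ)⁻¹ • X m ω)| ≤ l₂

/-- Conditional drift of the stopped process. -/
noncomputable def stoppedDrift (P : Measure Ω) (ℱ : Filtration ℕ mΩ) (n : ℕ)
    (X : ℕ → Ω → Fin q → ℝ) (D : Set (Fin q → ℝ)) (y : ℕ → Fin q → ℝ) (j : ℕ) (ω : Ω) :
    Fin q → ℝ := fun k =>
  (inDomain n X D j).indicator (fun _ => (√n)⁻¹) ω *
    ((P[fun ω' => X (j + 1) ω' k - X j ω' k | ℱ j]) ω + -(n * (y (j + 1) k - y j k)))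

/-- Conditional second moments of the increments of the stopped process. -/
noncomputable def stoppedSecond (P : Measure Ω) (ℱ : Filtration ℕ mΩ) (n : ℕ)
    (X : ℕ → Ω → Fin q → ℝ) (D : Set (Fin q → ℝ)) (y : ℕ → Fin q → ℝ) (j : ℕ) (ω : Ω) :
    Fin q → Fin q → ℝ := fun i k =>
  (inDomain n X D j).indicator (fun _ => (n : ℝ)⁻¹) ω *
    ((P[fun ω' => (X (j + 1) ω' i - X j ω' i) * (X (j + 1) ω' k - X j ω' k) | ℱ j]) ω +
      -(n * (y (j + 1) k - y j k)) * (P[fun ω' => X (j + 1) ω' i - X j ω' i | ℱ j]) ω +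
      -(n * (y (j + 1) i - y j i)) * (P[fun ω' => X (j + 1) ω' k - X j ω' k | ℱ j]) ω +
      n * (y (j + 1) i - y j i) * (n * (y (j + 1) k - y j k)))

theorem ae_cond_of_ae {P : Measure Ω} {A : Set Ω} {p : Ω → Prop} (h : ∀ᵐ ω ∂P, p ω) :
    ∀ᵐ ω ∂(ProbabilityTheory.cond P A), p ω :=
  cond_absolutelyContinuous.ae_le h

namespace HasDriftAndDiffusion

variable {P : Measure Ω} {ℱ : Filtration ℕ mΩ} {X : ℕ → Ω → Fin q → ℝ}
  {n M : ℕ} {D : Set (Fin q → ℝ)} {f : Fin q → (Fin q → ℝ) → ℝ}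
  {g : Fin q → Fin q → (Fin q → ℝ) → ℝ} {β l₁ l₂ : ℝ}

theorem measurableSet_initial (h : HasDriftAndDiffusion P ℱ X n M D f g β l₁ l₂) (v : Fin q → ℝ) :
    MeasurableSet[ℱ 0] {ω | X 0 ω = v} :=
  h.meas 0 (Nat.zero_le _) (measurableSet_singleton v)

/-- The centring is deterministic, the stopping indicator is known at time `j`, and the conditioning
event lies in every `ℱ j`. Hence the conditional moments of the stopped steps are explicit in those
of `X` under `P`. -/
theorem isAdaptedWalk [IsProbabilityMeasure P]
    (h : HasDriftAndDiffusion P ℱ X n M D f g β l₁ l₂) (hn : 0 < n) (hD : IsOpen D)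
    {N : ℕ} (hN : N ≤ M) {y : ℕ → Fin q → ℝ}
    (hA : P {ω | X 0 ω = (n : ℝ) • y 0} ≠ 0) {V : ℝ} (hβ : 0 ≤ β) (hV0 : 0 ≤ V)
    (hV : ∀ j < N, ∀ k, |(n : ℝ) * (y (j + 1) k - y j k)| ≤ V) :
    IsAdaptedWalk ℱ (ProbabilityTheory.cond P {ω | X 0 ω = (n : ℝ) • y 0})
      (stoppedWalk n X D y) (stoppedDrift P ℱ n X D y) (stoppedSecond P ℱ n X D y)
      ((√n)⁻¹ * (β + V)) N := by
  have hn' : (0 : ℝ) < n := by exact_mod_cast hn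
  have hA0 := h.measurableSet_initial ((n : ℝ) • y 0)
  have hAm : ∀ j, MeasurableSet[ℱ j] {ω | X 0 ω = (n : ℝ) • y 0} := fun j =>
    ℱ.mono (Nat.zero_le j) _ hA0
  have hID : ∀ j ≤ N, MeasurableSet[ℱ j] (inDomain n X D j) := fun j hj =>
    measurableSet_inDomain hD fun i hi => h.meas i (hi.trans (hj.trans hN))
  have hind : ∀ j ≤ N, ∀ a : ℝ, Measurable[ℱ j] ((inDomain n X D j).indicator fun _ => a) :=
    fun j hj a => measurable_const.indicator (hID j hj)
  have hindb : ∀ j, ∀ a : ℝ, ∀ ω, ‖(inDomain n X D j).indicator (fun _ => a) ω‖ ≤ ‖a‖ :=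
    fun j a ω => norm_indicator_le_norm_self _ _
  have hprob : IsProbabilityMeasure (ProbabilityTheory.cond P {ω | X 0 ω = (n : ℝ) • y 0}) :=
    cond_isProbabilityMeasure hA
  have hΔ : ∀ j < N, ∀ k, IsWeakCondExp (ℱ j)
      (ProbabilityTheory.cond P {ω | X 0 ω = (n : ℝ) • y 0})
      (fun ω => X (j + 1) ω k - X j ω k) (P[fun ω' => X (j + 1) ω' k - X j ω' k | ℱ j]) :=
    fun j hj k => (IsWeakCondExp.condExp (ℱ.le j)
      ((h.memLp j (hj.trans_le hN) k).integrable one_le_two)).cond (ℱ.le j) (hAm j) hA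
  have hΔΔ : ∀ j < N, ∀ i k, IsWeakCondExp (ℱ j)
      (ProbabilityTheory.cond P {ω | X 0 ω = (n : ℝ) • y 0})
      (fun ω => (X (j + 1) ω i - X j ω i) * (X (j + 1) ω k - X j ω k))
      (P[fun ω' => (X (j + 1) ω' i - X j ω' i) * (X (j + 1) ω' k - X j ω' k) | ℱ j]) :=
    fun j hj i k => (IsWeakCondExp.condExp (ℱ.le j)
      ((h.memLp j (hj.trans_le hN) i).integrable_mul (h.memLp j (hj.trans_le hN) k))).cond
        (ℱ.le j) (hAm j) hA
  refine ⟨fun j hj => ?_, ?_, fun j hj => ?_, fun j hj k => ?_, fun j hj i k => ?_⟩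
  · have hXm : ∀ i ≤ j, Measurable[ℱ j] (X i) := fun i hi =>
      (h.meas i (hi.trans (hj.trans hN))).mono (ℱ.mono hi) le_rfl
    refine (@measurable_pi_iff _ _ _ (ℱ j) _ _).2 fun k => ?_
    have hXk : ∀ i ≤ j, Measurable[ℱ j] (fun ω => X i ω k) := fun i hi =>
      (measurable_pi_apply k).comp (hXm i hi)
    refine (((hXk 0 (Nat.zero_le _)).sub_const _).const_mul _).add
      (@Finset.measurable_fun_sum _ _ _ _ _ _ (ℱ j) _ _ fun i hi => ?_)
    have hij : i < j := Finset.mem_range.1 hi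
    exact ((hind i (hij.le.trans hj) _).mono (ℱ.mono hij.le) le_rfl).mul
      (((hXk (i + 1) hij).sub (hXk i hij.le)).add_const _)
  · have h1 : ∀ᵐ ω ∂(ProbabilityTheory.cond P {ω | X 0 ω = (n : ℝ) • y 0}),
        X 0 ω = (n : ℝ) • y 0 :=
      ae_cond_mem (ℱ.le 0 _ hA0)
    filter_upwards [h1] with ω hω
    ext k
    simp [stoppedWalk, hω]
  · filter_upwards [ae_cond_of_ae (h.step j (hj.trans_le hN))] with ω hω
    have hs : 0 ≤ (√(n : ℝ))⁻¹ := by positivity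
    refine (pi_norm_le_iff_of_nonneg (by positivity)).2 fun k => ?_
    rw [Pi.sub_apply, stoppedWalk_succ_sub]
    by_cases hωD : ω ∈ inDomain n X D j
    · rw [Set.indicator_of_mem hωD, norm_mul, Real.norm_of_nonneg hs]
      refine mul_le_mul_of_nonneg_left ((norm_add_le _ _).trans (add_le_add ?_ ?_)) hs
      · exact (norm_le_pi_norm (X (j + 1) ω - X j ω) k).trans (hω hωD)
      · rw [norm_neg]; exact hV j hj k
    · rw [Set.indicator_of_notMem hωD, zero_mul, norm_zero]
      positivity
  · simp only [stoppedWalk_succ_sub]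
    exact ((hΔ j hj k).add (ℱ.le j) (IsWeakCondExp.of_measurable (integrable_const _))).mul_left
      (ℱ.le j) (hind j hj.le _) (hindb j _)
  · have h1 := ((((hΔΔ j hj i k).add (ℱ.le j) ((hΔ j hj i).const_mul
      (-(n * (y (j + 1) k - y j k))))).add (ℱ.le j) ((hΔ j hj k).const_mul
      (-(n * (y (j + 1) i - y j i))))).add (ℱ.le j) (IsWeakCondExp.of_measurable
      (integrable_const (n * (y (j + 1) i - y j i) * (n * (y (j + 1) k - y j k)))))).mul_left
      (ℱ.le j) (hind j hj.le (n : ℝ)⁻¹) (hindb j _)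
    convert h1 using 2 with ω ω
    swap
    · rfl
    rw [stoppedWalk_succ_sub, stoppedWalk_succ_sub]
    by_cases hωD : ω ∈ inDomain n X D j
    · simp only [Set.indicator_of_mem hωD]
      have h2 : (n : ℝ)⁻¹ = (√n)⁻¹ * (√n)⁻¹ := by
        rw [← mul_inv, Real.mul_self_sqrt hn'.le]
      rw [h2]
      ring
    · simp only [Set.indicator_of_notMem hωD]
      ring

end HasDriftAndDiffusion

end StoppedWalk

/-! ### Comparison of drift and second moments with their linearized limits -/

namespace HasDriftAndDiffusion

variable {Ω : Type*} {mΩ : MeasurableSpace Ω} {q : ℕ}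
  {P : Measure Ω} {ℱ : Filtration ℕ mΩ} {X : ℕ → Ω → Fin q → ℝ}
  {n M : ℕ} {D : Set (Fin q → ℝ)} {f : Fin q → (Fin q → ℝ) → ℝ}
  {g : Fin q → Fin q → (Fin q → ℝ) → ℝ} {β l₁ l₂ : ℝ} {y : ℕ → Fin q → ℝ} {j : ℕ} {L : ℝ≥0}

theorem abs_sub_le_of_lipschitz (hL : LipschitzOnWith L (driftField f) D) {v w : Fin q → ℝ}
    (hv : v ∈ D) (hw : w ∈ D) (k : Fin q) : |f k v - f k w| ≤ L * ‖v - w‖ := by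
  have h1 := hL.dist_le_mul v hv w hw
  rw [dist_eq_norm, dist_eq_norm] at h1
  exact (norm_le_pi_norm (driftField f v - driftField f w) k).trans h1

theorem norm_inv_smul_sub (hn : 0 < n) {ω : Ω} (hω : ω ∈ inDomain n X D j) :
    ‖(n : ℝ)⁻¹ • X j ω - y j‖ = ‖stoppedWalk n X D y j ω‖ / √n := by
  have hs : 0 < √(n : ℝ) := Real.sqrt_pos.2 (by exact_mod_cast hn)
  rw [inv_smul_sub_eq hn (fun i hi => inDomain_anti hi.le hω), norm_smul,
    Real.norm_of_nonneg hs.le]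
  field_simp

/-- A rough estimate that feeds the moment bounds: inside `D` the Lipschitz property of `f` costs `L
‖W‖ / √n`, and after the exit the drift vanishes. `κ` is the Euler error of the fluid path. -/
theorem abs_stoppedDrift_le (h : HasDriftAndDiffusion P ℱ X n M D f g β l₁ l₂) (hn : 0 < n)
    (hj : j < M) (hL : LipschitzOnWith L (driftField f) D) (hy : y j ∈ D) {κ : ℝ}
    (hκ : ∀ k, |n * (y (j + 1) k - y j k) - f k (y j)| ≤ κ) (hl₁ : 0 ≤ l₁) {r : ℝ}
    (hr : √n * (l₁ + κ) ≤ r) :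
    ∀ᵐ ω ∂P, ∀ k, |stoppedDrift P ℱ n X D y j ω k| ≤
      (L * ‖stoppedWalk n X D y j ω‖ + r) / n := by
  have hn' : (0 : ℝ) < n := by exact_mod_cast hn
  have hs : 0 < √(n : ℝ) := Real.sqrt_pos.2 hn'
  filter_upwards [ae_all_iff.2 (h.drift j hj)] with ω hω k
  have hκ0 : 0 ≤ κ := (abs_nonneg _).trans (hκ k)
  have hr0 : 0 ≤ r := (by positivity : 0 ≤ √(n : ℝ) * (l₁ + κ)).trans hr
  by_cases hωD : ω ∈ inDomain n X D j
  · have h1 := hω k hωD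
    have h2 := hκ k
    have h3 := abs_sub_le_of_lipschitz hL (hωD j le_rfl) hy k
    rw [norm_inv_smul_sub hn hωD] at h3
    rw [stoppedDrift, Set.indicator_of_mem hωD, abs_mul, abs_of_nonneg (inv_nonneg.2 hs.le)]
    set E := (P[fun ω' => X (j + 1) ω' k - X j ω' k | ℱ j]) ω
    have h4 : |E + -(n * (y (j + 1) k - y j k))| ≤
        l₁ + κ + L * (‖stoppedWalk n X D y j ω‖ / √n) := by
      rw [abs_le] at *
      constructor <;> linarith
    have h5 : (L * ‖stoppedWalk n X D y j ω‖ + √n * (l₁ + κ)) / n =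
        (√n)⁻¹ * (l₁ + κ + L * (‖stoppedWalk n X D y j ω‖ / √n)) := by
      have : ∀ t : ℝ, 0 < t → t * t = n → (L * ‖stoppedWalk n X D y j ω‖ + t * (l₁ + κ)) / n =
          t⁻¹ * (l₁ + κ + L * (‖stoppedWalk n X D y j ω‖ / t)) := by
        intro t ht htn
        rw [← htn]
        field_simp
        ring
      exact this _ hs (Real.mul_self_sqrt hn'.le)
    calc (√(n : ℝ))⁻¹ * |E + -(n * (y (j + 1) k - y j k))|
        ≤ (√n)⁻¹ * (l₁ + κ + L * (‖stoppedWalk n X D y j ω‖ / √n)) := by gcongr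
      _ = _ := h5.symm
      _ ≤ _ := by gcongr
  · rw [stoppedDrift, Set.indicator_of_notMem hωD, zero_mul, abs_zero]
    positivity

theorem stoppedSecond_self_le (h : HasDriftAndDiffusion P ℱ X n M D f g β l₁ l₂) (hn : 0 < n)
    (hj : j < M) {K : ℝ} (hf : ∀ v ∈ D, ∀ k, |f k v| ≤ K) (hg : ∀ v ∈ D, ∀ i k, |g i k v| ≤ K)
    (hy : y j ∈ D) {κ : ℝ} (hκ : ∀ k, |n * (y (j + 1) k - y j k) - f k (y j)| ≤ κ)
    (hl₁ : l₁ ≤ 1) (hl₂ : l₂ ≤ 1) (hκ1 : κ ≤ 1) :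
    ∀ᵐ ω ∂P, ∀ k, stoppedSecond P ℱ n X D y j ω k k ≤ 4 * (K + 1) ^ 2 / n := by
  have hn' : (0 : ℝ) < n := by exact_mod_cast hn
  filter_upwards [ae_all_iff.2 (h.drift j hj),
    ae_all_iff.2 fun i => ae_all_iff.2 (h.second j hj i)] with ω hω hω2 k
  have hK0 : 0 ≤ K := (abs_nonneg _).trans (hf _ hy k)
  by_cases hωD : ω ∈ inDomain n X D j
  · have h1 := hω k hωD
    have h2 := hκ k
    have h3 := hω2 k k hωD
    have h4 := hf _ (hωD j le_rfl) k
    have h5 := hf _ hy k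
    have h6 := hg _ (hωD j le_rfl) k k
    rw [stoppedSecond, Set.indicator_of_mem hωD]
    set E := (P[fun ω' => X (j + 1) ω' k - X j ω' k | ℱ j]) ω
    set E2 := (P[fun ω' => (X (j + 1) ω' k - X j ω' k) * (X (j + 1) ω' k - X j ω' k) | ℱ j]) ω
    set v := n * (y (j + 1) k - y j k)
    have hE : |E| ≤ K + 1 := by rw [abs_le] at *; constructor <;> linarith
    have hv : |v| ≤ K + 1 := by rw [abs_le] at *; constructor <;> linarith
    have hE2 : E2 ≤ K + 1 := by rw [abs_le] at *; linarith
    -- The bracket `E2 - 2 v E + v²` is at most `(K + 1) + 3 (K + 1)²`, and `K + 1 ≥ 1`.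
    have hvE : |v * E| ≤ (K + 1) * (K + 1) := by
      rw [abs_mul]; gcongr
    have hvv : |v * v| ≤ (K + 1) * (K + 1) := by
      rw [abs_mul]; gcongr
    rw [div_eq_inv_mul]
    refine mul_le_mul_of_nonneg_left ?_ (inv_nonneg.2 hn'.le)
    rw [abs_le] at hvE hvv
    nlinarith
  · rw [stoppedSecond, Set.indicator_of_notMem hωD, zero_mul]
    positivity

/-- Applied after the exit with `ρ = √n r`: a linear term in `‖W‖` becomes a small multiple of
`‖W‖²`. -/
theorem le_sq_div_of_le {w ρ : ℝ} (hρ : 0 < ρ) (hw : ρ ≤ w) : w ≤ w ^ 2 / ρ := by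
  have := hρ.le.trans hw
  rw [le_div_iff₀ hρ, sq]
  gcongr

/-- The drift of the stopped process is close to the linearized drift. -/
theorem abs_stoppedDrift_sub_le (h : HasDriftAndDiffusion P ℱ X n M D f g β l₁ l₂) (hn : 0 < n)
    (hj : j < M) (hD : IsOpen D) (hy : ∀ i ≤ j, y i ∈ D) {κ : ℝ}
    (hκ : ∀ k, |n * (y (j + 1) k - y j k) - f k (y j)| ≤ κ)
    {r : ℝ} (hr0 : 0 < r) (hr : ∀ i ≤ j, r ≤ Metric.infDist (y i) (frontier D))
    {J : Matrix (Fin q) (Fin q) ℝ} {L' : ℝ} (hJ : ∀ i k, |J i k| ≤ L') {η K e : ℝ} (hK : 0 ≤ K)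
    (hη : 0 ≤ η)
    (hlin : ∀ v ∈ D, ∀ i, |f i v - f i (y j) - J.mulVec (v - y j) i| ≤
      η * ‖v - y j‖ + K * ‖v - y j‖ ^ 2)
    (he1 : √n * (l₁ + κ) + η + K / √n ≤ e) (he2 : q * L' / (√n * r) ≤ e) :
    ∀ᵐ ω ∂P, ∀ k, |n * stoppedDrift P ℱ n X D y j ω k -
      J.mulVec (stoppedWalk n X D y j ω) k| ≤
      e * (1 + stoppedWalk n X D y j ω ⬝ᵥ stoppedWalk n X D y j ω) := by
  have hn' : (0 : ℝ) < n := by exact_mod_cast hn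
  have hs : 0 < √(n : ℝ) := Real.sqrt_pos.2 hn'
  filter_upwards [ae_all_iff.2 (h.drift j hj)] with ω hω k
  have hL0 : 0 ≤ L' := (abs_nonneg _).trans (hJ k k)
  have he0 : 0 ≤ e := (by positivity : 0 ≤ q * L' / (√n * r)).trans he2
  set w := stoppedWalk n X D y j ω with hw
  have hsq := norm_sq_le_dotProduct_self w
  suffices H : |n * stoppedDrift P ℱ n X D y j ω k - J.mulVec w k| ≤ e * (1 + ‖w‖ ^ 2) from
    H.trans (by gcongr)
  by_cases hωD : ω ∈ inDomain n X D j
  · have h1 := hω k hωD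
    have h2 := hκ k
    have h3 := hlin _ (hωD j le_rfl) k
    rw [norm_inv_smul_sub hn hωD, ← hw] at h3
    have h4 : w = √n • ((n : ℝ)⁻¹ • X j ω - y j) :=
      inv_smul_sub_eq hn fun i hi => inDomain_anti hi.le hωD
    have h5 : J.mulVec w k = √n * J.mulVec ((n : ℝ)⁻¹ • X j ω - y j) k := by
      rw [h4, Matrix.mulVec_smul]; rfl
    set d := J.mulVec ((n : ℝ)⁻¹ • X j ω - y j) k
    rw [stoppedDrift, Set.indicator_of_mem hωD, h5]
    set E := (P[fun ω' => X (j + 1) ω' k - X j ω' k | ℱ j]) ω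
    set V := (n : ℝ) * (y (j + 1) k - y j k)
    have h6 : (n : ℝ) * ((√n)⁻¹ * (E + -V)) - √n * d = √n * ((E + -V) - d) := by
      have : (n : ℝ) * (√n)⁻¹ = √n := by
        rw [← div_eq_mul_inv, Real.div_sqrt]
      rw [← mul_assoc, this]; ring
    -- Errors of the conditional drift, of the fluid step and of the linearization. Multiplied by
    -- `√n`, the quadratic one still carries a factor `1 / √n`.
    have h7 : |E + -V - d| ≤ l₁ + κ + (η * (‖w‖ / √n) + K * (‖w‖ / √n) ^ 2) := by
      rw [abs_le] at *
      constructor <;> linarith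
    rw [h6, abs_mul, abs_of_pos hs]
    have h8 : √n * (l₁ + κ + (η * (‖w‖ / √n) + K * (‖w‖ / √n) ^ 2)) =
        √n * (l₁ + κ) + η * ‖w‖ + K / √n * ‖w‖ ^ 2 := by
      field_simp
      ring
    have h9 : ‖w‖ ≤ 1 + ‖w‖ ^ 2 := by nlinarith [sq_nonneg (‖w‖ - 1)]
    have h10 : η * ‖w‖ ≤ η * (1 + ‖w‖ ^ 2) := by gcongr
    have h11 : 0 ≤ K / √n := by positivity
    have h12 : 0 ≤ √n * (l₁ + κ) := by
      have := (abs_nonneg _).trans h1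
      have := (abs_nonneg _).trans h2
      positivity
    calc √n * |E + -V - d| ≤ √n * (l₁ + κ + (η * (‖w‖ / √n) + K * (‖w‖ / √n) ^ 2)) := by gcongr
      _ ≤ (√n * (l₁ + κ) + η + K / √n) * (1 + ‖w‖ ^ 2) := by
          rw [h8]; nlinarith [sq_nonneg ‖w‖]
      _ ≤ _ := by gcongr
  · rw [stoppedDrift, Set.indicator_of_notMem hωD, zero_mul, mul_zero, zero_sub, abs_neg]
    -- After the exit the true drift is `0` and all of `J w` counts as error; the lower bound `√n r
    -- ≤ ‖w‖` makes it small relative to `‖w‖²`.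
    have h1 : |J.mulVec w k| ≤ q * L' * ‖w‖ := abs_dotProduct_le (hJ k) w
    have h2 : ‖w‖ ≤ ‖w‖ ^ 2 / (√n * r) :=
      le_sq_div_of_le (by positivity) (le_norm_stoppedWalk hn hD hωD hy hr)
    calc _ ≤ q * L' * (‖w‖ ^ 2 / (√n * r)) := h1.trans (by gcongr)
      _ = q * L' / (√n * r) * ‖w‖ ^ 2 := by ring
      _ ≤ e * (1 + ‖w‖ ^ 2) := by gcongr; linarith

/-- With exact values the centred second moment is `γ - fₖ fᵢ - fᵢ fₖ + fᵢ fₖ = γ - fᵢ fₖ`, the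
source of `- F Fᵀ` in the limit. -/
theorem abs_second_moment_sub_le {E₂ Eᵢ Eₖ Vᵢ Vₖ fᵢ fₖ γ p s t K : ℝ} (hγ : |E₂ - γ| ≤ t)
    (hpi : |Vᵢ - fᵢ| ≤ p) (hpk : |Vₖ - fₖ| ≤ p) (hsi : |Eᵢ - fᵢ| ≤ s) (hsk : |Eₖ - fₖ| ≤ s)
    (hfi : |fᵢ| ≤ K) (hfk : |fₖ| ≤ K) (hp : p ≤ 1) :
    |E₂ + -Vₖ * Eᵢ + -Vᵢ * Eₖ + Vᵢ * Vₖ - (γ - fᵢ * fₖ)| ≤ t + (2 * K + 2) * s + p := by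
  have hid : E₂ + -Vₖ * Eᵢ + -Vᵢ * Eₖ + Vᵢ * Vₖ - (γ - fᵢ * fₖ) =
      (E₂ - γ) - fₖ * (Eᵢ - fᵢ) - (Vₖ - fₖ) * (Eᵢ - fᵢ) -
      fᵢ * (Eₖ - fₖ) - (Vᵢ - fᵢ) * (Eₖ - fₖ) + (Vᵢ - fᵢ) * (Vₖ - fₖ) := by ring
  have hK0 : 0 ≤ K := (abs_nonneg _).trans hfi
  have mul_le : ∀ {a b c d : ℝ}, |a| ≤ c → |b| ≤ d → |a * b| ≤ c * d := fun {a b c d} h₁ h₂ => by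
    rw [abs_mul]
    exact mul_le_mul h₁ h₂ (abs_nonneg _) ((abs_nonneg _).trans h₁)
  have a1 := abs_le.1 (mul_le hfk hsi)
  have a2 := abs_le.1 (mul_le (hpk.trans hp) hsi)
  have a3 := abs_le.1 (mul_le hfi hsk)
  have a4 := abs_le.1 (mul_le (hpi.trans hp) hsk)
  have a5 := abs_le.1 (mul_le (hpi.trans hp) hpk)
  rw [abs_le] at hγ
  rw [hid, abs_le]
  constructor <;> linarith

/-- The conditional second moments of the stopped process are close to `G - F Fᵀ` at a point `z`
near `y j`. -/
theorem abs_stoppedSecond_sub_le (h : HasDriftAndDiffusion P ℱ X n M D f g β l₁ l₂) (hn : 0 < n)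
    (hj : j < M) (hD : IsOpen D) (hL : LipschitzOnWith L (driftField f) D) {Lg : ℝ}
    (hLg : ∀ v ∈ D, ∀ w ∈ D, ∀ i k, |g i k v - g i k w| ≤ Lg * ‖v - w‖) (hLg0 : 0 ≤ Lg)
    (hy : ∀ i ≤ j, y i ∈ D) {κ : ℝ}
    (hκ : ∀ k, |n * (y (j + 1) k - y j k) - f k (y j)| ≤ κ)
    {r : ℝ} (hr0 : 0 < r) (hr : ∀ i ≤ j, r ≤ Metric.infDist (y i) (frontier D))
    {K : ℝ} (hf : ∀ v ∈ D, ∀ k, |f k v| ≤ K) (hg : ∀ v ∈ D, ∀ i k, |g i k v| ≤ K)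
    {z : Fin q → ℝ} (hz : z ∈ D) {ζ e : ℝ} (hζ : ‖y j - z‖ ≤ ζ) (hp : κ + L * ζ ≤ 1)
    (he1 : l₂ + Lg * ζ + (2 * K + 2) * (l₁ + L * ζ) + (κ + L * ζ) +
      (Lg + (2 * K + 2) * L) / √n ≤ e)
    (he2 : (K + K ^ 2) / (√n * r) ^ 2 ≤ e) :
    ∀ᵐ ω ∂P, ∀ i k, |n * stoppedSecond P ℱ n X D y j ω i k - (g i k z - f i z * f k z)| ≤
      e * (1 + stoppedWalk n X D y j ω ⬝ᵥ stoppedWalk n X D y j ω) := by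
  have hn' : (0 : ℝ) < n := by exact_mod_cast hn
  have hs : 0 < √(n : ℝ) := Real.sqrt_pos.2 hn'
  filter_upwards [ae_all_iff.2 (h.drift j hj),
    ae_all_iff.2 fun i => ae_all_iff.2 (h.second j hj i)] with ω hω hω2 i k
  have hK0 : 0 ≤ K := (abs_nonneg _).trans (hf _ hz k)
  have he0 : 0 ≤ e := (by positivity : 0 ≤ (K + K ^ 2) / (√n * r) ^ 2).trans he2
  set w := stoppedWalk n X D y j ω with hw
  have hsq := norm_sq_le_dotProduct_self w
  suffices H : |n * stoppedSecond P ℱ n X D y j ω i k - (g i k z - f i z * f k z)| ≤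
      e * (1 + ‖w‖ ^ 2) from H.trans (by gcongr)
  by_cases hωD : ω ∈ inDomain n X D j
  · set v := (n : ℝ)⁻¹ • X j ω with hv
    have hvD : v ∈ D := hωD j le_rfl
    have hvz : ‖v - z‖ ≤ ‖w‖ / √n + ζ := by
      rw [hw, ← norm_inv_smul_sub hn hωD]
      exact (norm_sub_le_norm_sub_add_norm_sub _ (y j) _).trans (by gcongr)
    have hζ0 : 0 ≤ ζ := (norm_nonneg _).trans hζ
    rw [stoppedSecond, Set.indicator_of_mem hωD, ← mul_assoc, mul_inv_cancel₀ hn'.ne', one_mul]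
    have hE2 := hω2 i k hωD
    have hEi := hω i hωD
    have hEk := hω k hωD
    set E2 := (P[fun ω' => (X (j + 1) ω' i - X j ω' i) * (X (j + 1) ω' k - X j ω' k) | ℱ j]) ω
    set Ei := (P[fun ω' => X (j + 1) ω' i - X j ω' i | ℱ j]) ω
    set Ek := (P[fun ω' => X (j + 1) ω' k - X j ω' k | ℱ j]) ω
    have hVi := hκ i
    have hVk := hκ k
    set Vi := (n : ℝ) * (y (j + 1) i - y j i)
    set Vk := (n : ℝ) * (y (j + 1) k - y j k)
    -- `p` and `s` bound the deviations of the deterministic step and of the conditional mean from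
    -- `f z`. Comparing at `z` and not at `y j` makes the limit coefficient the same along the whole
    -- sequence.
    set p := κ + L * ζ with hp'
    set s := l₁ + L * (‖w‖ / √n + ζ) with hs'
    have hp_of : ∀ l V, |V - f l (y j)| ≤ κ → |V - f l z| ≤ p := by
      intro l V hV
      have h1 := (abs_sub_le_of_lipschitz hL (hy j le_rfl) hz l).trans
        (mul_le_mul_of_nonneg_left hζ L.2)
      rw [abs_le] at *
      constructor <;> linarith
    have hs_of : ∀ l E, |E - f l v| ≤ l₁ → |E - f l z| ≤ s := by
      intro l E hE
      have h1 := (abs_sub_le_of_lipschitz hL hvD hz l).trans (mul_le_mul_of_nonneg_left hvz L.2)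
      rw [abs_le] at *
      constructor <;> linarith
    have hpi := hp_of i Vi hVi
    have hpk := hp_of k Vk hVk
    have hsi := hs_of i Ei hEi
    have hsk := hs_of k Ek hEk
    have hp0 : 0 ≤ p := (abs_nonneg _).trans hpi
    have hs0 : 0 ≤ s := (abs_nonneg _).trans hsi
    have hfi := hf z hz i
    have hfk := hf z hz k
    have hgz : |E2 - g i k z| ≤ l₂ + Lg * (‖w‖ / √n + ζ) := by
      have h1 := (hLg v hvD z hz i k).trans (mul_le_mul_of_nonneg_left hvz hLg0)
      rw [abs_le] at *
      constructor <;> linarith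
    refine (abs_second_moment_sub_le hgz hpi hpk hsi hsk hfi hfk hp).trans ?_
    have h9 : ‖w‖ ≤ 1 + ‖w‖ ^ 2 := by nlinarith [sq_nonneg (‖w‖ - 1)]
    have b1 : (l₂ + Lg * (‖w‖ / √n + ζ)) + (2 * K + 2) * s + p =
        (l₂ + Lg * ζ + (2 * K + 2) * (l₁ + L * ζ) + (κ + L * ζ)) +
        (Lg + (2 * K + 2) * L) / √n * ‖w‖ := by
      rw [hs', hp']; field_simp; ring
    set c₁ := l₂ + Lg * ζ + (2 * K + 2) * (l₁ + L * ζ) + (κ + L * ζ) with hc₁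
    set c₂ := (Lg + (2 * K + 2) * L) / √n with hc₂
    have hc₂0 : 0 ≤ c₂ := by positivity
    have hc₁0 : 0 ≤ c₁ := by
      have h1 := (abs_nonneg _).trans hE2
      have h2 := (abs_nonneg _).trans hEi
      have h3 := (abs_nonneg _).trans hVi
      positivity
    have b2 : c₁ + c₂ * ‖w‖ ≤ (c₁ + c₂) * (1 + ‖w‖ ^ 2) := by
      have := mul_le_mul_of_nonneg_left h9 hc₂0
      nlinarith [mul_nonneg hc₁0 (sq_nonneg ‖w‖)]
    have b3 : (c₁ + c₂) * (1 + ‖w‖ ^ 2) ≤ e * (1 + ‖w‖ ^ 2) := by gcongr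
    linarith
  · rw [stoppedSecond, Set.indicator_of_notMem hωD, zero_mul, mul_zero, zero_sub, abs_neg]
    have hρ : √n * r ≤ ‖w‖ := le_norm_stoppedWalk hn hD hωD hy hr
    have hρ0 : 0 < √n * r := by positivity
    have h1 : |g i k z - f i z * f k z| ≤ K + K ^ 2 := by
      refine (abs_sub _ _).trans (add_le_add (hg z hz i k) ?_)
      rw [abs_mul, sq]
      have := hf z hz i
      have := hf z hz k
      gcongr
    -- After the exit the second moment is `0`, and the bounded entry of `G - F Fᵀ` is paid for by
    -- `‖w‖²`.
    have h2 : 1 ≤ ‖w‖ ^ 2 / (√n * r) ^ 2 := by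
      rw [one_le_div (by positivity)]; gcongr
    have h3 : 0 ≤ K + K ^ 2 := by positivity
    calc _ ≤ (K + K ^ 2) * 1 := by linarith
      _ ≤ (K + K ^ 2) * (‖w‖ ^ 2 / (√n * r) ^ 2) := by gcongr
      _ = (K + K ^ 2) / (√n * r) ^ 2 * ‖w‖ ^ 2 := by ring
      _ ≤ e * (1 + ‖w‖ ^ 2) := by gcongr; linarith

end HasDriftAndDiffusion

/-! ### Compensating row vectors and accumulated variance -/

section RowVectors

variable {q : ℕ}

theorem abs_dotProduct_le_of_abs_le {a v : Fin q → ℝ} {K R : ℝ} (ha : ∀ k, |a k| ≤ K)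
    (hv : ∀ k, |v k| ≤ R) (hR : 0 ≤ R) (hK : 0 ≤ K) : |a ⬝ᵥ v| ≤ q * K * R := by
  refine (abs_dotProduct_le ha v).trans ?_
  have : ‖v‖ ≤ R := (pi_norm_le_iff_of_nonneg hR).2 hv
  gcongr

theorem abs_mul_abs_of_pos {n : ℝ} (hn : 0 < n) (x : ℝ) : |n * x| = n * |x| := by
  rw [abs_mul, abs_of_pos hn]

theorem norm_le_one_add_dotProduct_self (w : Fin q → ℝ) : ‖w‖ ≤ 1 + w ⬝ᵥ w := by
  have := norm_sq_le_dotProduct_self w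
  nlinarith [sq_nonneg (‖w‖ - 1)]

/-- Along row vectors `a` with `a' ≈ a - a J / n` a drift `b ≈ J w / n` is compensated. -/
theorem abs_compensated_drift_le {n : ℝ} (hn : 0 < n) {a a' b w : Fin q → ℝ}
    {J : Matrix (Fin q) (Fin q) ℝ} {L K e η E : ℝ} (hL : ∀ i k, |J i k| ≤ L) (hL0 : 0 ≤ L)
    (hK0 : 0 ≤ K) (he0 : 0 ≤ e) (hη0 : 0 ≤ η) (ha' : ∀ k, |a' k| ≤ K)
    (haa' : ∀ k, |a' k - a k| ≤ K / n) (haJ : ∀ k, |n * (a' k - a k) + Matrix.vecMul a J k| ≤ η)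
    (hb : ∀ k, |n * b k - J.mulVec w k| ≤ e * (1 + w ⬝ᵥ w))
    (hE : q * K * e + q * K * (q * L) / n + q * η ≤ E) :
    |a' ⬝ᵥ b + (a' - a) ⬝ᵥ w| ≤ E / n * (1 + w ⬝ᵥ w) := by
  have hw0 := dotProduct_self_nonneg' w
  have hw := norm_le_one_add_dotProduct_self w
  -- Since `(a J) ⬝ᵥ w = a ⬝ᵥ (J w)`, the main terms cancel. The drift error, the variation of `a`
  -- over one step and the error in the adjoint equation remain.
  have hid : n * (a' ⬝ᵥ b + (a' - a) ⬝ᵥ w) = a' ⬝ᵥ (n • b - J.mulVec w) +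
      (a' - a) ⬝ᵥ J.mulVec w + (n • (a' - a) + Matrix.vecMul a J) ⬝ᵥ w := by
    simp only [dotProduct_sub, sub_dotProduct, add_dotProduct, ← Matrix.dotProduct_mulVec,
      dotProduct_smul, smul_dotProduct, smul_eq_mul]
    ring
  have h1 : |a' ⬝ᵥ (n • b - J.mulVec w)| ≤ q * K * (e * (1 + w ⬝ᵥ w)) :=
    abs_dotProduct_le_of_abs_le ha' hb (by positivity) hK0
  have h2 : |(a' - a) ⬝ᵥ J.mulVec w| ≤ q * (K / n) * (q * L * ‖w‖) :=
    abs_dotProduct_le_of_abs_le haa' (fun k => abs_dotProduct_le (hL k) w) (by positivity)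
      (by positivity)
  have h3 : |(n • (a' - a) + Matrix.vecMul a J) ⬝ᵥ w| ≤ q * η * ‖w‖ := abs_dotProduct_le haJ w
  have h4 : n * |a' ⬝ᵥ b + (a' - a) ⬝ᵥ w| ≤ E * (1 + w ⬝ᵥ w) := by
    rw [← abs_mul_abs_of_pos hn, hid]
    calc _ ≤ q * K * (e * (1 + w ⬝ᵥ w)) + q * (K / n) * (q * L * ‖w‖) + q * η * ‖w‖ :=
        (abs_add_three _ _ _).trans (by linarith)
      _ ≤ q * K * (e * (1 + w ⬝ᵥ w)) + q * (K / n) * (q * L * (1 + w ⬝ᵥ w)) +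
          q * η * (1 + w ⬝ᵥ w) := by gcongr
      _ = (q * K * e + q * K * (q * L) / n + q * η) * (1 + w ⬝ᵥ w) := by ring
      _ ≤ _ := by gcongr
  have h5 : E / n * (1 + w ⬝ᵥ w) = E * (1 + w ⬝ᵥ w) / n := by ring
  rwa [h5, le_div_iff₀ hn, mul_comm]

theorem abs_quadratic_sum_le {u : Fin q → Fin q → ℝ} {K : ℝ} (hu : ∀ i k, |u i k| ≤ K) :
    |∑ i, ∑ k, u i k| ≤ q * (q * K) := by
  have h : ∀ i, |∑ k, u i k| ≤ q * K := fun i =>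
    (Finset.abs_sum_le_sum_abs _ _).trans
      ((Finset.sum_le_card_nsmul _ _ _ fun k _ => hu i k).trans (by simp))
  exact (Finset.abs_sum_le_sum_abs _ _).trans
    ((Finset.sum_le_card_nsmul _ _ _ fun i _ => h i).trans (by simp))

/-- The variance `ψ' - ψ` accumulated in one step is close to the quadratic form of the second
moments. -/
theorem abs_variance_step_le {n : ℝ} (hn : 0 < n) {a a' w : Fin q → ℝ}
    {c M : Fin q → Fin q → ℝ} {K Km e η E x x' : ℝ} (hK0 : 0 ≤ K)
    (hη0 : 0 ≤ η) (hM : ∀ i k, |M i k| ≤ Km) (hKm : 0 ≤ Km) (ha : ∀ k, |a k| ≤ K)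
    (ha' : ∀ k, |a' k| ≤ K) (haa' : ∀ k, |a' k - a k| ≤ K / n)
    (hx : |n * (x' - x) - ∑ i, ∑ k, a i * a k * M i k| ≤ η)
    (hc : ∀ i k, |n * c i k - M i k| ≤ e * (1 + w ⬝ᵥ w))
    (hE : q * (q * (K * K * e)) + q * (q * (2 * K * K * Km)) / n + η ≤ E) :
    |x' - x - ∑ i, ∑ k, a' i * a' k * c i k| ≤ E / n * (1 + w ⬝ᵥ w) := by
  have hw0 := dotProduct_self_nonneg' w
  have hid : n * (x' - x - ∑ i, ∑ k, a' i * a' k * c i k) =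
      (n * (x' - x) - ∑ i, ∑ k, a i * a k * M i k) -
      ∑ i, ∑ k, (a' i * a' k - a i * a k) * M i k -
      ∑ i, ∑ k, a' i * a' k * (n * c i k - M i k) := by
    simp only [mul_sub, sub_mul, Finset.sum_sub_distrib, Finset.mul_sum]
    have : ∀ i k, n * (a' i * a' k * c i k) = a' i * a' k * (n * c i k) := fun i k => by ring
    simp only [this]
    ring
  have mul_le : ∀ {a b c d : ℝ}, |a| ≤ c → |b| ≤ d → |a * b| ≤ c * d := fun {a b c d} h₁ h₂ => by
    rw [abs_mul]
    exact mul_le_mul h₁ h₂ (abs_nonneg _) ((abs_nonneg _).trans h₁)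
  have h1 : |∑ i, ∑ k, (a' i * a' k - a i * a k) * M i k| ≤ q * (q * (2 * K * (K / n) * Km)) := by
    refine abs_quadratic_sum_le fun i k => mul_le ?_ (hM i k)
    have e1 : a' i * a' k - a i * a k = a' i * (a' k - a k) + (a' i - a i) * a k := by ring
    have e2 := mul_le (ha' i) (haa' k)
    have e3 := mul_le (haa' i) (ha k)
    rw [e1]
    refine (abs_add_le _ _).trans ?_
    linarith
  have h2 : |∑ i, ∑ k, a' i * a' k * (n * c i k - M i k)| ≤
      q * (q * (K * K * (e * (1 + w ⬝ᵥ w)))) :=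
    abs_quadratic_sum_le fun i k => mul_le (mul_le (ha' i) (ha' k)) (hc i k)
  have h4 : n * |x' - x - ∑ i, ∑ k, a' i * a' k * c i k| ≤ E * (1 + w ⬝ᵥ w) := by
    rw [← abs_mul_abs_of_pos hn, hid]
    have h6 := abs_sub (n * (x' - x) - ∑ i, ∑ k, a i * a k * M i k -
      ∑ i, ∑ k, (a' i * a' k - a i * a k) * M i k)
      (∑ i, ∑ k, a' i * a' k * (n * c i k - M i k))
    have h7 := abs_sub (n * (x' - x) - ∑ i, ∑ k, a i * a k * M i k)
      (∑ i, ∑ k, (a' i * a' k - a i * a k) * M i k)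
    have h8 : q * (q * (2 * K * (K / n) * Km)) = q * (q * (2 * K * K * Km)) / n := by ring
    have h9 : 0 ≤ q * (q * (2 * K * K * Km)) / n := by positivity
    calc _ ≤ η + q * (q * (2 * K * K * Km)) / n + q * (q * (K * K * (e * (1 + w ⬝ᵥ w)))) := by
          linarith
      _ ≤ (q * (q * (K * K * e)) + q * (q * (2 * K * K * Km)) / n + η) * (1 + w ⬝ᵥ w) := by
          nlinarith
      _ ≤ _ := by gcongr
  have h5 : E / n * (1 + w ⬝ᵥ w) = E * (1 + w ⬝ᵥ w) / n := by ring
  rwa [h5, le_div_iff₀ hn, mul_comm]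

end RowVectors

/-! ### Comparison of characteristic functions -/

section ExpDifference

variable {Ω : Type*} {mΩ : MeasurableSpace Ω} {q : ℕ}

theorem norm_exp_I_mul_sub_exp_I_mul_le (x y : ℝ) :
    ‖Complex.exp (Complex.I * x) - Complex.exp (Complex.I * y)‖ ≤ |x - y| := by
  have h : Complex.exp (Complex.I * x) - Complex.exp (Complex.I * y) =
      Complex.exp (Complex.I * y) * (Complex.exp (Complex.I * ((x - y : ℝ) : ℂ)) - 1) := by
    rw [mul_sub, ← Complex.exp_add, mul_one]
    congr 2
    push_cast; ring
  rw [h, norm_mul, mul_comm Complex.I (y : ℂ), Complex.norm_exp_ofReal_mul_I, one_mul]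
  exact Real.norm_exp_I_mul_ofReal_sub_one_le

theorem norm_exp_I_mul_sub_exp_I_mul_le_two (x y : ℝ) :
    ‖Complex.exp (Complex.I * x) - Complex.exp (Complex.I * y)‖ ≤ 2 := by
  refine (norm_sub_le _ _).trans ?_
  rw [mul_comm, Complex.norm_exp_ofReal_mul_I, mul_comm, Complex.norm_exp_ofReal_mul_I]
  norm_num

theorem integrable_exp_I_mul {μ : Measure Ω} [IsFiniteMeasure μ] {Y : Ω → ℝ} (hY : Measurable Y) :
    Integrable (fun ω => Complex.exp (Complex.I * (Y ω : ℂ))) μ := by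
  refine Integrable.of_bound (C := 1) (by fun_prop) (ae_of_all _ fun ω => ?_)
  rw [mul_comm, Complex.norm_exp_ofReal_mul_I]

theorem norm_integral_exp_sub_integral_exp_le {μ : Measure Ω} [IsFiniteMeasure μ] {Y Y' : Ω → ℝ}
    (hY : Measurable Y) (hY' : Measurable Y') {b : Ω → ℝ} (hb : Integrable b μ)
    (h : ∀ᵐ ω ∂μ, ‖Complex.exp (Complex.I * (Y ω : ℂ)) - Complex.exp (Complex.I * (Y' ω : ℂ))‖ ≤
      b ω) :
    ‖∫ ω, Complex.exp (Complex.I * (Y ω : ℂ)) ∂μ - ∫ ω, Complex.exp (Complex.I * (Y' ω : ℂ)) ∂μ‖ ≤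
      ∫ ω, b ω ∂μ := by
  rw [← integral_sub (integrable_exp_I_mul hY) (integrable_exp_I_mul hY')]
  exact norm_integral_le_of_norm_le hb h

end ExpDifference

/-! ### Diffusive arrays: moment bounds and limits of characteristic functions -/

/-- A sequence of walks with steps of order `1 / √n`, drift approximately `A(j/n) W / n` and second
moments approximately `M(j/n) / n`, at times `j/n < τ`, and numbers of steps `N ~ n t`. -/
structure IsDiffusiveArray {Ω : ℕ → Type*} {mΩ : ∀ k, MeasurableSpace (Ω k)} {q : ℕ}
    (ℱ : ∀ k, Filtration ℕ (mΩ k)) (μ : ∀ k, Measure (Ω k)) (W b : ∀ k, ℕ → Ω k → Fin q → ℝ)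
    (c : ∀ k, ℕ → Ω k → Fin q → Fin q → ℝ) (δ : ℕ → ℝ) (n N : ℕ → ℕ)
    (A M : ℝ → Matrix (Fin q) (Fin q) ℝ) (τ : EReal) (t : ℝ) : Prop where
  prob : ∀ k, IsProbabilityMeasure (μ k)
  walk : ∀ k, IsAdaptedWalk (ℱ k) (μ k) (W k) (b k) (c k) (δ k) (N k)
  pos : ∀ k, 0 < n k
  tendsto_n : Tendsto n atTop atTop
  tendsto_step : Tendsto δ atTop (𝓝 0)
  tendsto_time : Tendsto (fun k => (N k : ℝ) / n k) atTop (𝓝 t)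
  time_le : (t : EReal) ≤ τ
  drift_le : ∃ L : ℝ, 0 ≤ L ∧ ∀ᶠ k in atTop, ∀ j < N k, ∀ᵐ ω ∂(μ k), ∀ i,
    |b k j ω i| ≤ (L * ‖W k j ω‖ + 1) / n k
  second_le : ∃ K : ℝ, 0 ≤ K ∧ ∀ᶠ k in atTop, ∀ j < N k, ∀ᵐ ω ∂(μ k), ∀ i,
    c k j ω i i ≤ K / n k
  drift : ∀ t' ∈ timeInterval τ, ∀ e > 0, ∀ᶠ k in atTop, ∀ j < N k, (j : ℝ) / n k ≤ t' →
    ∀ᵐ ω ∂(μ k), ∀ i, |n k * b k j ω i - (A ((j : ℝ) / n k)).mulVec (W k j ω) i| ≤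
      e * (1 + W k j ω ⬝ᵥ W k j ω)
  second : ∀ t' ∈ timeInterval τ, ∀ e > 0, ∀ᶠ k in atTop, ∀ j < N k, (j : ℝ) / n k ≤ t' →
    ∀ᵐ ω ∂(μ k), ∀ i l, |n k * c k j ω i l - M ((j : ℝ) / n k) i l| ≤
      e * (1 + W k j ω ⬝ᵥ W k j ω)
  second_symm : ∀ k j ω i l, c k j ω i l = c k j ω l i

namespace IsDiffusiveArray

variable {Ω : ℕ → Type*} {mΩ : ∀ k, MeasurableSpace (Ω k)} {q : ℕ}
  {ℱ : ∀ k, Filtration ℕ (mΩ k)} {μ : ∀ k, Measure (Ω k)} {W b : ∀ k, ℕ → Ω k → Fin q → ℝ}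
  {c : ∀ k, ℕ → Ω k → Fin q → Fin q → ℝ} {δ : ℕ → ℝ} {n N : ℕ → ℕ}
  {A M : ℝ → Matrix (Fin q) (Fin q) ℝ} {τ : EReal} {t : ℝ}

theorem time_nonneg (h : IsDiffusiveArray ℱ μ W b c δ n N A M τ t) : 0 ≤ t :=
  ge_of_tendsto' h.tendsto_time fun _ => by positivity

theorem tendsto_cast (h : IsDiffusiveArray ℱ μ W b c δ n N A M τ t) :
    Tendsto (fun k => (n k : ℝ)) atTop atTop :=
  tendsto_natCast_atTop_atTop.comp h.tendsto_n

theorem eventually_time_le (h : IsDiffusiveArray ℱ μ W b c δ n N A M τ t) :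
    ∀ᶠ k in atTop, (N k : ℝ) / n k ≤ t + 1 :=
  (h.tendsto_time.eventually_lt_const (lt_add_one t)).mono fun _ hk => hk.le

/-- The second moments are bounded. -/
theorem exists_integral_le (h : IsDiffusiveArray ℱ μ W b c δ n N A M τ t) :
    ∃ B : ℝ, 0 ≤ B ∧ ∀ᶠ k in atTop, ∀ j ≤ N k, ∫ ω, W k j ω ⬝ᵥ W k j ω ∂(μ k) ≤ B := by
  obtain ⟨L, hL, hb⟩ := h.drift_le
  obtain ⟨K, hK, hc⟩ := h.second_le
  have ht := h.time_nonneg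
  refine ⟨q * (1 + K) * (t + 1) * Real.exp (q * (2 * L + 1) * (t + 1)), by positivity, ?_⟩
  filter_upwards [hb, hc, h.eventually_time_le] with k hbk hck htk j hj
  have := h.prob k
  have hn : (0 : ℝ) < n k := by exact_mod_cast h.pos k
  have h1 := (h.walk k).integral_dotProduct_self_le (h.pos k) (i := 0) (B := 1) hL hK
    (R := fun _ => 1) (integrable_const _) (by simp) (fun j _ hjN => by
      filter_upwards [hbk j hjN, (h.walk k).zero] with ω hω h0
      simpa [h0] using hω) (fun j _ hjN => hck j hjN) (Nat.zero_le j) hj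
  have h2 : ∫ ω, (W k j ω - W k 0 ω) ⬝ᵥ (W k j ω - W k 0 ω) ∂(μ k) =
      ∫ ω, W k j ω ⬝ᵥ W k j ω ∂(μ k) := by
    refine integral_congr_ae ?_
    filter_upwards [(h.walk k).zero] with ω h0
    simp [h0]
  have h3 : ((j : ℝ) - (0 : ℕ)) / n k ≤ t + 1 := by
    refine le_trans ?_ htk
    have : (j : ℝ) ≤ N k := by exact_mod_cast hj
    rw [Nat.cast_zero, sub_zero]
    gcongr
  rw [h2] at h1
  have h4 : 0 ≤ ((j : ℝ) - (0 : ℕ)) / n k := by rw [Nat.cast_zero, sub_zero]; positivity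
  refine h1.trans ?_
  gcongr

/-- The second moments of the increments are at most proportional to the time elapsed. -/
theorem exists_integral_sub_le (h : IsDiffusiveArray ℱ μ W b c δ n N A M τ t) :
    ∃ B : ℝ, 0 ≤ B ∧ ∀ᶠ k in atTop, ∀ i j, i ≤ j → j ≤ N k →
      ∫ ω, (W k j ω - W k i ω) ⬝ᵥ (W k j ω - W k i ω) ∂(μ k) ≤ B * (((j : ℝ) - i) / n k) := by
  obtain ⟨L, hL, hb⟩ := h.drift_le
  obtain ⟨K, hK, hc⟩ := h.second_le
  obtain ⟨B, hB, hW⟩ := h.exists_integral_le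
  have ht := h.time_nonneg
  refine ⟨q * ((2 * L ^ 2 * B + 2) + K) * Real.exp (q * (2 * L + 1) * (t + 1)), by positivity, ?_⟩
  filter_upwards [hb, hc, hW, h.eventually_time_le] with k hbk hck hWk htk i j hij hj
  have := h.prob k
  have hn : (0 : ℝ) < n k := by exact_mod_cast h.pos k
  have hi := hij.trans hj
  -- For a walk restarted at time `i` the drift is bounded by `L ‖W j - W i‖ + R` with `R = L ‖W i‖
  -- + 1`, and the uniform moment bound controls the mean of `R²`.
  have hle : ∀ ω, (L * ‖W k i ω‖ + 1) ^ 2 ≤ 2 * L ^ 2 * (W k i ω ⬝ᵥ W k i ω) + 2 := fun ω => by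
    have h1 := mul_le_mul_of_nonneg_left (norm_sq_le_dotProduct_self (W k i ω)) (sq_nonneg L)
    nlinarith [sq_nonneg (L * ‖W k i ω‖ - 1)]
  have hint : Integrable (fun ω => 2 * L ^ 2 * (W k i ω ⬝ᵥ W k i ω) + 2) (μ k) :=
    (((h.walk k).integrable_dotProduct_self' hi).const_mul _).add (integrable_const _)
  have hR : Integrable (fun ω => (L * ‖W k i ω‖ + 1) ^ 2) (μ k) := by
    have hm := (h.walk k).measurable hi
    refine hint.mono' (Measurable.aestronglyMeasurable (by fun_prop)) (ae_of_all _ fun ω => ?_)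
    rw [Real.norm_of_nonneg (sq_nonneg _)]
    exact hle ω
  have hRB : ∫ ω, (L * ‖W k i ω‖ + 1) ^ 2 ∂(μ k) ≤ 2 * L ^ 2 * B + 2 := by
    refine (integral_mono hR hint hle).trans ?_
    rw [integral_add (((h.walk k).integrable_dotProduct_self' hi).const_mul _)
      (integrable_const _), integral_const_mul]
    have := hWk i hi
    simp only [integral_const, probReal_univ, smul_eq_mul, one_mul]
    gcongr
  have h1 := (h.walk k).integral_dotProduct_self_le (h.pos k) (i := i) hL hK hR hRB
    (fun j _ hjN => by
      filter_upwards [hbk j hjN] with ω hω l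
      refine (hω l).trans ?_
      have := norm_sub_norm_le (W k j ω) (W k i ω)
      have : L * ‖W k j ω‖ ≤ L * (‖W k j ω - W k i ω‖ + ‖W k i ω‖) := by gcongr; linarith
      exact div_le_div_of_nonneg_right (by linarith) hn.le) (fun j _ hjN => hck j hjN) hij hj
  have hij' : (i : ℝ) ≤ j := by exact_mod_cast hij
  have h4 : 0 ≤ ((j : ℝ) - i) / n k := div_nonneg (sub_nonneg.2 hij') hn.le
  have h3 : ((j : ℝ) - i) / n k ≤ t + 1 := by
    refine le_trans ?_ htk
    have : (j : ℝ) ≤ N k := by exact_mod_cast hj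
    gcongr
    have : (0 : ℝ) ≤ i := by positivity
    linarith
  refine h1.trans ?_
  rw [mul_right_comm]
  gcongr

end IsDiffusiveArray

theorem exists_abs_le_of_continuousOn {ι : Type*} [Fintype ι] {φ : ι → ℝ → ℝ} {s : Set ℝ}
    (hs : IsCompact s) (hφ : ∀ i, ContinuousOn (φ i) s) :
    ∃ K : ℝ, 0 ≤ K ∧ ∀ r ∈ s, ∀ i, |φ i r| ≤ K := by
  obtain ⟨K, hK⟩ := hs.exists_bound_of_continuousOn (f := fun r i => φ i r) (continuousOn_pi.2 hφ)
  exact ⟨max K 0, le_max_right _ _, fun r hr i =>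
    (norm_le_pi_norm (fun i => φ i r) i).trans ((hK r hr).trans (le_max_left _ _))⟩

theorem eventually_abs_step_sub_le {φ φ' : ℝ → ℝ} {T : ℝ}
    (hφ : ∀ s ∈ Set.Icc 0 T, HasDerivWithinAt φ (φ' s) (Set.Icc 0 T) s)
    (hc : ContinuousOn φ' (Set.Icc 0 T)) {n : ℕ → ℕ} (hn : Tendsto (fun k => (n k : ℝ)) atTop atTop)
    {η : ℝ} (hη : 0 < η) :
    ∀ᶠ k in atTop, ∀ j : ℕ, ((j + 1 : ℕ) : ℝ) / n k ≤ T →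
      |n k * (φ (((j + 1 : ℕ) : ℝ) / n k) - φ ((j : ℝ) / n k)) - φ' ((j : ℝ) / n k)| ≤ η := by
  obtain ⟨δ, hδ, h⟩ := exists_taylor_one_uniform hφ hc hη
  filter_upwards [hn.eventually_ge_atTop (1 / δ), hn.eventually_gt_atTop 0] with k hk hk0 j hj
  have h1 : ((j + 1 : ℕ) : ℝ) / n k - (j : ℝ) / n k = 1 / n k := by
    push_cast; ring
  have h2 : (0 : ℝ) < 1 / n k := by positivity
  have h3 := h ((j : ℝ) / n k) ⟨by positivity, by linarith⟩ (((j + 1 : ℕ) : ℝ) / n k)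
    ⟨by positivity, hj⟩ (by linarith) (by rw [h1, one_div_le hk0 hδ]; exact hk)
  rw [h1] at h3
  have h4 := mul_le_mul_of_nonneg_left h3 hk0.le
  rw [← abs_mul_abs_of_pos hk0] at h4
  have h5 : (n k : ℝ) * (φ (((j + 1 : ℕ) : ℝ) / n k) - φ ((j : ℝ) / n k) -
      1 / n k * φ' ((j : ℝ) / n k)) =
      n k * (φ (((j + 1 : ℕ) : ℝ) / n k) - φ ((j : ℝ) / n k)) - φ' ((j : ℝ) / n k) := by
    field_simp
  rw [h5] at h4
  refine h4.trans (le_of_eq ?_)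
  field_simp

theorem cast_mul_le_sq_mul_sq (q : ℕ) {K : ℝ} (hK : 1 ≤ K) :
    (q : ℝ) * K ≤ (1 + q) ^ 2 * K ^ 2 ∧ (q : ℝ) ≤ (1 + q) ^ 2 * K ^ 2 ∧
      (q : ℝ) * (q * (K * K)) ≤ (1 + q) ^ 2 * K ^ 2 ∧ 1 ≤ (1 + (q : ℝ)) ^ 2 * K ^ 2 := by
  have hq : (0 : ℝ) ≤ q := Nat.cast_nonneg q
  have h1 : (q : ℝ) ≤ (1 + q) ^ 2 := by nlinarith
  have h2 : (q : ℝ) * q ≤ (1 + q) ^ 2 := by nlinarith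
  have h3 : (1 : ℝ) ≤ (1 + q) ^ 2 := one_le_pow₀ (by linarith)
  have h4 : K ≤ K ^ 2 := le_self_pow₀ hK two_ne_zero
  have h5 : 1 ≤ K ^ 2 := one_le_pow₀ hK
  refine ⟨by gcongr, ?_, ?_, one_le_mul_of_one_le_of_one_le h3 h5⟩
  · exact h1.trans (le_mul_of_one_le_right (by positivity) h5)
  · calc (q : ℝ) * (q * (K * K)) = q * q * K ^ 2 := by ring
      _ ≤ _ := by gcongr

namespace IsDiffusiveArray

variable {Ω : ℕ → Type*} {mΩ : ∀ k, MeasurableSpace (Ω k)} {q : ℕ}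
  {ℱ : ∀ k, Filtration ℕ (mΩ k)} {μ : ∀ k, Measure (Ω k)} {W b : ∀ k, ℕ → Ω k → Fin q → ℝ}
  {c : ∀ k, ℕ → Ω k → Fin q → Fin q → ℝ} {δ : ℕ → ℝ} {n N : ℕ → ℕ}
  {A M : ℝ → Matrix (Fin q) (Fin q) ℝ} {τ : EReal} {t : ℝ}

set_option maxHeartbeats 800000 in
/-- Along row vectors `a` that solve the adjoint equation, with `ψ` the accumulated variance, the
exponential martingale has mean close to `1`. -/
theorem tendsto_integral_exp_compensated (h : IsDiffusiveArray ℱ μ W b c δ n N A M τ t) {t' : ℝ}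
    (ht' : t' ∈ timeInterval τ) {a : ℝ → Fin q → ℝ} {ψ : ℝ → ℝ}
    (ha : ∀ i, ∀ s ∈ Set.Icc 0 t', HasDerivWithinAt (fun r => a r i)
      (-(Matrix.vecMul (a s) (A s) i)) (Set.Icc 0 t') s)
    (hψ : ∀ s ∈ Set.Icc 0 t', HasDerivWithinAt ψ (∑ i, ∑ l, a s i * a s l * M s i l)
      (Set.Icc 0 t') s) (hψ0 : ψ 0 = 0)
    (hA : ∀ i l, ContinuousOn (fun s => A s i l) (Set.Icc 0 t'))
    (hM : ∀ i l, ContinuousOn (fun s => M s i l) (Set.Icc 0 t')) :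
    Tendsto (fun k => ∫ ω, Complex.exp (Complex.I *
      ((a ((min (N k) ⌊t' * n k⌋₊ : ℕ) / n k : ℝ) ⬝ᵥ W k (min (N k) ⌊t' * n k⌋₊) ω : ℝ) : ℂ) +
      (ψ ((min (N k) ⌊t' * n k⌋₊ : ℕ) / n k : ℝ) / 2 : ℝ)) ∂(μ k)) atTop (𝓝 1) := by
  have hac : ∀ i, ContinuousOn (fun s => a s i) (Set.Icc 0 t') := fun i s hs =>
    (ha i s hs).continuousWithinAt
  have hac' : ∀ i, ContinuousOn (fun s => -(Matrix.vecMul (a s) (A s) i)) (Set.Icc 0 t') :=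
    fun i => by
      simp only [Matrix.vecMul, dotProduct]
      exact (continuousOn_finsetSum _ fun l _ => (hac l).mul (hA l i)).neg
  have hψc' : ContinuousOn (fun s => ∑ i, ∑ l, a s i * a s l * M s i l) (Set.Icc 0 t') :=
    continuousOn_finsetSum _ fun i _ => continuousOn_finsetSum _ fun l _ =>
      ((hac i).mul (hac l)).mul (hM i l)
  have hψc : ContinuousOn ψ (Set.Icc 0 t') := fun s hs => (hψ s hs).continuousWithinAt
  obtain ⟨K₁, hK₁, ba⟩ := exists_abs_le_of_continuousOn isCompact_Icc hac
  obtain ⟨K₂, hK₂, ba'⟩ := exists_abs_le_of_continuousOn isCompact_Icc hac'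
  obtain ⟨K₃, hK₃, bψ⟩ := exists_abs_le_of_continuousOn (ι := Unit) isCompact_Icc fun _ => hψc
  obtain ⟨K₄, hK₄, bψ'⟩ := exists_abs_le_of_continuousOn (ι := Unit) isCompact_Icc fun _ => hψc'
  obtain ⟨K₅, hK₅, bA⟩ := exists_abs_le_of_continuousOn (ι := Fin q × Fin q)
    (φ := fun p s => A s p.1 p.2) isCompact_Icc fun p => hA p.1 p.2
  obtain ⟨K₆, hK₆, bM⟩ := exists_abs_le_of_continuousOn (ι := Fin q × Fin q)
    (φ := fun p s => M s p.1 p.2) isCompact_Icc fun p => hM p.1 p.2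
  obtain ⟨B, hB0, hB⟩ := h.exists_integral_le
  -- One constant for `a`, `ψ` and `n` times their one-step differences; the latter are within `η ≤
  -- 1` of the derivatives, which the summand `1` covers.
  obtain ⟨K, hK⟩ : ∃ K, K = 1 + K₁ + K₂ + K₃ + K₄ := ⟨_, rfl⟩
  have hK1 : 1 ≤ K := by linarith
  have ht0 : 0 ≤ t' := ht'.1
  obtain ⟨Z, hZ⟩ : ∃ Z, Z = Real.exp (K / 2) * (30 * K ^ 2 * (1 + q) ^ 2 * (1 + B)) * (t' + 1) :=
    ⟨_, rfl⟩
  have hZ0 : 0 < Z := by rw [hZ]; positivity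
  rw [tendsto_iff_norm_sub_tendsto_zero]
  rw [Metric.tendsto_nhds]
  intro ε hε
  obtain ⟨e, he⟩ : ∃ e, e = min 1 (ε / (2 * Z)) := ⟨_, rfl⟩
  have he0 : 0 < e := by rw [he]; positivity
  have he1 : e ≤ 1 := he ▸ min_le_left _ _
  have heZ : Z * e < ε := by
    have : Z * e ≤ Z * (ε / (2 * Z)) := by rw [he]; gcongr; exact min_le_right _ _
    have h2 : Z * (ε / (2 * Z)) = ε / 2 := by field_simp
    linarith
  -- With coefficients accurate to `η`, each error term in the drift and variance conditions is at
  -- most `e / 4`; the total after at most `n t'` steps is then at most `Z e < ε`.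
  obtain ⟨η, hη⟩ : ∃ η, η = e / (4 * ((1 + q) ^ 2 * K ^ 2)) := ⟨_, rfl⟩
  have hη0 : 0 < η := by rw [hη]; positivity
  have hηe : ∀ x : ℝ, x ≤ (1 + q) ^ 2 * K ^ 2 → x * η ≤ e / 4 := by
    intro x hx
    have h1 : (1 + (q : ℝ)) ^ 2 * K ^ 2 * η = e / 4 := by rw [hη]; field_simp
    rw [← h1]; gcongr
  obtain ⟨q1, q2, q3, q4⟩ := cast_mul_le_sq_mul_sq q hK1
  have hη1 : η ≤ 1 := by
    have := hηe 1 q4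
    linarith
  have hdiv : ∀ x y : ℝ, 0 < y → ∀ᶠ k in atTop, x / n k ≤ y := fun x y hy =>
    ((h.tendsto_cast.const_div_atTop x).eventually_lt_const hy).mono fun _ hk => hk.le
  have hstep := fun i => eventually_abs_step_sub_le (ha i) (hac' i) h.tendsto_cast hη0
  filter_upwards [hB, h.drift t' ht' η hη0, h.second t' ht' η hη0,
    h.tendsto_step.eventually_lt_const he0, eventually_all.2 hstep,
    eventually_abs_step_sub_le hψ hψc' h.tendsto_cast hη0, hdiv 1 e he0, hdiv K 1 one_pos,
    hdiv (q * K * (q * K₅)) (e / 4) (by positivity),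
    hdiv (q * (q * (2 * K * K * K₆))) (e / 4) (by positivity)]
    with k hBk hd hs hδ hsa hsψ hn1 hnK hnA hnM
  have := h.prob k
  have hn : (0 : ℝ) < n k := by exact_mod_cast h.pos k
  set m := min (N k) ⌊t' * n k⌋₊ with hm
  have hmN : m ≤ N k := min_le_left _ _
  have hmt : (m : ℝ) ≤ t' * n k :=
    (Nat.cast_le.2 (min_le_right _ _)).trans (Nat.floor_le (by positivity))
  have hIcc : ∀ j ≤ m, (j : ℝ) / n k ∈ Set.Icc 0 t' := fun j hj => by
    refine ⟨by positivity, ?_⟩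
    rw [div_le_iff₀ hn]
    exact (Nat.cast_le.2 hj).trans hmt
  have hΔa : ∀ j < m, ∀ i, |a (((j + 1 : ℕ) : ℝ) / n k) i - a ((j : ℝ) / n k) i| ≤ K / n k := by
    intro j hj i
    rw [le_div_iff₀ hn, mul_comm, ← abs_mul_abs_of_pos hn]
    have h1 := hsa i j (hIcc (j + 1) hj).2
    have h2 := ba' _ (hIcc j hj.le) i
    have h3 := abs_sub_abs_le_abs_sub (n k * (a (((j + 1 : ℕ) : ℝ) / n k) i - a ((j : ℝ) / n k) i))
      (-(Matrix.vecMul (a ((j : ℝ) / n k)) (A ((j : ℝ) / n k)) i))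
    linarith
  have hΔψ : ∀ j < m, |ψ (((j + 1 : ℕ) : ℝ) / n k) - ψ ((j : ℝ) / n k)| ≤ K / n k := by
    intro j hj
    rw [le_div_iff₀ hn, mul_comm, ← abs_mul_abs_of_pos hn]
    have h1 := hsψ j (hIcc (j + 1) hj).2
    have h2 := bψ' _ (hIcc j hj.le) ()
    have h3 := abs_sub_abs_le_abs_sub (n k * (ψ (((j + 1 : ℕ) : ℝ) / n k) - ψ ((j : ℝ) / n k)))
      (∑ i, ∑ l, a ((j : ℝ) / n k) i * a ((j : ℝ) / n k) l * M ((j : ℝ) / n k) i l)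
    linarith
  have key := (h.walk k).norm_integral_exp_sub_one_le (h.pos k) hmN
    (a := fun j => a ((j : ℝ) / n k)) (ψ := fun j => ψ ((j : ℝ) / n k)) (K := K) (e := e)
    (Ψ := K) (B := B) hK1 hδ.le he1 hn1 hnK (by simpa using hψ0)
    (fun j hj i => (ba _ (hIcc j hj) i).trans (by linarith)) hΔa hΔψ
    (fun j hj => (le_abs_self _).trans ((bψ _ (hIcc j hj) ()).trans (by linarith)))
    (fun j hj => hBk j (hj.trans hmN))
    (fun j hj => by
      filter_upwards [hd j (hj.trans_le hmN) (hIcc j hj.le).2] with ω hω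
      refine abs_compensated_drift_le hn (fun i l => bA _ (hIcc j hj.le) (i, l)) hK₅
        (by linarith) hη0.le hη0.le (fun i => (ba _ (hIcc (j + 1) hj) i).trans (by linarith))
        (hΔa j hj) (fun i => ?_) hω ?_
      · have h1 := hsa i j (hIcc (j + 1) hj).2
        rwa [sub_neg_eq_add] at h1
      · have h1 := hηe _ q1
        have h2 := hηe _ q2
        linarith)
    (fun j hj => by
      filter_upwards [hs j (hj.trans_le hmN) (hIcc j hj.le).2] with ω hω
      refine abs_variance_step_le hn (by linarith) hη0.le
        (fun i l => bM _ (hIcc j hj.le) (i, l)) hK₆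
        (fun i => (ba _ (hIcc j hj.le) i).trans (by linarith))
        (fun i => (ba _ (hIcc (j + 1) hj) i).trans (by linarith))
        (hΔa j hj) (hsψ j (hIcc (j + 1) hj).2) hω ?_
      have h1 := hηe _ q3
      have h2 := hηe _ q4
      have h3 : (q : ℝ) * (q * (K * K * η)) = q * (q * (K * K)) * η := by ring
      linarith) le_rfl
  rw [dist_zero_right, norm_norm]
  refine key.trans_lt (lt_of_le_of_lt ?_ heZ)
  have h1 : e / n k * m ≤ e * (t' + 1) := by
    rw [div_mul_eq_mul_div, div_le_iff₀ hn]
    nlinarith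
  calc Real.exp (K / 2) * (30 * K ^ 2 * (1 + q) ^ 2 * (1 + B) * (e / n k)) * m
      = Real.exp (K / 2) * (30 * K ^ 2 * (1 + q) ^ 2 * (1 + B)) * (e / n k * m) := by ring
    _ ≤ Real.exp (K / 2) * (30 * K ^ 2 * (1 + q) ^ 2 * (1 + B)) * (e * (t' + 1)) := by gcongr
    _ = _ := by rw [hZ]; ring

end IsDiffusiveArray

theorem tendsto_min_floor_div {n N : ℕ → ℕ} (hn : Tendsto (fun k => (n k : ℝ)) atTop atTop) {t t' : ℝ}
    (hN : Tendsto (fun k => (N k : ℝ) / n k) atTop (𝓝 t)) (ht' : 0 ≤ t') (hle : t' ≤ t) :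
    Tendsto (fun k => ((min (N k) ⌊t' * n k⌋₊ : ℕ) : ℝ) / n k) atTop (𝓝 t') := by
  have h1 : Tendsto (fun k => (⌊t' * n k⌋₊ : ℝ) / n k) atTop (𝓝 t') :=
    (tendsto_nat_floor_mul_div_atTop ht').comp hn
  have h2 := hN.min h1
  rw [min_eq_right hle] at h2
  refine h2.congr fun k => ?_
  rw [Nat.cast_min, min_div_div_right (Nat.cast_nonneg _)]

theorem min_floor_div_mem_Icc {n N : ℕ} (hn : 0 < n) {t' : ℝ} (ht' : 0 ≤ t') :
    ((min N ⌊t' * n⌋₊ : ℕ) : ℝ) / n ∈ Set.Icc 0 t' := by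
  have hn' : (0 : ℝ) < n := by exact_mod_cast hn
  refine ⟨by positivity, ?_⟩
  rw [div_le_iff₀ hn']
  exact (Nat.cast_le.2 (min_le_right _ _)).trans (Nat.floor_le (by positivity))

section MatrixDerivative

variable {q : ℕ} {T Ξ A M : ℝ → Matrix (Fin q) (Fin q) ℝ} {I : Set ℝ}

theorem HasMatrixDerivOn.vecMul (hT : HasMatrixDerivOn T (fun s => -(T s * A s)) I) (u : Fin q → ℝ)
    (i : Fin q) {s : ℝ} (hs : s ∈ I) :
    HasDerivWithinAt (fun r => Matrix.vecMul u (T r) i)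
      (-(Matrix.vecMul (Matrix.vecMul u (T s)) (A s) i)) I s := by
  have h1 : HasDerivWithinAt (fun r => ∑ l, u l * T r l i) (∑ l, u l * (-(T s * A s)) l i) I s :=
    HasDerivWithinAt.fun_sum fun l _ => (hT s hs l i).const_mul (u l)
  have h2 : ∑ l, u l * (-(T s * A s)) l i = -(Matrix.vecMul (Matrix.vecMul u (T s)) (A s) i) := by
    rw [Matrix.vecMul_vecMul]
    simp [Matrix.vecMul, dotProduct]
  rw [h2] at h1
  exact h1

theorem HasMatrixDerivOn.quadratic
    (hΞ : HasMatrixDerivOn Ξ (fun s => T s * M s * (T s).transpose) I) (u : Fin q → ℝ) {s : ℝ}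
    (hs : s ∈ I) :
    HasDerivWithinAt (fun r => u ⬝ᵥ (Ξ r).mulVec u)
      (∑ i, ∑ l, Matrix.vecMul u (T s) i * Matrix.vecMul u (T s) l * M s i l) I s := by
  have h1 : HasDerivWithinAt (fun r => ∑ i, u i * ∑ l, Ξ r i l * u l)
      (∑ i, u i * ∑ l, (T s * M s * (T s).transpose) i l * u l) I s :=
    HasDerivWithinAt.fun_sum fun i _ => (HasDerivWithinAt.fun_sum fun l _ =>
      (hΞ s hs i l).mul_const (u l)).const_mul (u i)
  have h2 : ∑ i, u i * ∑ l, (T s * M s * (T s).transpose) i l * u l =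
      u ⬝ᵥ (T s * M s * (T s).transpose).mulVec u := rfl
  have h3 : u ⬝ᵥ (T s * M s * (T s).transpose).mulVec u =
      Matrix.vecMul u (T s) ⬝ᵥ (M s).mulVec (Matrix.vecMul u (T s)) := by
    rw [← Matrix.mulVec_mulVec, ← Matrix.mulVec_mulVec, Matrix.mulVec_transpose,
      Matrix.dotProduct_mulVec]
  rw [h2, h3] at h1
  refine h1.congr_deriv ?_
  simp only [dotProduct, Matrix.mulVec, Finset.mul_sum]
  refine Finset.sum_congr rfl fun i _ => Finset.sum_congr rfl fun l _ => ?_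
  ring

end MatrixDerivative

namespace IsDiffusiveArray

variable {Ω : ℕ → Type*} {mΩ : ∀ k, MeasurableSpace (Ω k)} {q : ℕ}
  {ℱ : ∀ k, Filtration ℕ (mΩ k)} {μ : ∀ k, Measure (Ω k)} {W b : ∀ k, ℕ → Ω k → Fin q → ℝ}
  {c : ∀ k, ℕ → Ω k → Fin q → Fin q → ℝ} {δ : ℕ → ℝ} {n N : ℕ → ℕ}
  {A M T Ξ S : ℝ → Matrix (Fin q) (Fin q) ℝ} {τ : EReal} {t : ℝ}

theorem integral_norm_le (h : IsDiffusiveArray ℱ μ W b c δ n N A M τ t) {k j : ℕ}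
    (hj : j ≤ N k) : Integrable (fun ω => ‖W k j ω‖) (μ k) ∧
      ∫ ω, ‖W k j ω‖ ∂(μ k) ≤ 1 + ∫ ω, W k j ω ⬝ᵥ W k j ω ∂(μ k) := by
  have := h.prob k
  have hi := (h.walk k).integrable_dotProduct_self' hj
  have hi1 : Integrable (fun ω => 1 + W k j ω ⬝ᵥ W k j ω) (μ k) := (integrable_const _).add hi
  have h1 : Integrable (fun ω => ‖W k j ω‖) (μ k) := by
    refine hi1.mono' ((h.walk k).measurable hj).norm.aestronglyMeasurable (ae_of_all _ fun ω => ?_)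
    rw [norm_norm]
    exact norm_le_one_add_dotProduct_self _
  refine ⟨h1, (integral_mono h1 hi1 fun ω => norm_le_one_add_dotProduct_self _).trans ?_⟩
  rw [integral_add (integrable_const _) hi]
  simp

/-- The row vector `u T(t')⁻¹ T(s)` solves the adjoint equation and equals `u` at `t'`, where the
accumulated variance is `u Σ(t') uᵀ`. The discrete time only tends to `t'`, so the row vector there
is merely close to `u`; bounded first moments of `‖W‖` absorb the difference. -/
theorem tendsto_integral_exp_min_floor (h : IsDiffusiveArray ℱ μ W b c δ n N A M τ t) {t' : ℝ}
    (ht' : t' ∈ timeInterval τ) (hle : t' ≤ t)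
    (hT : HasMatrixDerivOn T (fun s => -(T s * A s)) (timeInterval τ))
    (hTinv : ∀ s ∈ timeInterval τ, IsUnit (T s).det)
    (hΞ : HasMatrixDerivOn Ξ (fun s => T s * M s * (T s).transpose) (timeInterval τ))
    (hΞ0 : Ξ 0 = 0)
    (hS : ∀ s ∈ timeInterval τ, S s = (T s)⁻¹ * Ξ s * ((T s)⁻¹).transpose)
    (hA : ∀ i l, ContinuousOn (fun s => A s i l) (timeInterval τ))
    (hM : ∀ i l, ContinuousOn (fun s => M s i l) (timeInterval τ)) (u : Fin q → ℝ) :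
    Tendsto (fun k => ∫ ω, Complex.exp (Complex.I *
      ((u ⬝ᵥ W k (min (N k) ⌊t' * n k⌋₊) ω : ℝ) : ℂ)) ∂(μ k)) atTop
      (𝓝 (Complex.exp (-(u ⬝ᵥ (S t').mulVec u / 2 : ℝ)))) := by
  have hsub : Set.Icc 0 t' ⊆ timeInterval τ :=
    (convex_timeInterval τ).ordConnected.out ⟨le_rfl, (EReal.coe_le_coe_iff.2 ht'.1).trans_lt ht'.2⟩
      ht'
  obtain ⟨u', hu'⟩ : ∃ u', u' = Matrix.vecMul u (T t')⁻¹ := ⟨_, rfl⟩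
  have ha : ∀ i, ∀ s ∈ Set.Icc 0 t', HasDerivWithinAt (fun r => Matrix.vecMul u' (T r) i)
      (-(Matrix.vecMul (Matrix.vecMul u' (T s)) (A s) i)) (Set.Icc 0 t') s := fun i s hs =>
    (hT.vecMul u' i (hsub hs)).mono hsub
  have hψ : ∀ s ∈ Set.Icc 0 t', HasDerivWithinAt (fun r => u' ⬝ᵥ (Ξ r).mulVec u')
      (∑ i, ∑ l, Matrix.vecMul u' (T s) i * Matrix.vecMul u' (T s) l * M s i l)
      (Set.Icc 0 t') s := fun s hs => (hΞ.quadratic u' (hsub hs)).mono hsub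
  have hmain := h.tendsto_integral_exp_compensated ht' (a := fun r => Matrix.vecMul u' (T r)) ha hψ
    (by simp [hΞ0]) (fun i l => (hA i l).mono hsub) (fun i l => (hM i l).mono hsub)
  have hat : Matrix.vecMul u' (T t') = u := by
    rw [hu', Matrix.vecMul_vecMul, Matrix.nonsing_inv_mul _ (hTinv t' ht'), Matrix.vecMul_one]
  have hψt : u' ⬝ᵥ (Ξ t').mulVec u' = u ⬝ᵥ (S t').mulVec u := by
    rw [hS t' ht', ← Matrix.mulVec_mulVec, ← Matrix.mulVec_mulVec, Matrix.mulVec_transpose,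
      ← hu', Matrix.dotProduct_mulVec u, ← hu']
  have htime : Tendsto (fun k => ((min (N k) ⌊t' * n k⌋₊ : ℕ) : ℝ) / n k) atTop
      (𝓝[Set.Icc 0 t'] t') :=
    tendsto_nhdsWithin_iff.2 ⟨tendsto_min_floor_div h.tendsto_cast h.tendsto_time ht'.1 hle,
      Eventually.of_forall fun k => min_floor_div_mem_Icc (h.pos k) ht'.1⟩
  have ht'mem : t' ∈ Set.Icc 0 t' := ⟨ht'.1, le_rfl⟩
  have hψlim := (hψ t' ht'mem).continuousWithinAt.tendsto.comp htime
  have halim : Tendsto (fun k => u - Matrix.vecMul u'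
      (T (((min (N k) ⌊t' * n k⌋₊ : ℕ) : ℝ) / n k))) atTop (𝓝 0) := by
    refine tendsto_pi_nhds.2 fun i => ?_
    have h1 := ((ha i t' ht'mem).continuousWithinAt.tendsto.comp htime).const_sub (u i)
    rw [hat, sub_self] at h1
    exact h1
  obtain ⟨B, hB0, hB⟩ := h.exists_integral_le
  have hY : Tendsto (fun k => ∫ ω, Complex.exp (Complex.I *
      ((Matrix.vecMul u' (T (((min (N k) ⌊t' * n k⌋₊ : ℕ) : ℝ) / n k)) ⬝ᵥ
        W k (min (N k) ⌊t' * n k⌋₊) ω : ℝ) : ℂ)) ∂(μ k)) atTop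
      (𝓝 (Complex.exp (-(u ⬝ᵥ (S t').mulVec u / 2 : ℝ)))) := by
    have h1 : Tendsto (fun k => Complex.exp (-((u' ⬝ᵥ (Ξ (((min (N k) ⌊t' * n k⌋₊ : ℕ) : ℝ) /
        n k)).mulVec u') / 2 : ℝ))) atTop (𝓝 (Complex.exp (-(u ⬝ᵥ (S t').mulVec u / 2 : ℝ)))) := by
      rw [← hψt]
      exact (Complex.continuous_exp.tendsto _).comp
        (((Complex.continuous_ofReal.tendsto _).comp (hψlim.div_const 2)).neg)
    have h2 := h1.mul hmain
    rw [mul_one] at h2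
    refine h2.congr fun k => ?_
    rw [← integral_const_mul]
    congr 1
    ext ω
    rw [← Complex.exp_add]
    congr 1
    ring
  refine (tendsto_iff_of_dist ?_).1 hY
  have hbd : Tendsto (fun k => q * ‖u - Matrix.vecMul u'
      (T (((min (N k) ⌊t' * n k⌋₊ : ℕ) : ℝ) / n k))‖ * (1 + B)) atTop (𝓝 0) := by
    simpa using (halim.norm.const_mul (q : ℝ)).mul_const (1 + B)
  refine squeeze_zero' (Eventually.of_forall fun _ => dist_nonneg) ?_ hbd
  filter_upwards [hB] with k hBk
  have := h.prob k
  have hm : min (N k) ⌊t' * n k⌋₊ ≤ N k := min_le_left _ _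
  obtain ⟨hi, hle⟩ := h.integral_norm_le hm
  have hmeas := (h.walk k).measurable hm
  rw [dist_comm, dist_eq_norm]
  refine (norm_integral_exp_sub_integral_exp_le (by unfold dotProduct; fun_prop)
    (by unfold dotProduct; fun_prop) (hi.const_mul (q * ‖u - Matrix.vecMul u'
      (T (((min (N k) ⌊t' * n k⌋₊ : ℕ) : ℝ) / n k))‖)) (ae_of_all _ fun ω => ?_)).trans ?_
  · refine (norm_exp_I_mul_sub_exp_I_mul_le _ _).trans ?_
    rw [← sub_dotProduct]
    exact abs_dotProduct_le (fun i => norm_le_pi_norm (u - Matrix.vecMul u' _) i) _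
  · rw [integral_const_mul]
    have := hBk _ hm
    gcongr
    linarith

/-- The characteristic functions converge to the Gaussian one. -/
theorem tendsto_integral_exp (h : IsDiffusiveArray ℱ μ W b c δ n N A M τ t) (hτ : 0 < τ)
    (hT : HasMatrixDerivOn T (fun s => -(T s * A s)) (timeInterval τ))
    (hTinv : ∀ s ∈ timeInterval τ, IsUnit (T s).det)
    (hΞ : HasMatrixDerivOn Ξ (fun s => T s * M s * (T s).transpose) (timeInterval τ))
    (hΞ0 : Ξ 0 = 0)
    (hS : ∀ s ∈ timeInterval τ, S s = (T s)⁻¹ * Ξ s * ((T s)⁻¹).transpose)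
    (hScont : Continuous S)
    (hA : ∀ i l, ContinuousOn (fun s => A s i l) (timeInterval τ))
    (hM : ∀ i l, ContinuousOn (fun s => M s i l) (timeInterval τ)) (u : Fin q → ℝ) :
    Tendsto (fun k => ∫ ω, Complex.exp (Complex.I * ((u ⬝ᵥ W k (N k) ω : ℝ) : ℂ)) ∂(μ k)) atTop
      (𝓝 (Complex.exp (-(u ⬝ᵥ (S t).mulVec u / 2 : ℝ)))) := by
  obtain ⟨B, hB0, hB⟩ := h.exists_integral_sub_le
  have ht0 := h.time_nonneg
  have hΦ : Continuous fun s => Complex.exp (-(u ⬝ᵥ (S s).mulVec u / 2 : ℝ)) := by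
    simp only [dotProduct, Matrix.mulVec]
    have : ∀ i l, Continuous fun s => S s i l := fun i l =>
      (continuous_apply l).comp ((continuous_apply i).comp hScont)
    fun_prop
  rw [Metric.tendsto_nhds]
  intro ε hε
  obtain ⟨ρ, hρ, hΦρ⟩ := Metric.continuous_iff.1 hΦ t (ε / 3) (by positivity)
  -- `η` is the weight in `x ≤ η / 2 + x² / (2 η)`, applied to the remaining increment `x = ‖W N - W
  -- m‖`. Its mean square is at most `2 B η²` once the time gap is below `2 η²`.
  obtain ⟨η, hη0, hη⟩ : ∃ η > 0, q * ‖u‖ * (η / 2 * (1 + 2 * B)) < ε / 3 := by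
    obtain ⟨Z, hZ⟩ : ∃ Z, Z = q * ‖u‖ * ((1 + 2 * B) / 2) := ⟨_, rfl⟩
    have hZ0 : 0 ≤ Z := by rw [hZ]; positivity
    refine ⟨ε / 3 / (Z + 1), by positivity, ?_⟩
    have : q * ‖u‖ * (ε / 3 / (Z + 1) / 2 * (1 + 2 * B)) = Z * (ε / 3) / (Z + 1) := by
      rw [hZ]; ring
    rw [this, div_lt_iff₀ (by positivity)]
    nlinarith
  -- The coefficients are controlled only strictly before `τ`, and `t = τ` is allowed; so one stops
  -- slightly earlier, except that for `t = 0` the time `0` itself will do.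
  obtain ⟨t', ht', htle, htρ, htη⟩ : ∃ t' ∈ timeInterval τ, t' ≤ t ∧ t - t' < ρ ∧
      t - t' < η ^ 2 * 2 := by
    rcases ht0.eq_or_lt with h0 | h0
    · exact ⟨0, zero_mem_timeInterval hτ, ht0, by rw [← h0]; simpa, by rw [← h0]; simp; positivity⟩
    · have hr : 0 < min ρ (η ^ 2 * 2) := by positivity
      refine ⟨max 0 (t - min ρ (η ^ 2 * 2) / 2), ⟨le_max_left _ _, ?_⟩, max_le ht0 (by linarith),
        ?_, ?_⟩
      · refine lt_of_lt_of_le (EReal.coe_lt_coe_iff.2 ?_) h.time_le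
        exact max_lt h0 (by linarith)
      · have := le_max_right 0 (t - min ρ (η ^ 2 * 2) / 2)
        have := min_le_left ρ (η ^ 2 * 2)
        linarith
      · have := le_max_right 0 (t - min ρ (η ^ 2 * 2) / 2)
        have := min_le_right ρ (η ^ 2 * 2)
        linarith
  have hlim := h.tendsto_integral_exp_min_floor ht' htle hT hTinv hΞ hΞ0 hS hA hM u
  have hgap : ∀ᶠ k in atTop,
      (N k : ℝ) / n k - ((min (N k) ⌊t' * n k⌋₊ : ℕ) : ℝ) / n k < η ^ 2 * 2 :=
    (h.tendsto_time.sub (tendsto_min_floor_div h.tendsto_cast h.tendsto_time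
      ht'.1 htle)).eventually_lt_const htη
  filter_upwards [hB, hgap, Metric.tendsto_nhds.1 hlim (ε / 3) (by positivity)] with k hBk hgk hlk
  have := h.prob k
  have hm : min (N k) ⌊t' * n k⌋₊ ≤ N k := min_le_left _ _
  have h1 := hBk _ _ hm le_rfl
  rw [sub_div] at h1
  generalize min (N k) ⌊t' * n k⌋₊ = m at *
  have hmeas := (h.walk k).measurable hm
  have hmeas' := (h.walk k).measurable le_rfl
  have hi := (h.walk k).integrable_dotProduct_self hm le_rfl
  have h2 : ‖∫ ω, Complex.exp (Complex.I * ((u ⬝ᵥ W k (N k) ω : ℝ) : ℂ)) ∂(μ k) -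
      ∫ ω, Complex.exp (Complex.I * ((u ⬝ᵥ W k m ω : ℝ) : ℂ)) ∂(μ k)‖ < ε / 3 := by
    refine (norm_integral_exp_sub_integral_exp_le (by unfold dotProduct; fun_prop)
      (by unfold dotProduct; fun_prop) (b := fun ω => q * ‖u‖ * (η / 2 +
        (2 * η)⁻¹ * ((W k (N k) ω - W k m ω) ⬝ᵥ (W k (N k) ω - W k m ω))))
      (((integrable_const _).add (hi.const_mul _)).const_mul _) (ae_of_all _ fun ω => ?_)).trans_lt ?_
    · refine (norm_exp_I_mul_sub_exp_I_mul_le _ _).trans ?_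
      rw [← dotProduct_sub]
      refine (abs_dotProduct_le (fun i => norm_le_pi_norm u i) _).trans ?_
      have h3 := norm_sq_le_dotProduct_self (W k (N k) ω - W k m ω)
      gcongr
      generalize ‖W k (N k) ω - W k m ω‖ = x at h3 ⊢
      have h4 : x ≤ η / 2 + (2 * η)⁻¹ * x ^ 2 := by
        have : η / 2 + (2 * η)⁻¹ * x ^ 2 - x = (2 * η)⁻¹ * (x - η) ^ 2 := by field_simp; ring
        have : 0 ≤ (2 * η)⁻¹ * (x - η) ^ 2 := by positivity
        linarith
      refine h4.trans ?_
      gcongr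
    · rw [integral_const_mul, integral_add (integrable_const _) (hi.const_mul _),
        integral_const_mul]
      simp only [integral_const, probReal_univ, smul_eq_mul, one_mul]
      refine lt_of_le_of_lt ?_ hη
      gcongr
      calc η / 2 + (2 * η)⁻¹ * ∫ ω, (W k (N k) ω - W k m ω) ⬝ᵥ (W k (N k) ω - W k m ω) ∂(μ k)
          ≤ η / 2 + (2 * η)⁻¹ * (B * (η ^ 2 * 2)) := by
            gcongr
            refine h1.trans ?_
            gcongr
        _ = _ := by field_simp
  rw [← dist_eq_norm] at h2
  have h3 := hΦρ t' (by rw [dist_comm, Real.dist_eq, abs_of_nonneg (by linarith)]; exact htρ)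
  calc _ ≤ _ := dist_triangle4 _ (∫ ω, Complex.exp (Complex.I * ((u ⬝ᵥ W k m ω : ℝ) : ℂ)) ∂(μ k))
        (Complex.exp (-(u ⬝ᵥ (S t').mulVec u / 2 : ℝ))) _
    _ < ε := by linarith

end IsDiffusiveArray

/-! ### Positive semidefiniteness of the limit covariance, and Lévy's theorem -/

theorem HasMatrixDerivOn.transpose_eq_of_transpose_eq {q : ℕ} {Ξ V : ℝ → Matrix (Fin q) (Fin q) ℝ}
    {s : ℝ} (h : HasMatrixDerivOn Ξ V (Set.Icc 0 s)) (h0 : Ξ 0 = 0) (hs : 0 ≤ s)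
    (hV : ∀ r ∈ Set.Icc 0 s, (V r).transpose = V r) : (Ξ s).transpose = Ξ s := by
  ext i l
  have h1 := (convex_Icc 0 s).norm_image_sub_le_of_norm_hasDerivWithin_le (C := 0)
    (f := fun r => Ξ r l i - Ξ r i l) (fun r hr => (h r hr l i).sub (h r hr i l))
    (fun r hr => by
      have h2 := congrFun (congrFun (hV r hr) i) l
      rw [Matrix.transpose_apply] at h2
      rw [h2, sub_self, norm_zero]) (Set.left_mem_Icc.2 hs) (Set.right_mem_Icc.2 hs)
  rw [zero_mul, norm_le_zero_iff, h0] at h1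
  simpa [sub_eq_zero] using h1

namespace IsDiffusiveArray

variable {Ω : ℕ → Type*} {mΩ : ∀ k, MeasurableSpace (Ω k)} {q : ℕ}
  {ℱ : ∀ k, Filtration ℕ (mΩ k)} {μ : ∀ k, Measure (Ω k)} {W b : ∀ k, ℕ → Ω k → Fin q → ℝ}
  {c : ∀ k, ℕ → Ω k → Fin q → Fin q → ℝ} {δ : ℕ → ℝ} {n N : ℕ → ℕ}
  {A M T Ξ S : ℝ → Matrix (Fin q) (Fin q) ℝ} {τ : EReal} {t : ℝ}

/-- The matrix `M` is not symmetric by assumption, but the conditional second moments are, and they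
approximate `M` up to `e (1 + W·W)`. Integrating and letting `e → 0` gives symmetry at every `s <
t`, the times the walks actually pass. -/
theorem transpose_eq (h : IsDiffusiveArray ℱ μ W b c δ n N A M τ t)
    (hM : ∀ i l, ContinuousOn (fun s => M s i l) (timeInterval τ)) {s : ℝ}
    (hs : s ∈ timeInterval τ) (hst : s < t) : (M s).transpose = M s := by
  obtain ⟨B, hB0, hB⟩ := h.exists_integral_le
  ext i l
  rw [Matrix.transpose_apply]
  have hfloor : Tendsto (fun k => (⌊s * n k⌋₊ : ℝ) / n k) atTop (𝓝 s) :=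
    (tendsto_nat_floor_mul_div_atTop hs.1).comp h.tendsto_cast
  have hle : ∀ k, (⌊s * n k⌋₊ : ℝ) / n k ≤ s := fun k => by
    have hn : (0 : ℝ) < n k := by exact_mod_cast h.pos k
    rw [div_le_iff₀ hn]
    exact Nat.floor_le (mul_nonneg hs.1 hn.le)
  have hmem : ∀ k, (⌊s * n k⌋₊ : ℝ) / n k ∈ timeInterval τ := fun k =>
    ⟨by positivity, (EReal.coe_le_coe_iff.2 (hle k)).trans_lt hs.2⟩
  have hfloor' := tendsto_nhdsWithin_iff.2 ⟨hfloor, Eventually.of_forall hmem⟩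
  have hlim : Tendsto (fun k => |M ((⌊s * n k⌋₊ : ℝ) / n k) l i - M ((⌊s * n k⌋₊ : ℝ) / n k) i l|)
      atTop (𝓝 |M s l i - M s i l|) :=
    (((hM l i s hs).tendsto.comp hfloor').sub ((hM i l s hs).tendsto.comp hfloor')).abs
  have key : ∀ e > 0, |M s l i - M s i l| ≤ 0 + e := by
    intro e he
    refine le_of_tendsto hlim ?_
    filter_upwards [hB, h.second s hs (e / (2 * (1 + B))) (by positivity),
      (hfloor.eventually_lt h.tendsto_time hst)] with k hBk hsk hlt
    have := h.prob k
    have hn : (0 : ℝ) < n k := by exact_mod_cast h.pos k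
    have hjN : ⌊s * n k⌋₊ < N k := by
      rw [div_lt_div_iff_of_pos_right hn] at hlt
      exact_mod_cast hlt
    have hi := (h.walk k).integrable_dotProduct_self' hjN.le
    have hae : ∀ᵐ ω ∂(μ k), |M ((⌊s * n k⌋₊ : ℝ) / n k) l i - M ((⌊s * n k⌋₊ : ℝ) / n k) i l| ≤
        e / (1 + B) * (1 + W k ⌊s * n k⌋₊ ω ⬝ᵥ W k ⌊s * n k⌋₊ ω) := by
      filter_upwards [hsk _ hjN (hle k)] with ω hω
      have h1 := hω i l
      have h2 := hω l i
      rw [h.second_symm k _ ω l i] at h2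
      have h3 : e / (1 + B) = 2 * (e / (2 * (1 + B))) := by field_simp
      rw [h3]
      rw [abs_le] at *
      constructor <;> linarith
    have hint := integral_mono_ae (integrable_const _)
      (((integrable_const (1 : ℝ)).add hi).const_mul (e / (1 + B))) hae
    rw [integral_const_mul] at hint
    simp only [Pi.add_apply] at hint
    rw [integral_add (integrable_const _) hi] at hint
    simp only [integral_const, probReal_univ, smul_eq_mul, one_mul] at hint
    have h4 := hBk _ hjN.le
    refine hint.trans ?_
    calc _ ≤ e / (1 + B) * (1 + B) := by gcongr
      _ = 0 + e := by field_simp; ring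
  have h0 := le_of_forall_pos_le_add key
  exact sub_eq_zero.1 (abs_eq_zero.1 (le_antisymm h0 (abs_nonneg _)))

/-- The limiting covariance matrix is positive semidefinite. -/
theorem posSemidef (h : IsDiffusiveArray ℱ μ W b c δ n N A M τ t) (hτ : 0 < τ)
    (hT : HasMatrixDerivOn T (fun s => -(T s * A s)) (timeInterval τ))
    (hTinv : ∀ s ∈ timeInterval τ, IsUnit (T s).det)
    (hΞ : HasMatrixDerivOn Ξ (fun s => T s * M s * (T s).transpose) (timeInterval τ))
    (hΞ0 : Ξ 0 = 0)
    (hS : ∀ s ∈ timeInterval τ, S s = (T s)⁻¹ * Ξ s * ((T s)⁻¹).transpose)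
    (hScont : Continuous S)
    (hA : ∀ i l, ContinuousOn (fun s => A s i l) (timeInterval τ))
    (hM : ∀ i l, ContinuousOn (fun s => M s i l) (timeInterval τ)) : (S t).PosSemidef := by
  have ht0 := h.time_nonneg
  refine Matrix.PosSemidef.of_dotProduct_mulVec_nonneg ?_ fun u => ?_
  · rw [Matrix.IsHermitian, Matrix.conjTranspose_eq_transpose_of_trivial]
    rcases ht0.eq_or_lt with h0 | h0
    · rw [← h0, hS 0 (zero_mem_timeInterval hτ), hΞ0]
      simp
    -- The formula for `S` holds only before `τ`, so symmetry is shown on `[0, t)` and reaches `t`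
    -- by continuity.
    · have hcl : IsClosed {s | (S s).transpose = S s} := isClosed_eq hScont.matrix_transpose hScont
      have hsub : Set.Ico 0 t ⊆ {s | (S s).transpose = S s} := by
        intro s hs
        have hsτ : s ∈ timeInterval τ := ⟨hs.1, (EReal.coe_lt_coe_iff.2 hs.2).trans_le h.time_le⟩
        have hIcc : Set.Icc 0 s ⊆ timeInterval τ :=
          (convex_timeInterval τ).ordConnected.out (zero_mem_timeInterval hτ) hsτ
        have hΞs : (Ξ s).transpose = Ξ s :=
          HasMatrixDerivOn.transpose_eq_of_transpose_eq
            (fun r hr i l => (hΞ r (hIcc hr) i l).mono hIcc) hΞ0 hs.1 fun r hr => by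
              rw [Matrix.transpose_mul, Matrix.transpose_mul, Matrix.transpose_transpose,
                h.transpose_eq hM (hIcc hr) (hr.2.trans_lt hs.2), Matrix.mul_assoc]
        rw [Set.mem_ofPred_eq, hS s hsτ, Matrix.transpose_mul, Matrix.transpose_mul,
          Matrix.transpose_transpose, hΞs, Matrix.mul_assoc]
      refine hcl.closure_subset_iff.2 hsub ?_
      rw [closure_Ico h0.ne]
      exact ⟨ht0, le_rfl⟩
  · rw [star_trivial]
    have h1 := h.tendsto_integral_exp hτ hT hTinv hΞ hΞ0 hS hScont hA hM u
    -- A limit of characteristic functions has modulus at most `1`, which forces the quadratic form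
    -- to be nonnegative.
    have h2 : ‖Complex.exp (-(u ⬝ᵥ (S t).mulVec u / 2 : ℝ))‖ ≤ 1 := by
      refine le_of_tendsto h1.norm (Eventually.of_forall fun k => ?_)
      have := h.prob k
      refine (norm_integral_le_of_norm_le_const (C := 1) (ae_of_all _ fun ω => ?_)).trans (by simp)
      rw [mul_comm, Complex.norm_exp_ofReal_mul_I]
    rw [← Complex.ofReal_neg, Complex.norm_exp_ofReal, Real.exp_le_one_iff] at h2
    linarith

end IsDiffusiveArray

/-- Lévy's theorem for a Gaussian limit, in terms of linear functionals. -/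
theorem tendstoInDistribution_multivariateGaussian {Ω : ℕ → Type*}
    {mΩ : ∀ k, MeasurableSpace (Ω k)} {q : ℕ} {μ : ∀ k, Measure (Ω k)}
    [∀ k, IsProbabilityMeasure (μ k)] {Y : ∀ k, Ω k → EuclideanSpace ℝ (Fin q)}
    (hY : ∀ k, Measurable (Y k)) {S : Matrix (Fin q) (Fin q) ℝ} (hS : S.PosSemidef)
    (h : ∀ u : Fin q → ℝ, Tendsto (fun k => ∫ ω, Complex.exp (Complex.I *
      ((u ⬝ᵥ (Y k ω).ofLp : ℝ) : ℂ)) ∂(μ k)) atTop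
      (𝓝 (Complex.exp (-(u ⬝ᵥ S.mulVec u / 2 : ℝ))))) :
    TendstoInDistribution Y atTop (id : EuclideanSpace ℝ (Fin q) → EuclideanSpace ℝ (Fin q)) μ
      (multivariateGaussian 0 S) where
  forall_aemeasurable k := (hY k).aemeasurable
  tendsto := by
    refine ProbabilityMeasure.tendsto_of_tendsto_charFun fun x => ?_
    simp only [ProbabilityMeasure.coe_mk, Measure.map_id, charFun_multivariateGaussian hS]
    have h1 := h x.ofLp
    convert h1 using 2 with k
    · rw [charFun_apply, integral_map (hY k).aemeasurable (by fun_prop)]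
      congr 1
      ext ω
      rw [mul_comm Complex.I, EuclideanSpace.inner_eq_star_dotProduct, star_trivial]
    · rw [inner_zero_right]
      push_cast
      congr 1
      ring

/-! ### From the original processes to diffusive arrays -/

/-- Regularity of the drift `f` and of the second moments `g` on an open domain. -/
structure IsRegularOn {q : ℕ} (D : Set (Fin q → ℝ)) (f : Fin q → (Fin q → ℝ) → ℝ)
    (g : Fin q → Fin q → (Fin q → ℝ) → ℝ) (L : ℝ≥0) (Lg K : ℝ) : Prop where
  isOpen : IsOpen D
  lipschitz : LipschitzOnWith L (driftField f) D
  contDiffOn : ∀ k, ContDiffOn ℝ 1 (f k) D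
  second_sub_le : ∀ v ∈ D, ∀ w ∈ D, ∀ i k, |g i k v - g i k w| ≤ Lg * ‖v - w‖
  Lg_nonneg : 0 ≤ Lg
  K_nonneg : 0 ≤ K
  drift_le : ∀ v ∈ D, ∀ k, |f k v| ≤ K
  second_le : ∀ v ∈ D, ∀ i k, |g i k v| ≤ K

theorem exists_isRegularOn {q : ℕ} {D : Set (Fin q → ℝ)} {f : Fin q → (Fin q → ℝ) → ℝ}
    {g : Fin q → Fin q → (Fin q → ℝ) → ℝ} (hD : IsOpen D) (hDbdd : Bornology.IsBounded D)
    (hf : ∀ k, ∃ K : ℝ≥0, LipschitzOnWith K (f k) D) (hC1 : ∀ k, ContDiffOn ℝ 1 (f k) D)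
    (hg : ∀ i j, ∃ K : ℝ≥0, LipschitzOnWith K (g i j) D) : ∃ L Lg K, IsRegularOn D f g L Lg K := by
  obtain ⟨L, hL⟩ := exists_lipschitzOnWith_driftField hf
  choose Lg hLg using fun i => exists_lipschitzOnWith_driftField (f := g i) (hg i)
  obtain ⟨Kf, hKf0, hKf⟩ := exists_norm_le_of_lipschitzOnWith hDbdd hL
  choose Kg hKg0 hKg using fun i => exists_norm_le_of_lipschitzOnWith hDbdd (hLg i)
  refine ⟨L, ∑ i, (Lg i : ℝ), Kf + ∑ i, Kg i, hD, hL, hC1, fun v hv w hw i k => ?_, by positivity,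
    add_nonneg hKf0 (Finset.sum_nonneg fun i _ => hKg0 i), fun v hv k => ?_, fun v hv i k => ?_⟩
  · have h1 := (hLg i).dist_le_mul v hv w hw
    rw [dist_eq_norm, dist_eq_norm] at h1
    refine ((norm_le_pi_norm (driftField (g i) v - driftField (g i) w) k).trans h1).trans ?_
    gcongr
    exact Finset.single_le_sum (f := fun i => (Lg i : ℝ)) (fun _ _ => NNReal.coe_nonneg _)
      (Finset.mem_univ i)
  · exact ((norm_le_pi_norm (driftField f v) k).trans (hKf v hv)).trans
      (le_add_of_nonneg_right (Finset.sum_nonneg fun i _ => hKg0 i))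
  · refine ((norm_le_pi_norm (driftField (g i) v) k).trans (hKg i v hv)).trans ?_
    have := Finset.single_le_sum (f := Kg) (fun i _ => hKg0 i) (Finset.mem_univ i)
    linarith

/-- A sequence of processes with drift `f` and second moments `g` in `D`, each together with the
solution `zs k` of the differential equation from its initial value, which stays at a distance
`r k` from the boundary of `D` that is large compared to `1 / √n`. -/
structure IsFluidArray {Ω : ℕ → Type*} {mΩ : ∀ k, MeasurableSpace (Ω k)} {q : ℕ}
    (P : ∀ k, Measure (Ω k)) (ℱ : ∀ k, Filtration ℕ (mΩ k)) (X : ∀ k, ℕ → Ω k → Fin q → ℝ)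
    (n N : ℕ → ℕ) (D : Set (Fin q → ℝ)) (f : Fin q → (Fin q → ℝ) → ℝ)
    (g : Fin q → Fin q → (Fin q → ℝ) → ℝ) (β l₁ l₂ r : ℕ → ℝ) (x : Fin q → ℝ)
    (z : ℝ → Fin q → ℝ) (τ : EReal) (xs : ℕ → Fin q → ℝ) (zs : ℕ → ℝ → Fin q → ℝ) (t : ℝ) :
    Prop where
  prob : ∀ k, IsProbabilityMeasure (P k)
  process : ∀ k, HasDriftAndDiffusion (P k) (ℱ k) (X k) (n k) (N k) D f g (β k) (l₁ k) (l₂ k)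
  pos : ∀ k, 0 < n k
  tendsto_n : Tendsto n atTop atTop
  β_nonneg : ∀ k, 0 ≤ β k
  tendsto_β : Tendsto (fun k => (√(n k))⁻¹ * β k) atTop (𝓝 0)
  l₁_nonneg : ∀ k, 0 ≤ l₁ k
  tendsto_l₁ : Tendsto (fun k => √(n k) * l₁ k) atTop (𝓝 0)
  tendsto_l₂ : Tendsto l₂ atTop (𝓝 0)
  sol : IsSolutionOn f D x z (timeInterval τ)
  sols : ∀ k, IsSolutionOn f D (xs k) (zs k) (Set.Icc 0 ((N k : ℝ) / n k))
  tendsto_init : Tendsto xs atTop (𝓝 x)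
  init_ne_zero : ∀ k, P k {ω | X k 0 ω = (n k : ℝ) • xs k} ≠ 0
  le_infDist : ∀ k, ∀ s ∈ Set.Icc 0 ((N k : ℝ) / n k), r k ≤ Metric.infDist (zs k s) (frontier D)
  tendsto_r : Tendsto (fun k => √(n k) * r k) atTop atTop
  tendsto_time : Tendsto (fun k => (N k : ℝ) / n k) atTop (𝓝 t)
  time_le : (t : EReal) ≤ τ

theorem stoppedSecond_symm {Ω : Type*} {mΩ : MeasurableSpace Ω} {q : ℕ} (P : Measure Ω)
    (ℱ : Filtration ℕ mΩ) (n : ℕ) (X : ℕ → Ω → Fin q → ℝ) (D : Set (Fin q → ℝ))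
    (y : ℕ → Fin q → ℝ) (j : ℕ) (ω : Ω) (i l : Fin q) :
    stoppedSecond P ℱ n X D y j ω i l = stoppedSecond P ℱ n X D y j ω l i := by
  have h : (fun ω' => (X (j + 1) ω' i - X j ω' i) * (X (j + 1) ω' l - X j ω' l)) =
      fun ω' => (X (j + 1) ω' l - X j ω' l) * (X (j + 1) ω' i - X j ω' i) :=
    funext fun _ => mul_comm _ _
  rw [stoppedSecond, stoppedSecond, h]
  ring

namespace IsFluidArray

variable {Ω : ℕ → Type*} {mΩ : ∀ k, MeasurableSpace (Ω k)} {q : ℕ}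
    {P : ∀ k, Measure (Ω k)} {ℱ : ∀ k, Filtration ℕ (mΩ k)} {X : ∀ k, ℕ → Ω k → Fin q → ℝ}
    {n N : ℕ → ℕ} {D : Set (Fin q → ℝ)} {f : Fin q → (Fin q → ℝ) → ℝ}
    {g : Fin q → Fin q → (Fin q → ℝ) → ℝ} {β l₁ l₂ r : ℕ → ℝ} {x : Fin q → ℝ}
    {z : ℝ → Fin q → ℝ} {τ : EReal} {xs : ℕ → Fin q → ℝ} {zs : ℕ → ℝ → Fin q → ℝ} {t : ℝ}
    {L : ℝ≥0} {Lg K : ℝ}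

theorem tendsto_sqrt (h : IsFluidArray P ℱ X n N D f g β l₁ l₂ r x z τ xs zs t) :
    Tendsto (fun k => √(n k : ℝ)) atTop atTop :=
  Real.tendsto_sqrt_atTop.comp (tendsto_natCast_atTop_atTop.comp h.tendsto_n)

theorem div_mem_Icc (h : IsFluidArray P ℱ X n N D f g β l₁ l₂ r x z τ xs zs t) {k j : ℕ}
    (hj : j ≤ N k) : (j : ℝ) / n k ∈ Set.Icc 0 ((N k : ℝ) / n k) := by
  have hn : (0 : ℝ) < n k := by exact_mod_cast h.pos k
  refine ⟨by positivity, ?_⟩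
  gcongr

/-- The Euler error of the fluid path is `O(1 / n)`, hence still negligible after multiplication by
`√n`. -/
theorem abs_step_le (h : IsFluidArray P ℱ X n N D f g β l₁ l₂ r x z τ xs zs t)
    (hreg : IsRegularOn D f g L Lg K) {k j : ℕ} (hj : j < N k) (i : Fin q) :
    |(n k : ℝ) * (zs k (((j + 1 : ℕ) : ℝ) / n k) i - zs k ((j : ℝ) / n k) i)| ≤ K ∧
    |(n k : ℝ) * (zs k (((j + 1 : ℕ) : ℝ) / n k) i - zs k ((j : ℝ) / n k) i) -
      f i (zs k ((j : ℝ) / n k))| ≤ L * K / n k := by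
  have hn : (0 : ℝ) < n k := by exact_mod_cast h.pos k
  have hK : ∀ v ∈ D, ‖driftField f v‖ ≤ K := fun v hv =>
    (pi_norm_le_iff_of_nonneg hreg.K_nonneg).2 fun i => hreg.drift_le v hv i
  have hstep : ((j + 1 : ℕ) : ℝ) / n k - (j : ℝ) / n k = 1 / n k := by push_cast; ring
  have hpos : (0 : ℝ) < 1 / n k := by positivity
  have h1 := (h.sols k).norm_sub_le (convex_Icc _ _) hK (h.div_mem_Icc hj.le) (h.div_mem_Icc hj)
  have h2 := (h.sols k).norm_taylor_le (convex_Icc _ _) hK hreg.lipschitz (h.div_mem_Icc hj.le)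
    (h.div_mem_Icc hj) (by linarith)
  rw [hstep, abs_of_pos hpos] at h1
  rw [hstep] at h2
  have h3 := (norm_le_pi_norm _ i).trans h1
  have h4 := (norm_le_pi_norm _ i).trans h2
  rw [Real.norm_eq_abs] at h3 h4
  constructor
  · rw [abs_mul_abs_of_pos hn]
    have h5 := mul_le_mul_of_nonneg_left h3 hn.le
    refine h5.trans (le_of_eq ?_)
    field_simp
  · have h5 := mul_le_mul_of_nonneg_left h4 hn.le
    rw [← abs_mul_abs_of_pos hn] at h5
    have h6 : (n k : ℝ) * (zs k (((j + 1 : ℕ) : ℝ) / n k) - zs k ((j : ℝ) / n k) -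
        (1 / (n k : ℝ)) • driftField f (zs k ((j : ℝ) / n k))) i =
        (n k : ℝ) * (zs k (((j + 1 : ℕ) : ℝ) / n k) i - zs k ((j : ℝ) / n k) i) -
        f i (zs k ((j : ℝ) / n k)) := by
      simp only [Pi.sub_apply, Pi.smul_apply, smul_eq_mul, driftField]
      field_simp
    rw [h6] at h5
    refine h5.trans (le_of_eq ?_)
    field_simp

/-- Each process is centred along its own solution `zs k`, but the limit coefficients are taken
along `z`; Gronwall compares the two up to any `t' < τ`. -/
theorem norm_sub_le (h : IsFluidArray P ℱ X n N D f g β l₁ l₂ r x z τ xs zs t)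
    (hreg : IsRegularOn D f g L Lg K) {t' : ℝ} (ht' : t' ∈ timeInterval τ) {k j : ℕ}
    (hj : j ≤ N k) (hjt : (j : ℝ) / n k ≤ t') :
    ‖zs k ((j : ℝ) / n k) - z ((j : ℝ) / n k)‖ ≤ ‖xs k - x‖ * Real.exp (L * t') := by
  have hmem := h.div_mem_Icc hj
  have hsub : Set.Icc 0 ((j : ℝ) / n k) ⊆ timeInterval τ := fun s hs =>
    ⟨hs.1, (EReal.coe_le_coe_iff.2 (hs.2.trans hjt)).trans_lt ht'.2⟩
  have h1 := ((h.sols k).mono (Set.Icc_subset_Icc_right hmem.2)).dist_le (h.sol.mono hsub)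
    hreg.lipschitz (Set.right_mem_Icc.2 hmem.1)
  rw [dist_eq_norm, dist_eq_norm] at h1
  refine h1.trans ?_
  gcongr

/-- The normalized processes, stopped at the exit from `D`, form a diffusive array. -/
theorem isDiffusiveArray (h : IsFluidArray P ℱ X n N D f g β l₁ l₂ r x z τ xs zs t)
    (hreg : IsRegularOn D f g L Lg K) :
    IsDiffusiveArray ℱ (fun k => ProbabilityTheory.cond (P k) {ω | X k 0 ω = (n k : ℝ) • xs k})
      (fun k => stoppedWalk (n k) (X k) D fun j => zs k ((j : ℝ) / n k))
      (fun k => stoppedDrift (P k) (ℱ k) (n k) (X k) D fun j => zs k ((j : ℝ) / n k))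
      (fun k => stoppedSecond (P k) (ℱ k) (n k) (X k) D fun j => zs k ((j : ℝ) / n k))
      (fun k => (√(n k))⁻¹ * (β k + K)) n N (fun s => jacobian f (z s))
      (fun s => Matrix.of (fun i j => g i j (z s)) -
        Matrix.vecMulVec (driftField f (z s)) (driftField f (z s))) τ t := by
  have hy0 : ∀ k, zs k (((0 : ℕ) : ℝ) / n k) = xs k := fun k => by
    rw [Nat.cast_zero, zero_div, (h.sols k).init]
  have hyD : ∀ k j, j < N k → ∀ i ≤ j, zs k ((i : ℝ) / n k) ∈ D := fun k j hj i hi =>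
    (h.sols k).mem _ (h.div_mem_Icc (hi.trans hj.le))
  have hyr : ∀ k j, j < N k → ∀ i ≤ j,
      r k ≤ Metric.infDist (zs k ((i : ℝ) / n k)) (frontier D) := fun k j hj i hi =>
    h.le_infDist k _ (h.div_mem_Icc (hi.trans hj.le))
  have hcast : Tendsto (fun k => (n k : ℝ)) atTop atTop :=
    tendsto_natCast_atTop_atTop.comp h.tendsto_n
  have hsqrt := h.tendsto_sqrt
  have hκ : ∀ k j, j < N k → ∀ i,
      |(n k : ℝ) * (zs k (((j + 1 : ℕ) : ℝ) / n k) i - zs k ((j : ℝ) / n k) i) -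
      f i (zs k ((j : ℝ) / n k))| ≤ L * K / n k := fun k j hj i => (h.abs_step_le hreg hj i).2
  have hK0 := hreg.K_nonneg
  have hlimκ : Tendsto (fun k => L * K / (n k : ℝ)) atTop (𝓝 0) := hcast.const_div_atTop _
  have hliml₁ : Tendsto l₁ atTop (𝓝 0) := by
    have h1 := hsqrt.inv_tendsto_atTop.mul h.tendsto_l₁
    rw [zero_mul] at h1
    refine h1.congr fun k => ?_
    have : 0 < √(n k : ℝ) := Real.sqrt_pos.2 (by exact_mod_cast h.pos k)
    rw [Pi.inv_apply, ← mul_assoc, inv_mul_cancel₀ this.ne', one_mul]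
  -- This is where `λ₁ = o(n^{-1/2})` is needed: centring at scale `√n` magnifies the drift error by
  -- `√n`.
  have hlimdrift : Tendsto (fun k => √(n k) * (l₁ k + L * K / n k)) atTop (𝓝 0) := by
    have h1 := h.tendsto_l₁.add (hsqrt.const_div_atTop (L * K))
    rw [zero_add] at h1
    refine h1.congr fun k => ?_
    have hn : (0 : ℝ) < n k := by exact_mod_cast h.pos k
    have h2 : √(n k : ℝ) * (L * K / n k) = L * K / √(n k) := by
      have h3 : √(n k : ℝ) * √(n k) = n k := Real.mul_self_sqrt hn.le
      have : 0 < √(n k : ℝ) := Real.sqrt_pos.2 hn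
      rw [mul_div_assoc', div_eq_div_iff hn.ne' this.ne', mul_right_comm, h3, mul_comm]
    rw [mul_add, h2]
  have hrpos : ∀ᶠ k in atTop, 0 < r k := by
    filter_upwards [h.tendsto_r.eventually_gt_atTop 0] with k hk
    exact pos_of_mul_pos_right hk (Real.sqrt_nonneg _)
  have hzeta : ∀ c : ℝ, Tendsto (fun k => ‖xs k - x‖ * Real.exp c) atTop (𝓝 0) := fun c => by
    have h1 := ((h.tendsto_init.sub_const x).norm).mul_const (Real.exp c)
    simpa using h1
  refine ⟨fun k => ?_, fun k => ?_, h.pos, h.tendsto_n, ?_, h.tendsto_time, h.time_le,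
    ⟨L, L.2, ?_⟩, ⟨4 * (K + 1) ^ 2, by positivity, ?_⟩, ?_, ?_,
    fun k j ω i l => stoppedSecond_symm _ _ _ _ _ _ _ _ _ _⟩
  · have := h.prob k
    exact cond_isProbabilityMeasure (h.init_ne_zero k)
  · have := h.prob k
    have h1 := (h.process k).isAdaptedWalk (h.pos k) hreg.isOpen le_rfl
      (y := fun j => zs k ((j : ℝ) / n k)) (V := K)
      (by rw [hy0]; exact h.init_ne_zero k) (h.β_nonneg k) hK0
      fun j hj i => (h.abs_step_le hreg hj i).1
    simpa only [hy0] using h1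
  · have h1 := h.tendsto_β.add (hsqrt.inv_tendsto_atTop.mul_const K)
    rw [zero_mul, zero_add] at h1
    exact h1.congr fun k => (mul_add _ _ _).symm
  · filter_upwards [hlimdrift.eventually_lt_const one_pos] with k hk j hj
    exact ae_cond_of_ae ((h.process k).abs_stoppedDrift_le (h.pos k) hj hreg.lipschitz
      (hyD k j hj j le_rfl) (hκ k j hj) (h.l₁_nonneg k) hk.le)
  · filter_upwards [hlimκ.eventually_lt_const one_pos, hliml₁.eventually_lt_const one_pos,
      h.tendsto_l₂.eventually_lt_const one_pos] with k h1 h2 h3 j hj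
    exact ae_cond_of_ae ((h.process k).stoppedSecond_self_le (h.pos k) hj hreg.drift_le
      hreg.second_le (hyD k j hj j le_rfl) (hκ k j hj) h2.le h3.le h1.le)
  · intro t' ht' e he
    have hsub : Set.Icc 0 t' ⊆ timeInterval τ := fun s hs =>
      ⟨hs.1, (EReal.coe_le_coe_iff.2 hs.2).trans_lt ht'.2⟩
    -- Up to `t' < τ` the path `z` traces a compact subset of `D`, so the linearization is uniform;
    -- its quadratic constant `C` is fixed before `k` and `C / √n → 0`.
    obtain ⟨C, hC, ρ, hρ, hlin⟩ := exists_linearization hreg.isOpen hreg.lipschitz hreg.contDiffOn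
      (S := z '' Set.Icc 0 t') (isCompact_Icc.image_of_continuousOn (h.sol.continuousOn.mono hsub))
      (by rintro _ ⟨s, hs, rfl⟩; exact h.sol.mem s (hsub hs)) (η := e / 2) (by positivity)
    filter_upwards [hrpos, (hzeta (L * t')).eventually_lt_const hρ,
      (hlimdrift.add (hsqrt.const_div_atTop C)).eventually_lt_const
        (show (0 : ℝ) + 0 < e / 2 by linarith),
      (h.tendsto_r.const_div_atTop (q * (L : ℝ))).eventually_lt_const he]
      with k hrk hζk he1 he2 j hj hjt
    have hmem : (j : ℝ) / n k ∈ Set.Icc 0 t' := ⟨by positivity, hjt⟩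
    exact ae_cond_of_ae ((h.process k).abs_stoppedDrift_sub_le (h.pos k) hj hreg.isOpen
      (hyD k j hj) (hκ k j hj) hrk (hyr k j hj)
      (fun i l => abs_jacobian_le hreg.isOpen hreg.lipschitz (h.sol.mem _ (hsub hmem)) i l) hC.le
      (half_pos he).le (hlin _ ⟨_, hmem, rfl⟩ _ (hyD k j hj j le_rfl)
        ((h.norm_sub_le hreg ht' hj.le hjt).trans hζk.le)) (by linarith) he2.le)
  · intro t' ht' e he
    have hsub : Set.Icc 0 t' ⊆ timeInterval τ := fun s hs =>
      ⟨hs.1, (EReal.coe_le_coe_iff.2 hs.2).trans_lt ht'.2⟩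
    have hζ := hzeta (L * t')
    have hp := hlimκ.add (hζ.const_mul (L : ℝ))
    have hs := (((h.tendsto_l₂.add (hζ.const_mul Lg)).add
      ((hliml₁.add (hζ.const_mul (L : ℝ))).const_mul (2 * K + 2))).add hp).add
      (hsqrt.const_div_atTop (Lg + (2 * K + 2) * L))
    have hr2 : Tendsto (fun k => (K + K ^ 2) / (√(n k) * r k) ^ 2) atTop (𝓝 0) :=
      ((tendsto_pow_atTop two_ne_zero).comp h.tendsto_r).const_div_atTop _
    simp only [mul_zero, add_zero] at hp hs
    filter_upwards [hrpos, hp.eventually_lt_const one_pos, hs.eventually_lt_const he,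
      hr2.eventually_lt_const he] with k hrk hpk he1 he2 j hj hjt
    have hmem : (j : ℝ) / n k ∈ Set.Icc 0 t' := ⟨by positivity, hjt⟩
    exact ae_cond_of_ae ((h.process k).abs_stoppedSecond_sub_le (h.pos k) hj hreg.isOpen
      hreg.lipschitz hreg.second_sub_le hreg.Lg_nonneg (hyD k j hj) (hκ k j hj) hrk (hyr k j hj)
      hreg.drift_le hreg.second_le (h.sol.mem _ (hsub hmem)) (h.norm_sub_le hreg ht' hj.le hjt)
      hpk.le he1.le he2.le)

end IsFluidArray

theorem measurable_normalized {Ω : Type*} {mΩ : MeasurableSpace Ω} {q : ℕ} {n m : ℕ}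
    {X : ℕ → Ω → Fin q → ℝ} (hX : Measurable (X m)) (z : ℝ → Fin q → ℝ) :
    Measurable (normalized n X z m) := by
  refine (WithLp.measurable_toLp 2 _).comp (measurable_pi_iff.2 fun i => ?_)
  exact (((measurable_pi_apply i).comp hX).sub_const _).div_const _

theorem normalized_eq_stoppedWalk {Ω : Type*} {q : ℕ} {n m : ℕ} {X : ℕ → Ω → Fin q → ℝ}
    {D : Set (Fin q → ℝ)} {z : ℝ → Fin q → ℝ} {ω : Ω} (h : ∀ i < m, ω ∈ inDomain n X D i) :
    (normalized n X z m ω).ofLp = stoppedWalk n X D (fun j => z ((j : ℝ) / n)) m ω := by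
  ext i
  rw [stoppedWalk_eq h, mul_comm, ← div_eq_mul_inv]
  rfl

/-- The Jacobian and `G - F Fᵀ` are bounded on all of `D`, so the linear systems have continuous
solutions up to and beyond `τ`. -/
theorem exists_isCovarianceSystem_of_isRegularOn {q : ℕ} {D : Set (Fin q → ℝ)}
    {f : Fin q → (Fin q → ℝ) → ℝ} {g : Fin q → Fin q → (Fin q → ℝ) → ℝ} {L : ℝ≥0} {Lg K : ℝ}
    (hreg : IsRegularOn D f g L Lg K) {x : Fin q → ℝ} {z : ℝ → Fin q → ℝ} {τ : EReal} (hτ : 0 < τ)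
    (hz : IsSolutionOn f D x z (timeInterval τ)) :
    ContinuousOn (fun s => jacobian f (z s)) (timeInterval τ) ∧
    ContinuousOn (fun s => (Matrix.of (fun i j => g i j (z s)) -
      Matrix.vecMulVec (driftField f (z s)) (driftField f (z s)) : Matrix (Fin q) (Fin q) ℝ))
      (timeInterval τ) ∧
    ∃ T Ξ S, Continuous S ∧ IsCovarianceSystem f g z (timeInterval τ) T Ξ S := by
  have hmaps : Set.MapsTo z (timeInterval τ) D := hz.mem
  have hJ : ContinuousOn (fun s => jacobian f (z s)) (timeInterval τ) :=
    continuousOn_pi.2 fun i => continuousOn_pi.2 fun j =>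
      (((hreg.contDiffOn i).continuousOn_fderiv_of_isOpen hreg.isOpen le_rfl).comp hz.continuousOn
        hmaps).clm_apply continuousOn_const
  have hf : ∀ i, ContinuousOn (fun s => f i (z s)) (timeInterval τ) := fun i =>
    (hreg.contDiffOn i).continuousOn.comp hz.continuousOn hmaps
  have hg : ∀ i j, ContinuousOn (fun s => g i j (z s)) (timeInterval τ) := fun i j =>
    (LipschitzOnWith.of_dist_le_mul (K := Lg.toNNReal) (fun v hv w hw => by
      rw [Real.dist_eq, dist_eq_norm, Real.coe_toNNReal _ hreg.Lg_nonneg]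
      exact hreg.second_sub_le v hv w hw i j)).continuousOn.comp hz.continuousOn hmaps
  have hM : ContinuousOn (fun s => (Matrix.of (fun i j => g i j (z s)) -
      Matrix.vecMulVec (driftField f (z s)) (driftField f (z s)) : Matrix (Fin q) (Fin q) ℝ))
      (timeInterval τ) :=
    continuousOn_pi.2 fun i => continuousOn_pi.2 fun j => (hg i j).sub ((hf i).mul (hf j))
  have hK0 := hreg.K_nonneg
  refine ⟨hJ, hM, exists_isCovarianceSystem hτ f g z hJ hM (K := L + K + K * K) (by positivity)
    (fun s hs i j => ?_) fun s hs i j => ?_⟩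
  · have := abs_jacobian_le hreg.isOpen hreg.lipschitz (hz.mem s hs) i j
    have : 0 ≤ K * K := by positivity
    linarith
  · have h1 := hreg.second_le _ (hz.mem s hs) i j
    have h2 : |f i (z s) * f j (z s)| ≤ K * K := by
      rw [abs_mul]
      have := hreg.drift_le _ (hz.mem s hs) i
      have := hreg.drift_le _ (hz.mem s hs) j
      gcongr
    have := NNReal.coe_nonneg L
    have := abs_sub (g i j (z s)) (f i (z s) * f j (z s))
    linarith

namespace IsFluidArray

variable {Ω : ℕ → Type*} {mΩ : ∀ k, MeasurableSpace (Ω k)} {q : ℕ}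
    {P : ∀ k, Measure (Ω k)} {ℱ : ∀ k, Filtration ℕ (mΩ k)} {X : ∀ k, ℕ → Ω k → Fin q → ℝ}
    {n N : ℕ → ℕ} {D : Set (Fin q → ℝ)} {f : Fin q → (Fin q → ℝ) → ℝ}
    {g : Fin q → Fin q → (Fin q → ℝ) → ℝ} {β l₁ l₂ r : ℕ → ℝ} {x : Fin q → ℝ}
    {z : ℝ → Fin q → ℝ} {τ : EReal} {xs : ℕ → Fin q → ℝ} {zs : ℕ → ℝ → Fin q → ℝ} {t : ℝ}
    {L : ℝ≥0} {Lg K : ℝ}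

/-- Stopping at the exit from `D` does not change the limits of characteristic functions. -/
theorem tendsto_integral_exp_normalized
    (h : IsFluidArray P ℱ X n N D f g β l₁ l₂ r x z τ xs zs t) (hreg : IsRegularOn D f g L Lg K)
    (u : Fin q → ℝ) {φ : ℂ}
    (hφ : Tendsto (fun k => ∫ ω, Complex.exp (Complex.I * ((u ⬝ᵥ stoppedWalk (n k) (X k) D
      (fun j => zs k ((j : ℝ) / n k)) (N k) ω : ℝ) : ℂ))
      ∂(ProbabilityTheory.cond (P k) {ω | X k 0 ω = (n k : ℝ) • xs k})) atTop (𝓝 φ)) :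
    Tendsto (fun k => ∫ ω, Complex.exp (Complex.I *
      ((u ⬝ᵥ (normalized (n k) (X k) (zs k) (N k) ω).ofLp : ℝ) : ℂ))
      ∂(ProbabilityTheory.cond (P k) {ω | X k 0 ω = (n k : ℝ) • xs k})) atTop (𝓝 φ) := by
  have hA := h.isDiffusiveArray hreg
  obtain ⟨B, hB0, hB⟩ := hA.exists_integral_le
  refine (tendsto_iff_of_dist ?_).1 hφ
  have hbd : Tendsto (fun k => 2 * B / (√(n k) * r k) ^ 2) atTop (𝓝 0) :=
    ((tendsto_pow_atTop two_ne_zero).comp h.tendsto_r).const_div_atTop _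
  refine squeeze_zero' (Eventually.of_forall fun _ => dist_nonneg) ?_ hbd
  filter_upwards [hB, h.tendsto_r.eventually_gt_atTop 0] with k hBk hrk
  have := hA.prob k
  have hmeas := (hA.walk k).measurable le_rfl
  have hmeas' : Measurable (normalized (n k) (X k) (zs k) (N k)) :=
    measurable_normalized (((h.process k).meas _ le_rfl).mono ((ℱ k).le _) le_rfl) _
  have hmeas_dot : Measurable fun ω => u ⬝ᵥ (normalized (n k) (X k) (zs k) (N k) ω).ofLp :=
    Finset.measurable_sum _ fun i _ => Measurable.const_mul
      ((measurable_pi_apply i).comp ((WithLp.measurable_ofLp 2 _).comp hmeas')) (u i)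
  have hi := (hA.walk k).integrable_dotProduct_self' le_rfl
  have hint := hi.const_mul (2 / (√(n k) * r k) ^ 2)
  rw [dist_eq_norm]
  refine (norm_integral_exp_sub_integral_exp_le (by unfold dotProduct; fun_prop) hmeas_dot
    hint (ae_of_all _ fun ω => ?_)).trans ?_
  · by_cases hω : ω ∈ inDomain (n k) (X k) D (N k)
    · rw [normalized_eq_stoppedWalk fun i hi => inDomain_anti hi.le hω, sub_self, norm_zero]
      have := dotProduct_self_nonneg' (stoppedWalk (n k) (X k) D (fun j => zs k ((j : ℝ) / n k))
        (N k) ω)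
      positivity
    -- Chebyshev in pointwise form: outside `inDomain` the frozen walk satisfies `W·W ≥ (√n r)²`, so
    -- the trivial bound `2` is at most `2 W·W / (√n r)²`.
    · refine (norm_exp_I_mul_sub_exp_I_mul_le_two _ _).trans ?_
      have h1 : √(n k) * r k ≤ _ := le_norm_stoppedWalk (h.pos k) hreg.isOpen hω
        (y := fun j => zs k ((j : ℝ) / n k)) (fun i hi => (h.sols k).mem _ (h.div_mem_Icc hi))
        fun i hi => h.le_infDist k _ (h.div_mem_Icc hi)
      have h2 := norm_sq_le_dotProduct_self (stoppedWalk (n k) (X k) D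
        (fun j => zs k ((j : ℝ) / n k)) (N k) ω)
      have h3 := (pow_le_pow_left₀ hrk.le h1 2).trans h2
      rw [div_mul_eq_mul_div, le_div_iff₀ (by positivity)]
      gcongr
  · rw [integral_const_mul, mul_div_right_comm]
    have := hBk _ le_rfl
    gcongr

end IsFluidArray

/-! ### The main theorem -/

/-- The steps of the normalized walk vanish, because `1/12 - ε ≤ 1/2`. -/
theorem tendsto_inv_sqrt_mul_of_isLittleO {β : ℕ → ℝ}
    (hβ : ∃ ε : ℝ, 0 < ε ∧ β =o[atTop] fun n : ℕ => (n : ℝ) ^ ((1 : ℝ) / 12 - ε)) :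
    Tendsto (fun n : ℕ => (√(n : ℝ))⁻¹ * β n) atTop (𝓝 0) := by
  obtain ⟨ε, hε, h⟩ := hβ
  have h1 : (fun n : ℕ => (n : ℝ) ^ ((1 : ℝ) / 12 - ε)) =O[atTop] fun n : ℕ => √(n : ℝ) := by
    refine IsBigO.of_bound 1 ?_
    filter_upwards [eventually_ge_atTop 1] with n hn
    have hn' : (1 : ℝ) ≤ n := by exact_mod_cast hn
    rw [one_mul, Real.norm_of_nonneg (by positivity), Real.norm_of_nonneg (by positivity),
      Real.sqrt_eq_rpow]
    exact Real.rpow_le_rpow_of_exponent_le hn' (by linarith)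
  refine (h.trans_isBigO h1).tendsto_div_nhds_zero.congr fun n => ?_
  rw [div_eq_inv_mul]

theorem tendsto_sqrt_mul_abs_of_isLittleO {l : ℕ → ℝ}
    (hl : l =o[atTop] fun n : ℕ => (n : ℝ) ^ (-(1 : ℝ) / 2)) :
    Tendsto (fun n : ℕ => √(n : ℝ) * |l n|) atTop (𝓝 0) := by
  have h1 := hl.tendsto_div_nhds_zero.abs
  rw [abs_zero] at h1
  refine h1.congr fun n => ?_
  rw [neg_div, Real.rpow_neg (Nat.cast_nonneg n), ← Real.sqrt_eq_rpow, div_inv_eq_mul, abs_mul,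
    abs_of_nonneg (Real.sqrt_nonneg _), mul_comm]

theorem theorem2 {q : ℕ} (hq : 1 ≤ q)
    -- probability spaces, filtrations and processes, for `n ≥ 1`
    {Ω : ℕ → Type*} [∀ n, MeasurableSpace (Ω n)] (P : ∀ n, Measure (Ω n))
    [∀ n, IsProbabilityMeasure (P n)]
    (mbar : ℕ → ℕ) (hmbar : (fun n : ℕ => (mbar n : ℝ)) =O[atTop] fun n : ℕ => (n : ℝ))
    (ℱ : ∀ n, Filtration ℕ (inferInstance : MeasurableSpace (Ω n)))
    (X : ∀ n, ℕ → Ω n → Fin q → ℝ)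
    (hX : ∀ n, 0 < n → ∀ m ≤ mbar n, Measurable[ℱ n m] (X n m))
    -- the conditional expectations below are meaningful
    (hL2 : ∀ n, 0 < n → ∀ m < mbar n, ∀ k,
      MemLp (fun ω => X n (m + 1) ω k - X n m ω k) 2 (P n))
    (C₀ : ℝ) (hC₀ : ∀ n, 0 < n → ∀ m ≤ mbar n, ∀ k, ∀ᵐ ω ∂(P n), X n m ω k ≤ C₀ * (n : ℝ))
    -- the domain
    (D : Set (Fin q → ℝ)) (hDopen : IsOpen D) (hDconn : IsConnected D)
    (hDbdd : Bornology.IsBounded D) (hDinit : closure (initialValues P X) ⊆ D)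
    -- (i) bounded steps
    (β : ℕ → ℝ) (hβ1 : ∀ n, 0 < n → 1 ≤ β n)
    (hβ : ∃ ε : ℝ, 0 < ε ∧ β =o[atTop] fun n : ℕ => (n : ℝ) ^ ((1 : ℝ) / 12 - ε))
    (hstep : ∀ n, 0 < n → ∀ m < mbar n, ∀ᵐ ω ∂(P n),
      (m : ℕ∞) < exitTime n (X n) D ω → ‖X n (m + 1) ω - X n m ω‖ ≤ β n)
    -- (ii) conditional drift
    (f : Fin q → (Fin q → ℝ) → ℝ) (lam₁ : ℕ → ℝ)
    (hlam₁ : lam₁ =o[atTop] fun n : ℕ => (n : ℝ) ^ (-(1 : ℝ) / 2))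
    (hdrift : ∀ n, 0 < n → ∀ m < mbar n, ∀ k, ∀ᵐ ω ∂(P n),
      (m : ℕ∞) < exitTime n (X n) D ω →
        |((P n)[fun ω' => X n (m + 1) ω' k - X n m ω' k | ℱ n m]) ω
          - f k ((n : ℝ)⁻¹ • X n m ω)| ≤ lam₁ n)
    -- (iii) Lipschitz and continuously differentiable drift functions
    (hfLip : ∀ k, ∃ K : ℝ≥0, LipschitzOnWith K (f k) D)
    (hfC1 : ∀ k, ContDiffOn ℝ 1 (f k) D)
    -- (ii') conditional second moments
    (g : Fin q → Fin q → (Fin q → ℝ) → ℝ) (lam₂ : ℕ → ℝ) (hlam₂ : Tendsto lam₂ atTop (𝓝 0))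
    (hsecond : ∀ n, 0 < n → ∀ m < mbar n, ∀ i j, ∀ᵐ ω ∂(P n),
      (m : ℕ∞) < exitTime n (X n) D ω →
        |((P n)[fun ω' => (X n (m + 1) ω' i - X n m ω' i) * (X n (m + 1) ω' j - X n m ω' j)
            | ℱ n m]) ω - g i j ((n : ℝ)⁻¹ • X n m ω)| ≤ lam₂ n)
    -- (iii')
    (hgLip : ∀ i j, ∃ K : ℝ≥0, LipschitzOnWith K (g i j) D) :
    -- for the solution `z` from an initial point `x`, on any interval `[0, τ)` on which it exists
    ∀ (x : Fin q → ℝ) (z : ℝ → Fin q → ℝ) (τ : EReal), 0 < τ →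
      IsSolutionOn f D x z (timeInterval τ) →
      ∃ T Ξ S : ℝ → Matrix (Fin q) (Fin q) ℝ,
        Continuous S ∧ IsCovarianceSystem f g z (timeInterval τ) T Ξ S ∧
        -- along any indices `n k → ∞`, initial values `x k → x` of positive probability and
        -- numbers of steps `m k ≤ σ n k`, `m k ≤ mbar (n k)`, with `m k / n k → t ≤ τ`
        ∀ (lam : ℕ → ℝ), Tendsto (fun n : ℕ => lam n * Real.sqrt (n : ℝ)) atTop atTop →
        ∀ (C : ℝ), 0 < C →
        ∀ (n m : ℕ → ℕ) (xs : ℕ → Fin q → ℝ) (zs : ℕ → ℝ → Fin q → ℝ) (t : ℝ),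
          (∀ k, 0 < n k) → Tendsto n atTop atTop →
          ∀ hxs : ∀ k, P (n k) {ω | X (n k) 0 ω = (n k : ℝ) • xs k} ≠ 0,
          Tendsto xs atTop (𝓝 x) →
          (∀ k, IsSolutionOn f D (xs k) (zs k) (Set.Icc 0 ((m k : ℝ) / (n k : ℝ)))) →
          (∀ k, m k ≤ mbar (n k)) →
          (∀ k, (((m k : ℝ) / (n k : ℝ) : ℝ) : EReal) ≤ sigma f D (xs k) (C * lam (n k))) →
          Tendsto (fun k => (m k : ℝ) / (n k : ℝ)) atTop (𝓝 t) → (t : EReal) ≤ τ →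
          -- conditionally on `X_{n,0} = n x k`, the normalized vector tends to `N(0, Σ(t))`
          haveI : ∀ k, IsProbabilityMeasure
              (ProbabilityTheory.cond (P (n k)) {ω | X (n k) 0 ω = (n k : ℝ) • xs k}) :=
            fun k => cond_isProbabilityMeasure (hxs k)
          (S t).PosSemidef ∧
          TendstoInDistribution (fun k => normalized (n k) (X (n k)) (zs k) (m k)) atTop
            (id : EuclideanSpace ℝ (Fin q) → EuclideanSpace ℝ (Fin q))
            (fun k => ProbabilityTheory.cond (P (n k)) {ω | X (n k) 0 ω = (n k : ℝ) • xs k})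
            (multivariateGaussian 0 (S t)) := by
  obtain ⟨L, Lg, K, hreg⟩ := exists_isRegularOn hDopen hDbdd hfLip hfC1 hgLip
  intro x z τ hτ hz
  obtain ⟨hJ, hM, T, Ξ, S, hSc, hsys⟩ := exists_isCovarianceSystem_of_isRegularOn hreg hτ hz
  refine ⟨T, Ξ, S, hSc, hsys, ?_⟩
  intro lam hlam C hC n m xs zs t hn hnt hxs hxsx hzs hm hσ hmt htτ
  -- The margin from the boundary is `r = C λ(n)`, for which `√n r → ∞`. Absolute values make the
  -- error bounds nonnegative for every index.
  have hfluid : IsFluidArray (fun k => P (n k)) (fun k => ℱ (n k)) (fun k => X (n k)) n m D f g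
      (fun k => β (n k)) (fun k => |lam₁ (n k)|) (fun k => |lam₂ (n k)|)
      (fun k => C * lam (n k)) x z τ xs zs t :=
    { prob := fun k => inferInstance
      process := fun k =>
        { meas := fun j hj => hX _ (hn k) j (hj.trans (hm k))
          memLp := fun j hj => hL2 _ (hn k) j (hj.trans_le (hm k))
          step := fun j hj => by
            filter_upwards [hstep _ (hn k) j (hj.trans_le (hm k))] with ω hω hmem
            -- The increment leading to time `j + 1` is controlled when `j + 1 ≤ H_D`, that is `j <
            -- H_D`, that is when there is no exit up to time `j`.
            exact hω (mem_inDomain_iff.1 hmem)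
          drift := fun j hj i => by
            filter_upwards [hdrift _ (hn k) j (hj.trans_le (hm k)) i] with ω hω hmem
            exact (hω (mem_inDomain_iff.1 hmem)).trans (le_abs_self _)
          second := fun j hj i l => by
            filter_upwards [hsecond _ (hn k) j (hj.trans_le (hm k)) i l] with ω hω hmem
            exact (hω (mem_inDomain_iff.1 hmem)).trans (le_abs_self _) }
      pos := hn
      tendsto_n := hnt
      β_nonneg := fun k => zero_le_one.trans (hβ1 _ (hn k))
      tendsto_β := (tendsto_inv_sqrt_mul_of_isLittleO hβ).comp hnt
      l₁_nonneg := fun k => abs_nonneg _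
      tendsto_l₁ := (tendsto_sqrt_mul_abs_of_isLittleO hlam₁).comp hnt
      tendsto_l₂ := by simpa using (hlam₂.comp hnt).abs
      sol := hz
      sols := hzs
      tendsto_init := hxsx
      init_ne_zero := hxs
      le_infDist := fun k s hs =>
        (hzs k).le_infDist_of_le_sigma (by positivity) hreg.lipschitz (hσ k) hs
      tendsto_r := ((hlam.comp hnt).const_mul_atTop hC).congr fun k => by
        simp only [Function.comp_apply]; ring
      tendsto_time := hmt
      time_le := htτ }
  have hA := hfluid.isDiffusiveArray hreg
  have hJ' := fun i l => continuousOn_pi.1 (continuousOn_pi.1 hJ i) l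
  have hM' := fun i l => continuousOn_pi.1 (continuousOn_pi.1 hM i) l
  have hpsd : (S t).PosSemidef := hA.posSemidef hτ hsys.T_deriv hsys.T_inv hsys.Ξ_deriv hsys.Ξ_zero
    hsys.S_eq hSc hJ' hM'
  have hprob := hA.prob
  refine ⟨hpsd, tendstoInDistribution_multivariateGaussian (fun k => measurable_normalized
    ((hX _ (hn k) _ (hm k)).mono ((ℱ (n k)).le _) le_rfl) _) hpsd fun u => ?_⟩
  exact hfluid.tendsto_integral_exp_normalized hreg u (hA.tendsto_integral_exp hτ hsys.T_deriv
    hsys.T_inv hsys.Ξ_deriv hsys.Ξ_zero hsys.S_eq hSc hJ' hM' u)
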